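/- **Setting.** Let $p$ be an odd prime, $F_0/\mathbb{Q}_p$ a finite extension with ring of integers $O_{F_0}$, uniformizer $\varpi$ and residue field of cardinality $q$, and let $F/F_0$ be the unramified quadratic extension, with ring of integers $O_F$, Galois conjugation $a\mapsto\bar a$, normalized valuation $v$, attached quadratic character $\eta$ of $F_0^\times$ (trivial exactly on norms from $F^\times$), and $\widetilde\eta(x)=(-1)^{v(x)}$ on $F^\times$. Let $n\ge 2$; embed $\mathrm{GL}_{n-1}$ in $\mathrm{GL}_n$ by $h\mapsto\mathrm{diag}(h,1)$ and put $e=(0,\dots,0,1)$. A matrix $\gamma\in\mathrm{M}_n(F)$ is *regular semi-simple* (rs) if $\{\gamma^ie\}_{i=0}^{n-1}$ and $\{{}^t\gamma^ie\}_{i=0}^{n-1}$ are each linearly independent. **Linear side.** Let $S=\{\gamma\in\mathrm{GL}_n(F)\mid\gamma\bar\gamma=1\}$, $\mathfrak{s}=\{y\in\mathrm{M}_n(F)\mid y+\bar y=0\}$, $G'=\mathrm{GL}_{n-1}(F)\times\mathrm{GL}_n(F)$, and $r(\gamma)=\gamma\bar\gamma^{-1}$. Let $\mathfrak{s}(O_{F_0})=\mathfrak{s}\cap\mathrm{M}_n(O_F)$.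 Let $K_0(\varpi)\subset\mathrm{GL}_n(O_F)$ be the subgroup of matrices whose upper right $(n-1)\times1$ block is $\equiv0\bmod\varpi$; let $K'=S\cap K_0(\varpi)$, and let $\mathfrak{k}'$ be the set of $y\in\mathfrak{s}(O_{F_0})$ with upper right $(n-1)\times 1$ block $\equiv 0\bmod\varpi$. For rs $\gamma\in S$, resp. $y\in\mathfrak{s}$, put $$\mathrm{Orb}(\gamma,f')=\int_{\mathrm{GL}_{n-1}(F_0)}f'(h^{-1}\gamma h)\,\eta(\det h)\,dh,\qquad \mathrm{Orb}(y,\phi')=\int_{\mathrm{GL}_{n-1}(F_0)}\phi'(h^{-1}yh)\,\eta(\det h)\,dh,$$ $$\omega_S(\gamma)=\widetilde\eta\bigl(\det(\gamma)^{-\lfloor n/2\rfloor}\det(\gamma^ie)_{0\le i\le n-1}\bigr),\qquad \omega_{\mathfrak s}(y)=\widetilde\eta\bigl(\det(y^ie)_{0\le i\le n-1}\bigr).$$ Call $\gamma=(\gamma_1,\gamma_2)\in G'$ rs if $r(\gamma_1^{-1}\gamma_2)\in S$ is; for such $\gamma$ put $$\mathrm{Orb}(\gamma,f')=\int f'(h_1^{-1}\gamma_1h_2',\,h_1^{-1}\gamma_2h_2'')\,\eta(\det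 h_2')^n\,\eta(\det h_2'')^{n-1}\,dh_1\,dh_2'\,dh_2''$$ over $h_1\in\mathrm{GL}_{n-1}(F)$, $h_2'\in\mathrm{GL}_{n-1}(F_0)$, $h_2''\in\mathrm{GL}_n(F_0)$, and let $\omega_{G'}(\gamma)$ be $\omega_S(r(\gamma_1^{-1}\gamma_2))$ if $n$ is odd and $\widetilde\eta(\det\gamma_1^{-1}\gamma_2)\,\omega_S(r(\gamma_1^{-1}\gamma_2))$ if $n$ is even. The Haar measures give $\mathrm{GL}_{n-1}(O_{F_0})$, $\mathrm{GL}_n(O_{F_0})$ and $\mathrm{GL}_{n-1}(O_F)$ volume $1$. **Unitary side.** Let $W_0$, $W_1$ be the split and the non-split $F/F_0$-hermitian spaces of dimension $n$ (an $n$-dimensional space is split if $(-1)^{n(n-1)/2}$ times its Gram determinant is a norm from $F^\times$), with special vectors $u_i\in W_i$ of a common norm $(u_i,u_i)=\epsilon\in F_0^\times$; let $W_i^\flat=u_i^\perp$, $H_i=\mathrm{U}(W_i^\flat)$, $G_i=\mathrm{U}(W_i)\supset H_i$, and $\mathfrak{g}_i=\mathrm{Lie}\,G_i$. A basis of $W_i^\flat$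 completed by $u_i$ identifies $G_i$ and $\mathfrak g_i$ with sets of $n\times n$ matrices; elements of $G_i$ or $\mathfrak{g}_i$ are rs if the resulting matrices are, and rs elements $g\in G_i$ and $\gamma\in S$ (resp. $x\in\mathfrak g_i$ and $y\in\mathfrak s$) *match* if their matrices are conjugate under $\mathrm{GL}_{n-1}(F)$. An element $(g_1,g_2)\in H_i\times G_i$ is rs if $g_1^{-1}g_2\in G_i$ is, and rs elements $\gamma\in G'$ and $(g_1,g_2)\in H_i\times G_i$ match if $r(\gamma_1^{-1}\gamma_2)$ and $g_1^{-1}g_2$ match. Put $$\mathrm{Orb}(x,f)=\int_{H_i}f(h^{-1}xh)\,dh,\qquad \mathrm{Orb}((g_1,g_2),f)=\int_{H_i\times H_i}f(h_1^{-1}g_1h_2,\,h_1^{-1}g_2h_2)\,dh_1\,dh_2,$$ for rs $x$ in $G_i$ or $\mathfrak g_i$, resp. rs $(g_1,g_2)\in H_i\times G_i$, with respect to a Haar measure on $H_i$. A function $f'$ on $S$ (resp. $\mathfrak{s}$, $G'$) *transfers* to a pair $(f_0,f_1)$ of functions on $G_0,G_1$ (resp. $\mathfrak{g}_0,\mathfrak{g}_1$;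 $H_0\times G_0,H_1\times G_1$) if $\mathrm{Orb}(g,f_i)=\omega(\gamma)\,\mathrm{Orb}(\gamma,f')$ for $i=0,1$ and all matching rs $g$ and $\gamma$, with $\omega=\omega_S$ (resp. $\omega_{\mathfrak s}$, $\omega_{G'}$). **Fundamental lemma statements.** * *Lie algebra FL* ($\epsilon\in O_{F_0}^\times$). Let $\Lambda_0^\flat\subset W_0^\flat$ be a self-dual $O_F$-lattice and $\mathfrak{k}_0\subset\mathfrak{g}_0$ the stabilizer of $\Lambda_0^\flat\oplus O_Fu_0$; the stabilizer of $\Lambda_0^\flat$ in $H_0$ has volume $1$, and the Haar measure on $H_1$ is arbitrary. Then $\mathbf 1_{\mathfrak{s}(O_{F_0})}$ transfers to $(\mathbf 1_{\mathfrak{k}_0},0)$. * *Almost self-dual FL* ($\epsilon=\varpi$). Let $\Lambda_1^\flat\subset W_1^\flat$ be a self-dual $O_F$-lattice, $K_1^\flat\subset H_1$ its stabilizer, and $K_1\subset G_1$, $\mathfrak{k}_1\subset\mathfrak{g}_1$ the stabilizers of $\Lambda_1=\Lambda_1^\flat\oplus O_Fu_1$; $K_1^\flat$ has volume $1$, and the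 Haar measure on $H_0$ is arbitrary. * (a, homogeneous) $(-1)^{n-1}\frac{q^n-1}{q-1}\mathbf 1_{\mathrm{GL}_{n-1}(O_F)\times K_0(\varpi)}$ transfers to $(0,\mathbf 1_{K_1^\flat\times K_1})$. * (b, inhomogeneous) $(-1)^{n-1}\mathbf 1_{K'}$ transfers to $(0,\mathbf 1_{K_1})$. * (c, Lie algebra) $(-1)^{n-1}\mathbf 1_{\mathfrak{k}'}$ transfers to $(0,\mathbf 1_{\mathfrak{k}_1})$. **Theorem.** For given $F/F_0$, $\varpi$ and $n$, and for any choice of the above data (hermitian spaces, special vectors, lattices, measures) in the two settings: 1. The Lie algebra FL holds if and only if the almost self-dual Lie algebra FL (c) holds. 2. The homogeneous statement (a) holds if and only if the inhomogeneous statement (b) holds. 3. If $q\ge n$, then (c) implies both (a) and (b). -/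

import Mathlib

open MeasureTheory Matrix

noncomputable section

namespace UnramFL

/-! ## Fields -/

section Fields

/-- The ring of integers of a nonarchimedean normed field. -/
abbrev intRing (K : Type*) [NormedField K] [IsUltrametricDist K] : ValuationSubring K :=
  (NormedField.valuation (K := K)).valuationSubring

/-- The number of elements of the residue field. -/
def residueCard (K : Type*) [NormedField K] [IsUltrametricDist K] : ℕ :=
  Nat.card (IsLocalRing.ResidueField (intRing K))

/-- `ϖ` generates the maximal ideal of the ring of integers, and is nonzero. -/
def IsUniformizer {K : Type*} [NormedField K] (ϖ : K) : Prop :=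
  ϖ ≠ 0 ∧ ‖ϖ‖ < 1 ∧ ∀ x : K, ‖x‖ < 1 → ‖x‖ ≤ ‖ϖ‖

/-- `F / F₀` has ramification index one (equal value groups). For finite extensions of `ℚ_p`,
whose residue fields are finite and hence perfect, this means that `F / F₀` is unramified. -/
def IsUnramifiedExt (F₀ F : Type*) [NormedField F₀] [NormedField F] : Prop :=
  ∀ x : F, ∃ y : F₀, ‖x‖ = ‖y‖

variable {F₀ F : Type*} [NormedField F₀] [NormedField F] [NormedAlgebra F₀ F]

open Classical in
/-- The quadratic character of `F₀ˣ` attached to `F / F₀`: trivial exactly on the norms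
from `Fˣ`. -/
def eta (σ : F ≃ₐ[F₀] F) (a : F₀) : ℂ :=
  if ∃ c : F, c ≠ 0 ∧ c * σ c = algebraMap F₀ F a then 1 else -1

open Classical in
/-- The normalized valuation: `v x = k` for `x ≠ 0` with `|x| = |ϖ|ᵏ`. -/
def ordv (ϖ : F₀) (x : F) : ℤ :=
  if h : ∃ k : ℤ, ‖x‖ = ‖ϖ‖ ^ k then h.choose else 0

/-- The extension `x ↦ (-1)^{v(x)}` of the quadratic character to `Fˣ`. -/
def etaTilde (ϖ : F₀) (x : F) : ℂ := (-1) ^ ordv ϖ x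

end Fields

/-! ## General linear groups

Throughout `n = m + 1`, and the index set of `n × n` matrices is `Fin m ⊕ Fin 1`, whose last
element `Sum.inr 0` corresponds to the special vector. -/

section LinearGroups

/-- The index set for `n × n` matrices, `n = m + 1`. -/
abbrev Idx (m : ℕ) : Type := Fin m ⊕ Fin 1

instance instMeasurableSpaceGL {ι K : Type*} [Fintype ι] [DecidableEq ι] [NormedField K] :
    MeasurableSpace (GL ι K) := borel _

instance instBorelSpaceGL {ι K : Type*} [Fintype ι] [DecidableEq ι] [NormedField K] :
    BorelSpace (GL ι K) := ⟨rfl⟩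

/-- The group embedding `h ↦ diag(h, 1)` of `GL_{n-1}` in `GL_n`. -/
def glEmb {m : ℕ} {K : Type*} [Field K] : GL (Fin m) K →* GL (Idx m) K :=
  Units.map
    { toFun := fun h => Matrix.fromBlocks h 0 0 1
      map_one' := Matrix.fromBlocks_one
      map_mul' := fun a b => by simp [Matrix.fromBlocks_multiply] }

/-- The subgroup `GL(O)` of `GL(K)`, where `O` is the ring of integers of `K`, as a subset. -/
def integralGL (ι K : Type*) [Fintype ι] [DecidableEq ι] [NormedField K] : Set (GL ι K) :=
  {g | ∀ i j, ‖(g : Matrix ι ι K) i j‖ ≤ 1 ∧ ‖((g⁻¹ : GL ι K) : Matrix ι ι K) i j‖ ≤ 1}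

/-- The right conjugation action `y ↦ h⁻¹ y h` of `GL_{n-1}` on `M_n`. -/
def conjAct {m : ℕ} {K : Type*} [Field K] (y : Matrix (Idx m) (Idx m) K) (h : GL (Fin m) K) :
    Matrix (Idx m) (Idx m) K :=
  ((glEmb h⁻¹ : GL (Idx m) K) : Matrix (Idx m) (Idx m) K) * y * (glEmb h : GL (Idx m) K)

/-- The vector `e = (0, …, 0, 1)`. -/
def eVec (m : ℕ) (K : Type*) [Field K] : Idx m → K := Pi.single (Sum.inr 0) 1

/-- `γ ∈ M_n` is regular semi-simple for the conjugation action of `GL_{n-1}`: both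
`{γⁱ e}` and `{(ᵗγ)ⁱ e}`, `0 ≤ i ≤ n - 1`, are linearly independent. -/
def IsRS {m : ℕ} {K : Type*} [Field K] (γ : Matrix (Idx m) (Idx m) K) : Prop :=
  LinearIndependent K (fun i : Fin (m + 1) => (γ ^ (i : ℕ)) *ᵥ eVec m K) ∧
  LinearIndependent K (fun i : Fin (m + 1) => (γᵀ ^ (i : ℕ)) *ᵥ eVec m K)

/-- The matrix `(γⁱ e)_{0 ≤ i ≤ n-1}` with columns `γⁱ e`. -/
def krylov {m : ℕ} {K : Type*} [Field K] (γ : Matrix (Idx m) (Idx m) K) :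
    Matrix (Idx m) (Idx m) K :=
  Matrix.of fun i j => ((γ ^ (finSumFinEquiv j : ℕ)) *ᵥ eVec m K) i

end LinearGroups

variable {F₀ F : Type*} [NormedField F₀] [NormedField F] [NormedAlgebra F₀ F]

/-! ## The general linear side -/

section LinearSide

/-- The inclusion `GL(F₀) → GL(F)`. -/
abbrev baseGL {ι : Type*} [Fintype ι] [DecidableEq ι] (h : GL ι F₀) : GL ι F :=
  Matrix.GeneralLinearGroup.map (algebraMap F₀ F) h

/-- The set `S(F₀)` of `γ` with `γ γ̄ = 1`. -/
def symSpace (σ : F ≃ₐ[F₀] F) (m : ℕ) : Set (Matrix (Idx m) (Idx m) F) :=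
  {γ | γ * γ.map σ = 1}

/-- The set `𝔰(F₀)` of `y` with `y + ȳ = 0`. -/
def symLie (σ : F ≃ₐ[F₀] F) (m : ℕ) : Set (Matrix (Idx m) (Idx m) F) :=
  {y | y + y.map σ = 0}

/-- The map `r : GL_n(F) → S(F₀)`, `γ ↦ γ γ̄⁻¹`. -/
def rMap (σ : F ≃ₐ[F₀] F) {m : ℕ} (γ : GL (Idx m) F) : Matrix (Idx m) (Idx m) F :=
  (γ : Matrix (Idx m) (Idx m) F) * ((γ⁻¹ : GL (Idx m) F) : Matrix (Idx m) (Idx m) F).map σ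

/-- The map `G'(F₀) → GL_n(F)`, `(γ₁, γ₂) ↦ γ₁⁻¹ γ₂`. -/
def quot {m : ℕ} (γ : GL (Fin m) F × GL (Idx m) F) : GL (Idx m) F :=
  (glEmb γ.1)⁻¹ * γ.2

/-- `𝔰(O_{F₀})`. -/
def symLieInt (σ : F ≃ₐ[F₀] F) (m : ℕ) : Set (Matrix (Idx m) (Idx m) F) :=
  {y | y ∈ symLie σ m ∧ ∀ i j, ‖y i j‖ ≤ 1}

/-- `K₀(ϖ)`: elements of `GL_n(O_F)` whose upper right `(n-1) × 1` block vanishes mod `ϖ`. -/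
def parK (ϖ : F₀) (m : ℕ) : Set (GL (Idx m) F) :=
  {g | g ∈ integralGL (Idx m) F ∧
    ∀ i : Fin m, ‖(g : Matrix (Idx m) (Idx m) F) (Sum.inl i) (Sum.inr 0)‖ ≤ ‖ϖ‖}

/-- `K' = S(O_{F₀}) ∩ K₀(ϖ)`. -/
def symK (σ : F ≃ₐ[F₀] F) (ϖ : F₀) (m : ℕ) : Set (Matrix (Idx m) (Idx m) F) :=
  {γ | γ ∈ symSpace σ m ∧ ∃ g ∈ parK (F := F) ϖ m, (g : Matrix (Idx m) (Idx m) F) = γ}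

/-- `𝔨' = 𝔰(O_{F₀}) ∩ 𝔨₀(ϖ)`. -/
def symLieK (σ : F ≃ₐ[F₀] F) (ϖ : F₀) (m : ℕ) : Set (Matrix (Idx m) (Idx m) F) :=
  {y | y ∈ symLieInt σ m ∧ ∀ i : Fin m, ‖y (Sum.inl i) (Sum.inr 0)‖ ≤ ‖ϖ‖}

/-- The transfer factor on `S(F₀)_rs`. -/
def omegaS (ϖ : F₀) {m : ℕ} (γ : Matrix (Idx m) (Idx m) F) : ℂ :=
  etaTilde ϖ ((γ.det ^ ((m + 1) / 2))⁻¹ * (krylov γ).det)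

/-- The transfer factor on `𝔰(F₀)_rs`. -/
def omegaLie (ϖ : F₀) {m : ℕ} (y : Matrix (Idx m) (Idx m) F) : ℂ :=
  etaTilde ϖ (krylov y).det

/-- The transfer factor on `G'(F₀)_rs`. -/
def omegaG (σ : F ≃ₐ[F₀] F) (ϖ : F₀) {m : ℕ} (γ : GL (Fin m) F × GL (Idx m) F) : ℂ :=
  if Odd (m + 1) then omegaS ϖ (rMap σ (quot γ))
  else etaTilde ϖ (quot γ : Matrix (Idx m) (Idx m) F).det * omegaS ϖ (rMap σ (quot γ))

/-- The orbital integral (special value at `s = 0`) on `S(F₀)` and on `𝔰(F₀)`: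
`∫ f'(h⁻¹ y h) η(det h) dh` over `GL_{n-1}(F₀)`. -/
def orbLin (σ : F ≃ₐ[F₀] F) {m : ℕ} (μ : Measure (GL (Fin m) F₀))
    (y : Matrix (Idx m) (Idx m) F) (f' : Matrix (Idx m) (Idx m) F → ℂ) : ℂ :=
  ∫ h : GL (Fin m) F₀,
    f' (conjAct y (baseGL h)) * eta σ (h : Matrix (Fin m) (Fin m) F₀).det ∂μ

/-- The orbital integral (special value at `s = 0`) on `G'(F₀) = GL_{n-1}(F) × GL_n(F)`:
`∫ f'(h₁⁻¹ γ h₂) η(h₂) dh₁ dh₂`, with `h₁ ∈ GL_{n-1}(F)` embedded in `G'` as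
`(h₁, diag(h₁, 1))`, with `h₂ = (h₂', h₂'') ∈ GL_{n-1}(F₀) × GL_n(F₀)` and with
`η(h₂) = η(det h₂')ⁿ η(det h₂'')ⁿ⁻¹`. -/
def orbLinHom (σ : F ≃ₐ[F₀] F) {m : ℕ} (μF : Measure (GL (Fin m) F))
    (μ : Measure (GL (Fin m) F₀)) (μn : Measure (GL (Idx m) F₀))
    (γ : GL (Fin m) F × GL (Idx m) F) (f' : GL (Fin m) F × GL (Idx m) F → ℂ) : ℂ :=
  ∫ h : GL (Fin m) F × (GL (Fin m) F₀ × GL (Idx m) F₀),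
    f' (h.1⁻¹ * γ.1 * baseGL h.2.1, (glEmb h.1)⁻¹ * γ.2 * baseGL h.2.2) *
      (eta σ (h.2.1 : Matrix (Fin m) (Fin m) F₀).det ^ (m + 1) *
        eta σ (h.2.2 : Matrix (Idx m) (Idx m) F₀).det ^ m) ∂(μF.prod (μ.prod μn))

end LinearSide

/-! ## Hermitian spaces

A hermitian space over `F / F₀` is given by its Gram matrix `J` in some basis: it is
`ι → F` with the form `(x, y) = ∑ xᵢ Jᵢⱼ ȳⱼ`. -/

section Hermitian

variable {ι : Type*} [Fintype ι] [DecidableEq ι]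

/-- `J` is the Gram matrix of a nondegenerate hermitian form. -/
def IsHermForm (σ : F ≃ₐ[F₀] F) (J : Matrix ι ι F) : Prop :=
  Jᵀ = J.map σ ∧ J.det ≠ 0

/-- The hermitian form `(x, y) = ∑ xᵢ Jᵢⱼ ȳⱼ`. -/
def hermForm (σ : F ≃ₐ[F₀] F) (J : Matrix ι ι F) (x y : ι → F) : F :=
  x ⬝ᵥ (J *ᵥ fun i => σ (y i))

/-- The hermitian space is split: `(-1)^{n(n-1)/2} det J` is a norm from `Fˣ`, where `n` is its
dimension. -/
def IsSplitForm (σ : F ≃ₐ[F₀] F) (J : Matrix ι ι F) : Prop :=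
  ∃ c : F, c ≠ 0 ∧
    c * σ c = (-1) ^ (Fintype.card ι * (Fintype.card ι - 1) / 2) * J.det

/-- The unitary group of the hermitian space with Gram matrix `J`. -/
def unitaryGp (σ : F ≃ₐ[F₀] F) (J : Matrix ι ι F) : Subgroup (GL ι F) where
  carrier := {g | (g : Matrix ι ι F)ᵀ * J * (g : Matrix ι ι F).map σ = J}
  one_mem' := by simp
  mul_mem' := by
    intro a b ha hb
    simp only [Set.mem_ofPred_eq, Units.val_mul, Matrix.transpose_mul, Matrix.map_mul] at ha hb ⊢
    calc _ = (b : Matrix ι ι F)ᵀ * ((a : Matrix ι ι F)ᵀ * J * (a : Matrix ι ι F).map σ) *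
          (b : Matrix ι ι F).map σ := by simp only [Matrix.mul_assoc]
      _ = J := by rw [ha, hb]
  inv_mem' := by
    intro a ha
    simp only [Set.mem_ofPred_eq] at ha ⊢
    have h1 : ((a⁻¹ : GL ι F) : Matrix ι ι F)ᵀ * (a : Matrix ι ι F)ᵀ = 1 := by
      rw [← Matrix.transpose_mul, ← Units.val_mul]; simp
    have h2 : (a : Matrix ι ι F).map σ * ((a⁻¹ : GL ι F) : Matrix ι ι F).map σ = 1 := by
      rw [← Matrix.map_mul, ← Units.val_mul]; simp
    calc _ = ((a⁻¹ : GL ι F) : Matrix ι ι F)ᵀ *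
          ((a : Matrix ι ι F)ᵀ * J * (a : Matrix ι ι F).map σ) *
            ((a⁻¹ : GL ι F) : Matrix ι ι F).map σ := by rw [ha]
      _ = (((a⁻¹ : GL ι F) : Matrix ι ι F)ᵀ * (a : Matrix ι ι F)ᵀ) * J *
          ((a : Matrix ι ι F).map σ * ((a⁻¹ : GL ι F) : Matrix ι ι F).map σ) := by
            simp only [Matrix.mul_assoc]
      _ = J := by rw [h1, h2]; simp

/-- The Lie algebra of the unitary group of the hermitian space with Gram matrix `J`. -/
def unitaryLie (σ : F ≃ₐ[F₀] F) (J : Matrix ι ι F) : Set (Matrix ι ι F) :=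
  {x | xᵀ * J + J * x.map σ = 0}

/-- The Gram matrix of `W = W♭ ⊕ F u`, where `W♭` has Gram matrix `J` and `(u, u) = ε`. -/
def extForm {m : ℕ} (J : Matrix (Fin m) (Fin m) F) (ε : F₀) : Matrix (Idx m) (Idx m) F :=
  Matrix.fromBlocks J 0 0 (Matrix.of fun _ _ => algebraMap F₀ F ε)

/-- The pair of hermitian spaces `W_i = W_i♭ ⊕ F u_i` of dimension `n = m + 1`, `i ∈ {0, 1}`, with
`W_0` split, `W_1` non-split and `(u_i, u_i) = ε`; `J i` is the Gram matrix of `W_i♭` in an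
arbitrary basis. -/
structure HermPair (σ : F ≃ₐ[F₀] F) (m : ℕ) (ε : F₀) where
  J : Fin 2 → Matrix (Fin m) (Fin m) F
  herm : ∀ i, IsHermForm σ (J i)
  split : IsSplitForm σ (extForm (J 0) ε)
  nonsplit : ¬ IsSplitForm σ (extForm (J 1) ε)

/-- `G_i(F₀) = U(W_i)(F₀)`. -/
abbrev HermPair.G {σ : F ≃ₐ[F₀] F} {m : ℕ} {ε : F₀} (W : HermPair σ m ε) (i : Fin 2) :
    Subgroup (GL (Idx m) F) := unitaryGp σ (extForm (W.J i) ε)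

/-- `H_i(F₀) = U(W_i♭)(F₀)`. -/
abbrev HermPair.H {σ : F ≃ₐ[F₀] F} {m : ℕ} {ε : F₀} (W : HermPair σ m ε) (i : Fin 2) :
    Subgroup (GL (Fin m) F) := unitaryGp σ (W.J i)

/-- `𝔤_i(F₀)`. -/
abbrev HermPair.g {σ : F ≃ₐ[F₀] F} {m : ℕ} {ε : F₀} (W : HermPair σ m ε) (i : Fin 2) :
    Set (Matrix (Idx m) (Idx m) F) := unitaryLie σ (extForm (W.J i) ε)

/-- The orbital integral on `G_i(F₀)` and on `𝔤_i(F₀)`: `∫ f(h⁻¹ x h) dh` over `H_i(F₀)`. -/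
def orbU {m : ℕ} {H : Subgroup (GL (Fin m) F)} (ν : Measure H)
    (x : Matrix (Idx m) (Idx m) F) (f : Matrix (Idx m) (Idx m) F → ℂ) : ℂ :=
  ∫ h : H, f (conjAct x (h : GL (Fin m) F)) ∂ν

/-- The orbital integral on `G_{W_i}(F₀) = H_i(F₀) × G_i(F₀)`: `∫ f(h₁⁻¹ g h₂) dh₁ dh₂` over
`H_i(F₀) × H_i(F₀)`, with `H_i` embedded in `G_{W_i}` by `h ↦ (h, diag(h, 1))`. -/
def orbUHom {m : ℕ} {H : Subgroup (GL (Fin m) F)} (ν : Measure H)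
    (g : GL (Fin m) F × GL (Idx m) F) (f : GL (Fin m) F × GL (Idx m) F → ℂ) : ℂ :=
  ∫ h : H × H, f ((h.1 : GL (Fin m) F)⁻¹ * g.1 * (h.2 : GL (Fin m) F),
    (glEmb (h.1 : GL (Fin m) F))⁻¹ * g.2 * glEmb (h.2 : GL (Fin m) F)) ∂(ν.prod ν)

/-- `y` and `x` are in the same `GL_{n-1}(F)`-orbit. -/
def Match {m : ℕ} (y x : Matrix (Idx m) (Idx m) F) : Prop :=
  ∃ h : GL (Fin m) F, conjAct y h = x

end Hermitian

/-! ## Lattices -/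

section Lattices

variable [IsUltrametricDist F] {ι : Type*} [Fintype ι]

/-- `Λ` is an `O_F`-lattice which equals its dual lattice. -/
def IsSelfDual (σ : F ≃ₐ[F₀] F) (J : Matrix ι ι F) (Λ : Submodule (intRing F) (ι → F)) : Prop :=
  Submodule.IsLattice F Λ ∧
    ∀ x : ι → F, x ∈ Λ ↔ ∀ y ∈ Λ, hermForm σ J x y ∈ intRing F

/-- The lattice `Λ♭ ⊕ O_F u` in `W = W♭ ⊕ F u`. -/
def extLattice {m : ℕ} (Λ : Submodule (intRing F) (Fin m → F)) :
    Submodule (intRing F) (Idx m → F) where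
  carrier := {w | (fun i => w (Sum.inl i)) ∈ Λ ∧ w (Sum.inr 0) ∈ intRing F}
  zero_mem' := ⟨Λ.zero_mem, (intRing F).zero_mem⟩
  add_mem' := fun ha hb => ⟨Λ.add_mem ha.1 hb.1, (intRing F).add_mem _ _ ha.2 hb.2⟩
  smul_mem' := fun c _ hx => ⟨Λ.smul_mem c hx.1, (intRing F).mul_mem _ _ c.2 hx.2⟩

/-- The elements of a group `G` of matrices which stabilize the lattice `Λ`, i.e. `g Λ = Λ`. -/
def stabGp [DecidableEq ι] (G : Subgroup (GL ι F)) (Λ : Submodule (intRing F) (ι → F)) :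
    Set (GL ι F) :=
  {g | g ∈ G ∧ ∀ x : ι → F, (g : Matrix ι ι F) *ᵥ x ∈ Λ ↔ x ∈ Λ}

/-- The elements of a set `𝔤` of matrices which stabilize the lattice `Λ`, i.e. `x Λ ⊆ Λ`. -/
def stabLie (g : Set (Matrix ι ι F)) (Λ : Submodule (intRing F) (ι → F)) : Set (Matrix ι ι F) :=
  {x | x ∈ g ∧ ∀ w ∈ Λ, x *ᵥ w ∈ Λ}

end Lattices

/-! ## Transfer -/

section Transfer

variable {σ : F ≃ₐ[F₀] F} {m : ℕ} {ε : F₀}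

/-- Transfer in the inhomogeneous setting, between a function on `S(F₀)` and a pair of functions on
`G_0(F₀)` and `G_1(F₀)`; all functions are regarded as functions on the ambient matrix space. -/
def TransferInhom (ϖ : F₀) (μ : Measure (GL (Fin m) F₀)) (W : HermPair σ m ε)
    (ν : ∀ i, Measure (W.H i))
    (f' : Matrix (Idx m) (Idx m) F → ℂ) (f : Fin 2 → Matrix (Idx m) (Idx m) F → ℂ) : Prop :=
  ∀ i : Fin 2, ∀ g ∈ W.G i, IsRS (g : Matrix (Idx m) (Idx m) F) →
    ∀ γ ∈ symSpace σ m, IsRS γ → Match γ g →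
      orbU (ν i) g (f i) = omegaS ϖ γ * orbLin σ μ γ f'

/-- Transfer in the Lie algebra setting, between a function on `𝔰(F₀)` and a pair of functions on
`𝔤_0(F₀)` and `𝔤_1(F₀)`. -/
def TransferLie (ϖ : F₀) (μ : Measure (GL (Fin m) F₀)) (W : HermPair σ m ε)
    (ν : ∀ i, Measure (W.H i))
    (f' : Matrix (Idx m) (Idx m) F → ℂ) (f : Fin 2 → Matrix (Idx m) (Idx m) F → ℂ) : Prop :=
  ∀ i : Fin 2, ∀ x ∈ W.g i, IsRS x →
    ∀ y ∈ symLie σ m, IsRS y → Match y x →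
      orbU (ν i) x (f i) = omegaLie ϖ y * orbLin σ μ y f'

/-- Transfer in the homogeneous setting, between a function on `G'(F₀)` and a pair of functions on
`G_{W_0}(F₀)` and `G_{W_1}(F₀)`. An element of `G'(F₀)` is regular semi-simple if its image
`r(γ₁⁻¹ γ₂)` in `S(F₀)` is, an element of `G_{W_i}(F₀)` is if its image `g₁⁻¹ g₂` in `G_i(F₀)` is,
and such elements match if their images do. -/
def TransferHom (ϖ : F₀) (μF : Measure (GL (Fin m) F)) (μ : Measure (GL (Fin m) F₀))
    (μn : Measure (GL (Idx m) F₀)) (W : HermPair σ m ε) (ν : ∀ i, Measure (W.H i))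
    (f' : GL (Fin m) F × GL (Idx m) F → ℂ) (f : Fin 2 → GL (Fin m) F × GL (Idx m) F → ℂ) : Prop :=
  ∀ i : Fin 2, ∀ g : GL (Fin m) F × GL (Idx m) F, g.1 ∈ W.H i → g.2 ∈ W.G i →
    IsRS (quot g : Matrix (Idx m) (Idx m) F) →
    ∀ γ : GL (Fin m) F × GL (Idx m) F, IsRS (rMap σ (quot γ)) → Match (rMap σ (quot γ)) (quot g) →
      orbUHom (ν i) g (f i) = omegaG σ ϖ γ * orbLinHom σ μF μ μn γ f'

/-- The complex-valued characteristic function of a set. -/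
def charFn {X : Type*} (A : Set X) : X → ℂ := A.indicator fun _ => 1

/-- The set underlying an invertible-matrix set, inside the space of all matrices. -/
def toMat {ι K : Type*} [Fintype ι] [DecidableEq ι] [Field K] (A : Set (GL ι K)) :
    Set (Matrix ι ι K) := (fun g : GL ι K => (g : Matrix ι ι K)) '' A

end Transfer

/-! ## The fundamental lemma statements -/

section FL

variable [IsUltrametricDist F] {σ : F ≃ₐ[F₀] F} {m : ℕ}

/-- Lie algebra FL: `1_{𝔰(O_{F₀})}` transfers to `(1_{𝔨_0}, 0)`, where `𝔨_0` is the stabilizer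
of `Λ_0♭ ⊕ O_F u_0`. -/
def LieFL (ϖ : F₀) (μ : Measure (GL (Fin m) F₀)) {ε : F₀} (W : HermPair σ m ε)
    (Λ : Submodule (intRing F) (Fin m → F)) (ν : ∀ i, Measure (W.H i)) : Prop :=
  TransferLie ϖ μ W ν (charFn (symLieInt σ m)) ![charFn (stabLie (W.g 0) (extLattice Λ)), 0]

/-- Lie algebra FL, almost self-dual case: `(-1)ⁿ⁻¹ 1_{𝔨'}` transfers to `(0, 1_{𝔨_1})`, where
`𝔨_1` is the stabilizer of `Λ_1♭ ⊕ O_F u_1`. -/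
def LieAFL (ϖ : F₀) (μ : Measure (GL (Fin m) F₀)) (W : HermPair σ m ϖ)
    (Λ : Submodule (intRing F) (Fin m → F)) (ν : ∀ i, Measure (W.H i)) : Prop :=
  TransferLie ϖ μ W ν (fun y => (-1) ^ m * charFn (symLieK σ ϖ m) y)
    ![0, charFn (stabLie (W.g 1) (extLattice Λ))]

/-- Inhomogeneous FL, almost self-dual case: `(-1)ⁿ⁻¹ 1_{K'}` transfers to `(0, 1_{K_1})`. -/
def InhomAFL (ϖ : F₀) (μ : Measure (GL (Fin m) F₀)) (W : HermPair σ m ϖ)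
    (Λ : Submodule (intRing F) (Fin m → F)) (ν : ∀ i, Measure (W.H i)) : Prop :=
  TransferInhom ϖ μ W ν (fun γ => (-1) ^ m * charFn (symK σ ϖ m) γ)
    ![0, charFn (toMat (stabGp (W.G 1) (extLattice Λ)))]

/-- Homogeneous FL, almost self-dual case: `(-1)ⁿ⁻¹ (qⁿ - 1)/(q - 1) 1_{GL_{n-1}(O_F) × K₀(ϖ)}`
transfers to `(0, 1_{K_1♭ × K_1})`. -/
def HomAFL [IsUltrametricDist F₀] (ϖ : F₀) (μF : Measure (GL (Fin m) F))
    (μ : Measure (GL (Fin m) F₀)) (μn : Measure (GL (Idx m) F₀)) (W : HermPair σ m ϖ)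
    (Λ : Submodule (intRing F) (Fin m → F)) (ν : ∀ i, Measure (W.H i)) : Prop :=
  TransferHom ϖ μF μ μn W ν
    (fun γ => (-1) ^ m * (((residueCard F₀ : ℂ) ^ (m + 1) - 1) / ((residueCard F₀ : ℂ) - 1)) *
      charFn (integralGL (Fin m) F ×ˢ parK ϖ m) γ)
    ![0, charFn (stabGp (W.H 1) Λ ×ˢ stabGp (W.G 1) (extLattice Λ))]

end FL

end UnramFL

end

open UnramFL

open MeasureTheory Matrix

noncomputable section

set_option linter.unusedSectionVars false

namespace UnramFL

/-! ## Rings of integers -/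

section IntRing

variable {K : Type*} [NormedField K] [IsUltrametricDist K]

/-! All arithmetic input is collected in `UnramifiedQuadratic`: equal value groups, every unit of F₀
is a norm, 2 is a unit, and some unit δ of F satisfies σ δ = -δ. Consequently η and η̃ both record
only the parity of a valuation, hermitian spaces are classified by that parity for the discriminant,
and a self-dual lattice has an orthonormal basis.

Equivalence of the two Lie algebra statements. Multiplication of the upper right block by t = ε/ϖ
(`scaleUR`) commutes with conjugation by GL_{n-1}. It carries the Lie algebra for special norm ϖ to
the one for special norm ε, and 𝔨' to 𝔰(O). It multiplies det(yⁱe) by tⁿ⁻¹, which produces the sign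
(-1)ⁿ⁻¹. On the unitary side, in an orthonormal basis of the self-dual lattice, the upper right
entries are up to sign ϖ times the conjugates of the lower left ones, so integrality is the same
before and after scaling. The change of special norm flips the parity of the discriminant of W,
hence exchanges the indices: W_1♭ in one setting is isometric to W_0♭ in the other, because both
contain self-dual lattices, and the two remaining spaces are isometric because both have
discriminant of odd valuation.

Equivalence of the homogeneous and inhomogeneous statements. The superfluous variables are
integrated out. On the unitary side the fibre is a coset of the stabilizer of Λ♭, of volume one. On
the linear side, Hilbert 90 identifies the fibres of r with cosets of GL_n(F₀), and its integral
form (`exists_mem_parK`) identifies K' with r(K₀(ϖ)). The fibre then has the volume (q-1)/(qⁿ-1) of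
the rational points of K₀(ϖ) (`measure_parahoric`), which cancels the constant in the test function.
The powers of η that appear account for the difference between ω_{G'} and ω_S.

From the Lie algebra to the group. If the characteristic polynomial of γ is not integral, both
orbital integrals vanish. Otherwise a Cayley transform y of ξ⁻¹γ is used, with ξ of norm one and 1 -
ξ⁻¹γ of unit determinant. Such ξ exists if n ≤ q, because norm-one elements fill at least q + 1
residue classes while the characteristic polynomial has at most n roots modulo the maximal ideal.
Then γ and y generate the same O_F-order (`sameOrder_cayley`). Hence they, and likewise their
conjugates, lie in the same orders of matrices, and their Krylov determinants have the same absolute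
value. So all orbital integrals and transfer factors agree term by term. -/

theorem mem_intRing {x : K} : x ∈ intRing K ↔ ‖x‖ ≤ 1 := by
  rw [Valuation.mem_valuationSubring_iff, NormedField.valuation_apply]
  exact Iff.rfl

theorem norm_coe_le_one (x : intRing K) : ‖(x : K)‖ ≤ 1 := mem_intRing.1 x.2

theorem intRing_isUnit_iff {x : intRing K} : IsUnit x ↔ ‖(x : K)‖ = 1 := by
  constructor
  · rintro ⟨u, rfl⟩
    have h : ((u : intRing K) : K) * ((u⁻¹ : (intRing K)ˣ) : intRing K) = 1 := by
      rw [← MulMemClass.coe_mul, ← Units.val_mul]; simp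
    have h1 := norm_coe_le_one (u : intRing K)
    have h2 := norm_coe_le_one ((u⁻¹ : (intRing K)ˣ) : intRing K)
    have h3 := congrArg norm h
    rw [norm_mul, norm_one] at h3
    nlinarith [norm_nonneg ((u : intRing K) : K)]
  · intro h
    have h0 : (x : K) ≠ 0 := by
      intro h0; rw [h0] at h; simp at h
    refine IsUnit.of_mul_eq_one ⟨(x : K)⁻¹, mem_intRing.2 (by simp [h])⟩ ?_
    ext
    simp [h0]

theorem residue_eq_zero_iff_norm {x : intRing K} :
    IsLocalRing.residue (intRing K) x = 0 ↔ ‖(x : K)‖ < 1 := by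
  rw [IsLocalRing.residue_eq_zero_iff, IsLocalRing.mem_maximalIdeal, mem_nonunits_iff,
    intRing_isUnit_iff]
  exact ⟨fun h => lt_of_le_of_ne (norm_coe_le_one x) h, fun h => h.ne⟩

theorem residue_eq_iff_norm {x y : intRing K} :
    IsLocalRing.residue (intRing K) x = IsLocalRing.residue (intRing K) y ↔
      ‖(x : K) - y‖ < 1 := by
  rw [← sub_eq_zero, ← map_sub, residue_eq_zero_iff_norm]
  rfl

omit [IsUltrametricDist K] in
theorem IsUniformizer.norm_pos {ϖ : K} (h : IsUniformizer ϖ) : 0 < ‖ϖ‖ := norm_pos_iff.2 h.1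

omit [IsUltrametricDist K] in
-- A norm strictly between two consecutive powers of ‖ϖ‖ would, after rescaling and inversion, give
-- an element of norm strictly between ‖ϖ‖ and 1, against the maximality of ‖ϖ‖.
theorem IsUniformizer.exists_norm_eq {ϖ : K} (h : IsUniformizer ϖ) {x : K} (hx : x ≠ 0) :
    ∃ k : ℤ, ‖x‖ = ‖ϖ‖ ^ k := by
  have h1 : 1 < ‖ϖ‖⁻¹ := (one_lt_inv₀ h.norm_pos).2 h.2.1
  obtain ⟨n, hn1, hn2⟩ := exists_mem_Ico_zpow (norm_pos_iff.2 hx) h1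
  refine ⟨-n, ?_⟩
  have h0 := h.norm_pos
  have hp : (0 : ℝ) < ‖ϖ‖ ^ n := zpow_pos h0 n
  rw [_root_.inv_zpow] at hn1 hn2
  rw [zpow_add₀ h0.ne', zpow_one, mul_inv] at hn2
  rw [_root_.zpow_neg]
  refine le_antisymm ?_ hn1
  by_contra! hlt
  have hx0 := norm_pos_iff.2 hx
  have hz : ‖(x * ϖ ^ n)⁻¹‖ < 1 := by
    rw [norm_inv, norm_mul, norm_zpow]
    apply inv_lt_one_of_one_lt₀
    rwa [inv_lt_iff_one_lt_mul₀ hp] at hlt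
  have hz2 := h.2.2 _ hz
  rw [norm_inv, norm_mul, norm_zpow, inv_le_comm₀ (by positivity) h0] at hz2
  rw [← div_eq_inv_mul, lt_div_iff₀ hp] at hn2
  exact absurd hz2 (not_le.2 hn2)

/-- Every nonzero element is a unit times a power of ϖ, so a nonzero ideal is generated by the
smallest power of ϖ that it contains. -/
theorem IsUniformizer.isPrincipalIdealRing {ϖ : K} (h : IsUniformizer ϖ) :
    IsPrincipalIdealRing (intRing K) := by
  classical
  refine ⟨fun I => ?_⟩
  by_cases hI : I = ⊥
  · rw [hI]; infer_instance
  let w : intRing K := ⟨ϖ, mem_intRing.2 h.2.1.le⟩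
  have key : ∀ x : intRing K, x ≠ 0 → ∃ (k : ℕ) (u : (intRing K)ˣ), x = w ^ k * u := by
    intro x hx
    have hx' : (x : K) ≠ 0 := fun h => hx (Subtype.ext h)
    obtain ⟨k, hk⟩ := h.exists_norm_eq hx'
    have hk0 : 0 ≤ k := by
      by_contra! hneg
      have := norm_coe_le_one x
      rw [hk] at this
      exact absurd (one_lt_zpow_of_neg₀ h.norm_pos h.2.1 hneg) (not_lt.2 this)
    obtain ⟨k, rfl⟩ := Int.eq_ofNat_of_zero_le hk0
    have hn : ‖(ϖ ^ k)⁻¹ * (x : K)‖ = 1 := by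
      have := (pow_pos h.norm_pos k).ne'
      rw [norm_mul, norm_inv, norm_pow, hk, zpow_natCast]
      field_simp
    have hu : IsUnit (⟨(ϖ ^ k)⁻¹ * (x : K), mem_intRing.2 hn.le⟩ : intRing K) :=
      intRing_isUnit_iff.2 hn
    refine ⟨k, hu.unit, ?_⟩
    ext
    simp [w, h.1]
  have hex : ∃ k : ℕ, w ^ k ∈ I := by
    obtain ⟨x, hxI, hx0⟩ := Submodule.exists_mem_ne_zero_of_ne_bot hI
    obtain ⟨k, u, rfl⟩ := key x hx0
    exact ⟨k, (Ideal.mul_unit_mem_iff_mem I u.isUnit).1 hxI⟩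
  refine ⟨⟨w ^ Nat.find hex, le_antisymm ?_ ?_⟩⟩
  · intro x hx
    by_cases hx0 : x = 0
    · rw [hx0]; exact zero_mem _
    obtain ⟨k, u, rfl⟩ := key x hx0
    have hk : w ^ k ∈ I := (Ideal.mul_unit_mem_iff_mem I u.isUnit).1 hx
    exact Ideal.mem_span_singleton.2 ((pow_dvd_pow w (Nat.find_min' hex hk)).mul_right _)
  · exact (Ideal.span_singleton_le_iff_mem _).2 (Nat.find_spec hex)

/-- The ring of integers is the closed unit ball, which is compact because the field is proper. -/
theorem IsUniformizer.finite_residueField [ProperSpace K] {ϖ : K} (h : IsUniformizer ϖ) :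
    Finite (IsLocalRing.ResidueField (intRing K)) := by
  have := h.isPrincipalIdealRing
  have hc : IsCompact (intRing K : Set K) := by
    have : (intRing K : Set K) = Metric.closedBall 0 1 := by
      ext x
      rw [SetLike.mem_coe, mem_intRing, mem_closedBall_zero_iff]
    rw [this]
    exact isCompact_closedBall 0 1
  have : CompactSpace (intRing K) := isCompact_iff_compactSpace.1 hc
  infer_instance

end IntRing

/-! ## Unramified quadratic extensions -/

section Quadratic

variable {F₀ F : Type*} [NormedField F₀] [NormedField F] [NormedAlgebra F₀ F]

/-- The properties of an unramified quadratic extension of local fields of odd residue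
characteristic which are used below. -/
structure UnramifiedQuadratic (σ : F ≃ₐ[F₀] F) (ϖ : F₀) : Prop where
  unif : IsUniformizer ϖ
  unif' : IsUniformizer (algebraMap F₀ F ϖ)
  norm_conj : ∀ x, ‖σ x‖ = ‖x‖
  conj_conj : ∀ x, σ (σ x) = x
  exists_of_fixed : ∀ x, σ x = x → ∃ a, algebraMap F₀ F a = x
  norm_two : ‖(2 : F)‖ = 1
  exists_anti_unit : ∃ δ : F, σ δ = -δ ∧ ‖δ‖ = 1
  exists_norm_eq_unit : ∀ u : F₀, ‖u‖ = 1 → ∃ c : F, c * σ c = algebraMap F₀ F u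

/-- An F₀-linear map of a finite-dimensional space is bounded, say by C. If it is multiplicative and
increases the norm of one x, then the powers of x violate the bound. Applying this to σ and to its
inverse gives equality. -/
theorem norm_conj_of_finite [CompleteSpace F₀] [FiniteDimensional F₀ F] (h : ∃ x : F₀, 1 < ‖x‖)
    (σ : F ≃ₐ[F₀] F) (x : F) : ‖σ x‖ = ‖x‖ := by
  let _ : NontriviallyNormedField F₀ := { ‹NormedField F₀› with non_trivial := h }
  have key : ∀ (τ : F ≃ₐ[F₀] F) (x : F), ‖τ x‖ ≤ ‖x‖ := by
    intro τ x
    obtain ⟨C, hC, hb⟩ := (LinearMap.toContinuousLinearMap τ.toLinearMap).isBoundedLinearMap.bound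
    by_contra! hlt
    have hx : 0 < ‖x‖ := by
      rw [norm_pos_iff]; rintro rfl; simp at hlt
    have h1 : 1 < ‖τ x‖ / ‖x‖ := (one_lt_div hx).2 hlt
    obtain ⟨n, hn⟩ := pow_unbounded_of_one_lt C h1
    have := hb (x ^ n)
    rw [div_pow, lt_div_iff₀ (pow_pos hx n)] at hn
    simp only [LinearMap.coe_toContinuousLinearMap', AlgEquiv.toLinearMap_apply, map_pow,
      norm_pow] at this
    linarith
  refine le_antisymm (key σ x) ?_
  simpa using key σ.symm (σ x)

theorem conj_conj_of_finrank_eq_two (hdeg : Module.finrank F₀ F = 2) (σ : F ≃ₐ[F₀] F) (x : F) :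
    σ (σ x) = x := by
  have : FiniteDimensional F₀ F := Module.finite_of_finrank_eq_succ hdeg
  by_cases h1 : σ = 1
  · simp [h1]
  have hc : Fintype.card (F ≃ₐ[F₀] F) ≤ 2 := by rw [← hdeg]; exact AlgEquiv.card_le
  have ho : orderOf σ = 2 := by
    have h2 : orderOf σ ≤ 2 := (orderOf_le_card_univ).trans hc
    have h3 : 0 < orderOf σ := orderOf_pos σ
    have h4 : orderOf σ ≠ 1 := fun h => h1 (orderOf_eq_one_iff.1 h)
    omega
  have := pow_orderOf_eq_one σ
  rw [ho, pow_two] at this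
  exact DFunLike.congr_fun this x

/-- A fixed element outside F₀ would form with 1 an F₀-basis of fixed vectors, forcing σ to be
trivial. -/
theorem exists_of_fixed_of_finrank_eq_two (hdeg : Module.finrank F₀ F = 2) (σ : F ≃ₐ[F₀] F)
    (hσ : σ ≠ AlgEquiv.refl) (x : F) (hx : σ x = x) : ∃ a, algebraMap F₀ F a = x := by
  by_contra! hne
  apply hσ
  have hli : LinearIndependent F₀ ![1, x] := by
    rw [LinearIndependent.pair_iff]
    intro s t hst
    by_cases ht : t = 0
    · subst ht
      simpa [Algebra.smul_def] using hst
    · exfalso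
      refine hne (-s / t) ?_
      have ht' : algebraMap F₀ F t ≠ 0 := by simpa using ht
      rw [map_div₀, map_neg, div_eq_iff ht']
      simp only [Algebra.smul_def, mul_one] at hst
      linear_combination -hst
  have hsp := hli.span_eq_top_of_card_eq_finrank (by simp [hdeg])
  ext y
  have hy : y ∈ Submodule.span F₀ (Set.range ![1, x]) := hsp ▸ Submodule.mem_top
  simp only [Matrix.range_cons, Matrix.range_empty, Set.union_empty, Set.singleton_union] at hy
  obtain ⟨a, b, rfl⟩ := Submodule.mem_span_pair.1 hy
  simp [hx]

omit [NormedField F] [NormedAlgebra F₀ F] in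
-- In the binomial expansion the difference equals zᵖ + p z r with r integral. The estimate makes
-- the iterated p-th powers of a unit near 1 converge to 1.
theorem norm_pow_prime_sub_one_le [IsUltrametricDist F₀] {p : ℕ} (hp : p.Prime) {z : F₀}
    (hz : ‖z‖ ≤ 1) : ‖(1 + z) ^ p - 1‖ ≤ max ‖(p : F₀)‖ ‖z‖ * ‖z‖ := by
  obtain ⟨r, hr⟩ := exists_add_pow_prime_eq hp (⟨z, mem_intRing.2 hz⟩ : intRing F₀) 1
  have hr' := congrArg (fun x : intRing F₀ => (x : F₀)) hr
  simp only [MulMemClass.coe_mul, AddMemClass.coe_add, OneMemClass.coe_one, one_pow, mul_one,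
    SubmonoidClass.coe_pow] at hr'
  rw [add_comm, hr', show z ^ p + 1 + ((p : intRing F₀) : F₀) * z * r - 1 =
    z ^ p + ((p : intRing F₀) : F₀) * z * r by ring]
  have hc : ((p : intRing F₀) : F₀) = (p : F₀) := rfl
  refine (IsUltrametricDist.norm_add_le_max _ _).trans (max_le ?_ ?_)
  · rw [norm_pow]
    calc ‖z‖ ^ p ≤ ‖z‖ ^ 2 := pow_le_pow_of_le_one (norm_nonneg _) hz hp.two_le
      _ = ‖z‖ * ‖z‖ := sq _
      _ ≤ _ := by gcongr; exact le_max_right _ _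
  · rw [norm_mul, norm_mul, hc]
    calc ‖(p : F₀)‖ * ‖z‖ * ‖(r : F₀)‖ ≤ ‖(p : F₀)‖ * ‖z‖ * 1 := by
          gcongr; exact norm_coe_le_one r
      _ = ‖(p : F₀)‖ * ‖z‖ := mul_one _
      _ ≤ _ := by gcongr; exact le_max_left _ _

omit [NormedField F] [NormedAlgebra F₀ F] in
/-- A unit which is congruent to one is a square. -/
theorem exists_sq_of_norm_sub_one_lt [ProperSpace F₀] [IsUltrametricDist F₀] {p : ℕ}
    (hp : p.Prime) (hp2 : p ≠ 2) (hp1 : ‖(p : F₀)‖ < 1) (w : F₀) (hw : ‖w - 1‖ < 1) : ∃ s, s ^ 2 = w := by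
  have hw1 : ‖w‖ = 1 := by
    have := IsUltrametricDist.norm_add_eq_max_of_norm_ne_norm (x := w - 1) (y := 1)
      (by rw [norm_one]; exact hw.ne)
    rw [sub_add_cancel, norm_one, max_eq_right hw.le] at this
    exact this
  -- Each p-th power brings w nearer to 1 by a factor of at least ρ < 1.
  have hpow : Filter.Tendsto (fun k : ℕ => w ^ p ^ k) Filter.atTop (nhds 1) := by
    set ρ := max ‖(p : F₀)‖ ‖w - 1‖ with hρ
    have hρ1 : ρ < 1 := max_lt hp1 hw
    have hρ0 : 0 ≤ ρ := (norm_nonneg _).trans (le_max_right _ _)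
    have key : ∀ k : ℕ, ‖w ^ p ^ k - 1‖ ≤ ρ ^ (k + 1) := by
      intro k
      induction k with
      | zero => simp [hρ]
      | succ k ih =>
        have hz1 : ‖w ^ p ^ k - 1‖ ≤ ρ :=
          ih.trans (pow_le_of_le_one hρ0 hρ1.le (Nat.succ_ne_zero k))
        have hz := norm_pow_prime_sub_one_le hp (hz1.trans hρ1.le)
        rw [add_sub_cancel] at hz
        rw [pow_succ p, pow_mul]
        refine hz.trans ?_
        rw [pow_succ ρ, mul_comm]
        exact mul_le_mul ih (max_le (le_max_left _ _) hz1)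
          ((norm_nonneg _).trans (le_max_left _ _)) (by positivity)
    rw [tendsto_iff_norm_sub_tendsto_zero]
    refine squeeze_zero (fun _ => norm_nonneg _) key ?_
    exact (tendsto_pow_atTop_nhds_zero_of_lt_one hρ0 hρ1).comp (Filter.tendsto_add_atTop_nat 1)
  -- The squares of integral elements form a compact set. It contains w · w^(pᵏ), a square because
  -- pᵏ is odd, and hence contains the limit w.
  have hclosed : IsClosed ((fun s : F₀ => s ^ 2) '' Metric.closedBall 0 1) :=
    ((isCompact_closedBall 0 1).image (by fun_prop)).isClosed
  have hlim : Filter.Tendsto (fun k : ℕ => w * w ^ p ^ k) Filter.atTop (nhds w) := by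
    simpa using hpow.const_mul w
  have hmem : w ∈ ((fun s : F₀ => s ^ 2) '' Metric.closedBall 0 1) := by
    refine hclosed.mem_of_tendsto hlim (Filter.Eventually.of_forall fun k => ?_)
    obtain ⟨r, hr⟩ : Odd (p ^ k) := (hp.odd_of_ne_two hp2).pow
    refine ⟨w ^ (r + 1), by simp [hw1], ?_⟩
    simp only [hr]
    ring
  obtain ⟨s, -, hs⟩ := hmem
  exact ⟨s, hs⟩

omit [NormedField F] [NormedAlgebra F₀ F] in
/-- A sum of two squares with unit coefficients represents all units modulo the maximal ideal. -/
theorem exists_norm_sq_sub_lt_one [ProperSpace F₀] [IsUltrametricDist F₀] {ϖ : F₀}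
    (hϖ : IsUniformizer ϖ) (h2 : ‖(2 : F₀)‖ = 1) (D u : F₀) (hD : ‖D‖ = 1) (hu : ‖u‖ = 1) :
    ∃ a b : F₀, ‖a‖ ≤ 1 ∧ ‖b‖ ≤ 1 ∧ ‖a ^ 2 - D * b ^ 2 - u‖ < 1 := by
  classical
  have := hϖ.finite_residueField
  have := Fintype.ofFinite (IsLocalRing.ResidueField (intRing F₀))
  let k := IsLocalRing.ResidueField (intRing F₀)
  let D' : intRing F₀ := ⟨D, mem_intRing.2 hD.le⟩
  let u' : intRing F₀ := ⟨u, mem_intRing.2 hu.le⟩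
  let π := IsLocalRing.residue (intRing F₀)
  have h2k : (2 : k) ≠ 0 := by
    have : (2 : k) = π 2 := (map_ofNat π 2).symm
    rw [this, Ne, residue_eq_zero_iff_norm]
    change ¬ ‖(2 : F₀)‖ < 1
    simp [h2]
  have hDk : π D' ≠ 0 := by
    rw [Ne, residue_eq_zero_iff_norm]
    simp [D', hD]
  have hodd : Fintype.card k % 2 = 1 := by
    rw [← Nat.odd_iff, ← Nat.not_even_iff_odd, Nat.even_iff]
    intro he
    apply h2k
    have := ringChar.spec k 2
    rw [FiniteField.even_card_iff_char_two.2 he] at this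
    exact_mod_cast this.2 dvd_rfl
  -- In a finite field of odd cardinality, two quadratic polynomials in independent variables have a
  -- common value up to sign. Here this solves x² - D y² = u modulo the maximal ideal.
  obtain ⟨x, y, hxy⟩ := FiniteField.exists_root_sum_quadratic
    (f := Polynomial.X ^ 2 - Polynomial.C (π u')) (g := Polynomial.C (-π D') * Polynomial.X ^ 2)
    (by compute_degree!) (by compute_degree!) hodd
  obtain ⟨a, rfl⟩ := IsLocalRing.residue_surjective x
  obtain ⟨b, rfl⟩ := IsLocalRing.residue_surjective y
  refine ⟨a, b, norm_coe_le_one a, norm_coe_le_one b, ?_⟩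
  have h0 : π (a ^ 2 - D' * b ^ 2 - u') = 0 := by
    simp only [Polynomial.eval_sub, Polynomial.eval_pow, Polynomial.eval_X, Polynomial.eval_C,
      Polynomial.eval_mul] at hxy
    simp only [map_sub, map_mul, map_pow]
    linear_combination hxy
  rw [residue_eq_zero_iff_norm] at h0
  exact h0

/-- The unit δ arises from some x - σ x ≠ 0 after division by an element of F₀ of the same norm,
which exists because the value groups agree. With D = δ², the norm of a + bδ is a² - D b². This
represents a given unit u modulo the maximal ideal, and the remaining factor is a unit congruent to
1, hence a square s², which is the norm of s. -/
theorem UnramifiedQuadratic.of_padic (p : ℕ) [Fact p.Prime] (hp : p ≠ 2)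
    [NormedAlgebra ℚ_[p] F₀] [ProperSpace F₀] [IsUltrametricDist F₀]
    [IsUltrametricDist F] (hdeg : Module.finrank F₀ F = 2) (hunr : IsUnramifiedExt F₀ F)
    (σ : F ≃ₐ[F₀] F) (hσ : σ ≠ AlgEquiv.refl) (ϖ : F₀) (hϖ : IsUniformizer ϖ) :
    UnramifiedQuadratic σ ϖ := by
  have hfd : FiniteDimensional F₀ F := Module.finite_of_finrank_eq_succ hdeg
  have hbig : ∃ x : F₀, 1 < ‖x‖ :=
    ⟨ϖ⁻¹, by rw [norm_inv]; exact (one_lt_inv₀ hϖ.norm_pos).2 hϖ.2.1⟩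
  have hp1 : ‖(p : F₀)‖ < 1 := by
    rw [← map_natCast (algebraMap ℚ_[p] F₀), norm_algebraMap']
    exact Padic.norm_p_lt_one
  have h2 : ‖(2 : F₀)‖ = 1 := by
    rw [← map_ofNat (algebraMap ℚ_[p] F₀) 2, norm_algebraMap']
    have := (Padic.norm_natCast_eq_one_iff (p := p) (n := 2)).2
      ((Nat.coprime_primes Fact.out Nat.prime_two).2 hp)
    exact_mod_cast this
  have h2F : ‖(2 : F)‖ = 1 := by
    rw [← map_ofNat (algebraMap F₀ F) 2, norm_algebraMap', h2]
  have hnc := norm_conj_of_finite hbig σ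
  have hcc := conj_conj_of_finrank_eq_two hdeg σ
  have hfix := exists_of_fixed_of_finrank_eq_two hdeg σ hσ
  have hδ : ∃ δ : F, σ δ = -δ ∧ ‖δ‖ = 1 := by
    obtain ⟨x, hx⟩ : ∃ x, σ x ≠ x := by
      by_contra! h
      exact hσ (AlgEquiv.ext h)
    obtain ⟨y, hy⟩ := hunr (x - σ x)
    have h0 : ‖x - σ x‖ ≠ 0 := norm_ne_zero_iff.2 (sub_ne_zero.2 (Ne.symm hx))
    refine ⟨(x - σ x) / algebraMap F₀ F y, ?_, ?_⟩
    · rw [map_div₀, map_sub, hcc, AlgEquiv.commutes, ← neg_div, neg_sub]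
    · rw [norm_div, norm_algebraMap', ← hy, div_self h0]
  refine ⟨hϖ, ⟨?_, ?_, ?_⟩, hnc, hcc, hfix, h2F, hδ, ?_⟩
  · simpa using hϖ.1
  · simpa using hϖ.2.1
  · intro x hx
    obtain ⟨y, hy⟩ := hunr x
    rw [norm_algebraMap', hy]
    exact hϖ.2.2 y (hy ▸ hx)
  · intro u hu
    obtain ⟨δ, hδ1, hδ2⟩ := hδ
    obtain ⟨D, hD⟩ := hfix (δ ^ 2) (by rw [map_pow, hδ1, neg_sq])
    have hDn : ‖D‖ = 1 := by
      rw [← norm_algebraMap' F D, hD, norm_pow, hδ2, one_pow]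
    obtain ⟨a, b, ha, hb, hab⟩ := exists_norm_sq_sub_lt_one hϖ h2 D u hDn hu
    set v := a ^ 2 - D * b ^ 2 with hv
    have hvn : ‖v‖ = 1 := by
      have := IsUltrametricDist.norm_add_eq_max_of_norm_ne_norm (x := v - u) (y := u)
        (by rw [hu]; exact hab.ne)
      rw [sub_add_cancel, hu, max_eq_right hab.le] at this
      exact this
    have hv0 : v ≠ 0 := norm_ne_zero_iff.1 (by rw [hvn]; exact one_ne_zero)
    obtain ⟨s, hs⟩ := exists_sq_of_norm_sub_one_lt (Fact.out : p.Prime) hp hp1 (u / v) (by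
      rw [div_sub_one hv0, norm_div, hvn, div_one, norm_sub_rev]; exact hab)
    refine ⟨algebraMap F₀ F s * (algebraMap F₀ F a + algebraMap F₀ F b * δ), ?_⟩
    have hu' : u = v * s ^ 2 := by rw [hs, mul_div_cancel₀ _ hv0]
    simp only [map_mul, map_add, AlgEquiv.commutes, hδ1]
    rw [hu', hv]
    simp only [map_mul, map_sub, map_pow, hD]
    ring

end Quadratic


/-! ## The quadratic characters -/

section Characters

variable {F₀ F : Type*} [NormedField F₀] [NormedField F] [NormedAlgebra F₀ F]
variable {σ : F ≃ₐ[F₀] F} {ϖ : F₀}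

omit [NormedAlgebra F₀ F] in
theorem etaTilde_congr {x y : F} (h : ‖x‖ = ‖y‖) : etaTilde ϖ x = etaTilde ϖ y := by
  unfold etaTilde ordv
  rw [h]

theorem norm_zpow_injective (hϖ : IsUniformizer ϖ) :
    Function.Injective (fun k : ℤ => ‖ϖ‖ ^ k) :=
  zpow_right_injective₀ hϖ.norm_pos hϖ.2.1.ne

omit [NormedAlgebra F₀ F] in
theorem etaTilde_of_norm_eq (hϖ : IsUniformizer ϖ) {x : F} {k : ℤ} (h : ‖x‖ = ‖ϖ‖ ^ k) :
    etaTilde ϖ x = (-1) ^ k := by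
  have hex : ∃ k : ℤ, ‖x‖ = ‖ϖ‖ ^ k := ⟨k, h⟩
  have : ordv ϖ x = k := by
    rw [ordv, dif_pos hex]
    exact norm_zpow_injective hϖ (hex.choose_spec.symm.trans h)
  rw [etaTilde, this]

namespace UnramifiedQuadratic

variable (D : UnramifiedQuadratic σ ϖ)
include D

theorem exists_norm_eq {x : F} (hx : x ≠ 0) : ∃ k : ℤ, ‖x‖ = ‖ϖ‖ ^ k := by
  obtain ⟨k, hk⟩ := D.unif'.exists_norm_eq hx
  exact ⟨k, by rw [hk, norm_algebraMap']⟩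

theorem etaTilde_mul {x y : F} (hx : x ≠ 0) (hy : y ≠ 0) :
    etaTilde ϖ (x * y) = etaTilde ϖ x * etaTilde ϖ y := by
  obtain ⟨k, hk⟩ := D.exists_norm_eq hx
  obtain ⟨l, hl⟩ := D.exists_norm_eq hy
  rw [etaTilde_of_norm_eq D.unif hk, etaTilde_of_norm_eq D.unif hl,
    etaTilde_of_norm_eq D.unif (k := k + l), zpow_add₀ (by norm_num)]
  rw [norm_mul, hk, hl, zpow_add₀ D.unif.norm_pos.ne']

omit D [NormedAlgebra F₀ F] in
theorem etaTilde_mul_self (x : F) : etaTilde ϖ x * etaTilde ϖ x = 1 := by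
  rw [etaTilde, ← mul_zpow]; simp

/-- A norm has even valuation since σ is isometric and the value groups coincide. Conversely,
division by ϖ^(2k), the norm of ϖᵏ, leaves a unit, which is a norm. -/
theorem exists_eq_norm_iff {a : F₀} :
    (∃ c : F, c ≠ 0 ∧ c * σ c = algebraMap F₀ F a) ↔ ∃ k : ℤ, ‖a‖ = ‖ϖ‖ ^ (2 * k) := by
  constructor
  · rintro ⟨c, hc, h⟩
    obtain ⟨k, hk⟩ := D.exists_norm_eq hc
    refine ⟨k, ?_⟩
    rw [← norm_algebraMap' F a, ← h, norm_mul, D.norm_conj, hk, two_mul,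
      zpow_add₀ D.unif.norm_pos.ne']
  · rintro ⟨k, hk⟩
    have h0 : ϖ ^ (2 * k) ≠ 0 := zpow_ne_zero _ D.unif.1
    obtain ⟨c, hc⟩ := D.exists_norm_eq_unit (a / ϖ ^ (2 * k)) (by
      rw [norm_div, norm_zpow, hk]
      exact div_self (zpow_ne_zero _ D.unif.norm_pos.ne'))
    have ha : a ≠ 0 := by
      intro ha
      rw [ha, norm_zero] at hk
      exact (zpow_ne_zero _ D.unif.norm_pos.ne') hk.symm
    have hp : (algebraMap F₀ F ϖ) ^ k * (algebraMap F₀ F ϖ) ^ k = algebraMap F₀ F (ϖ ^ (2 * k)) := by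
      rw [map_zpow₀, two_mul, zpow_add₀ (by simpa using D.unif.1)]
    have hmul : (c * (algebraMap F₀ F ϖ) ^ k) * σ (c * (algebraMap F₀ F ϖ) ^ k) =
        algebraMap F₀ F a := by
      rw [map_mul, map_zpow₀, AlgEquiv.commutes, mul_mul_mul_comm, hc, hp, ← map_mul,
        div_mul_cancel₀ _ h0]
    refine ⟨_, ?_, hmul⟩
    intro h
    rw [h, zero_mul] at hmul
    exact ha ((map_eq_zero (algebraMap F₀ F)).1 hmul.symm)

/-- Both characters detect the parity of the valuation. This is how η on the orbital integrals is
compared with the transfer factors. -/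
theorem eta_eq_etaTilde {a : F₀} (ha : a ≠ 0) : eta σ a = etaTilde ϖ (algebraMap F₀ F a) := by
  obtain ⟨k, hk⟩ := D.unif.exists_norm_eq ha
  rw [etaTilde_of_norm_eq D.unif (k := k) (by rwa [norm_algebraMap']), eta, D.exists_eq_norm_iff]
  split_ifs with h
  · obtain ⟨l, hl⟩ := h
    rw [norm_zpow_injective D.unif (hk.symm.trans hl), _root_.zpow_mul]
    simp
  · have : Odd k := by
      rw [← Int.not_even_iff_odd]
      rintro ⟨l, rfl⟩
      exact h ⟨l, by rw [two_mul, hk]⟩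
    rw [this.neg_one_zpow]

omit D in
theorem eta_mul_self (a : F₀) : eta σ a * eta σ a = 1 := by
  unfold eta; split_ifs <;> norm_num

/-- The locus where η is 1 is a countable union of level sets of the norm. -/
theorem measurable_eta {X : Type*} [MeasurableSpace X] {f : X → F₀}
    (hf : Measurable fun x => ‖f x‖) : Measurable fun x => eta σ (f x) := by
  unfold eta
  refine Measurable.ite ?_ measurable_const measurable_const
  simp only [D.exists_eq_norm_iff, Set.ofPred_exists]
  exact MeasurableSet.iUnion fun k => hf (measurableSet_singleton _)

end UnramifiedQuadratic

end Characters

/-! ## Topology of general linear groups -/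

section Topology

variable {ι K L : Type*} [Fintype ι] [DecidableEq ι] [NormedField K] [NormedField L]

instance instSecondCountableGL [SecondCountableTopology K] :
    SecondCountableTopology (GL ι K) := by
  have : SecondCountableTopology (Matrix ι ι K) :=
    inferInstanceAs (SecondCountableTopology (ι → ι → K))
  have : SecondCountableTopology (Matrix ι ι K)ᵐᵒᵖ :=
    MulOpposite.opHomeomorph.symm.secondCountableTopology
  exact (Units.isEmbedding_embedProduct (M := Matrix ι ι K)).secondCountableTopology

instance instLocallyCompactGL [LocallyCompactSpace K] : LocallyCompactSpace (GL ι K) := by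
  have : LocallyCompactSpace (Matrix ι ι K) :=
    inferInstanceAs (LocallyCompactSpace (ι → ι → K))
  have : T2Space (Matrix ι ι K) := inferInstanceAs (T2Space (ι → ι → K))
  exact (Units.isClosedEmbedding_embedProduct (α := Matrix ι ι K)).locallyCompactSpace

theorem continuous_coe_apply (i j : ι) :
    Continuous fun g : GL ι K => (g : Matrix ι ι K) i j :=
  Units.continuous_val.matrix_elem i j

theorem continuous_baseGL [NormedAlgebra K L] :
    Continuous (baseGL : GL ι K → GL ι L) := by
  refine Continuous.units_map _ ?_
  exact continuous_id.matrix_map (continuous_algebraMap K L)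

theorem continuous_glEmb {m : ℕ} : Continuous (glEmb : GL (Fin m) K → GL (Idx m) K) := by
  refine Continuous.units_map _ ?_
  exact Continuous.matrix_fromBlocks continuous_id continuous_const continuous_const
    continuous_const

theorem isClopen_integralGL [IsUltrametricDist K] : IsClopen (integralGL ι K) := by
  have hc : IsClopen {x : K | ‖x‖ ≤ 1} := by
    have : {x : K | ‖x‖ ≤ 1} = Metric.closedBall 0 1 := by ext; simp
    rw [this]
    exact IsUltrametricDist.isClopen_closedBall _ one_ne_zero
  have : integralGL ι K = ⋂ i, ⋂ j, ((fun g : GL ι K => (g : Matrix ι ι K) i j) ⁻¹' {x | ‖x‖ ≤ 1} ∩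
      (fun g : GL ι K => ((g⁻¹ : GL ι K) : Matrix ι ι K) i j) ⁻¹' {x | ‖x‖ ≤ 1}) := by
    ext g; simp [integralGL]
  rw [this]
  refine isClopen_iInter_of_finite fun i => isClopen_iInter_of_finite fun j => ?_
  exact (hc.preimage (continuous_coe_apply i j)).inter
    (hc.preimage ((continuous_coe_apply i j).comp continuous_inv))

theorem isClopen_parK [NormedAlgebra K L] [IsUltrametricDist L] {ϖ : K} (hϖ : ϖ ≠ 0) {m : ℕ} :
    IsClopen (parK (F := L) ϖ m) := by
  have hc : IsClopen {x : L | ‖x‖ ≤ ‖ϖ‖} := by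
    have : {x : L | ‖x‖ ≤ ‖ϖ‖} = Metric.closedBall 0 ‖ϖ‖ := by ext; simp
    rw [this]
    exact IsUltrametricDist.isClopen_closedBall _ (norm_ne_zero_iff.2 hϖ)
  have : parK (F := L) ϖ m = integralGL (Idx m) L ∩ ⋂ i : Fin m,
      (fun g : GL (Idx m) L => (g : Matrix (Idx m) (Idx m) L) (Sum.inl i) (Sum.inr 0)) ⁻¹'
        {x | ‖x‖ ≤ ‖ϖ‖} := by
    ext g; simp [parK]
  rw [this]
  exact isClopen_integralGL.inter (isClopen_iInter_of_finite fun i =>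
    hc.preimage (continuous_coe_apply _ _))

theorem measurable_norm_det [SecondCountableTopology K] :
    Measurable fun g : GL ι K => ‖(g : Matrix ι ι K).det‖ :=
  (Units.continuous_val.matrix_det.norm).measurable

end Topology


/-! ## Krylov matrices -/

section Krylov

variable {m : ℕ} {K : Type*} [Field K]

theorem linearIndependent_iff_det_krylov_ne_zero (γ : Matrix (Idx m) (Idx m) K) :
    LinearIndependent K (fun i : Fin (m + 1) => (γ ^ (i : ℕ)) *ᵥ eVec m K) ↔
      (krylov γ).det ≠ 0 := by
  rw [← isUnit_iff_ne_zero, ← Matrix.isUnit_iff_isUnit_det,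
    ← Matrix.linearIndependent_cols_iff_isUnit, ← linearIndependent_equiv finSumFinEquiv]
  rfl

theorem isRS_iff (γ : Matrix (Idx m) (Idx m) K) :
    IsRS γ ↔ (krylov γ).det ≠ 0 ∧ (krylov γᵀ).det ≠ 0 := by
  rw [IsRS, linearIndependent_iff_det_krylov_ne_zero, linearIndependent_iff_det_krylov_ne_zero]

/-- Adding a multiple of `e` to each column does not change the determinant of the Krylov
matrix. -/
theorem det_krylov_add_vecMulVec (y : Matrix (Idx m) (Idx m) K) (w : Idx m → K) :
    (krylov (y + vecMulVec (eVec m K) w)).det = (krylov y).det := by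
  set z := y + vecMulVec (eVec m K) w with hz
  have hstep : ∀ v, z *ᵥ v = y *ᵥ v + (w ⬝ᵥ v) • eVec m K := by
    intro v
    rw [hz, add_mulVec, vecMulVec_mulVec]
    simp
  -- Modulo the span of the earlier vectors yⁱe, the vectors zʲe and yʲe agree, so the two Krylov
  -- matrices differ by the unitriangular factor U.
  have key : ∀ j : ℕ, ∃ c : ℕ → K, (z ^ j) *ᵥ eVec m K =
      (y ^ j) *ᵥ eVec m K + ∑ i ∈ Finset.range j, c i • ((y ^ i) *ᵥ eVec m K) := by
    intro j
    induction j with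
    | zero => exact ⟨0, by simp⟩
    | succ j ih =>
      obtain ⟨c, hc⟩ := ih
      refine ⟨fun i => if i = 0 then w ⬝ᵥ ((z ^ j) *ᵥ eVec m K) else c (i - 1), ?_⟩
      rw [pow_succ', ← mulVec_mulVec, hstep, hc, Finset.sum_range_succ', mulVec_add,
        mulVec_mulVec, ← pow_succ', mulVec_sum, add_assoc]
      simp only [mulVec_smul, mulVec_mulVec, ← pow_succ', Nat.succ_ne_zero, if_false, if_true,
        Nat.add_sub_cancel, pow_zero, one_mulVec]
  choose c hc using key
  let U : Matrix (Fin (m + 1)) (Fin (m + 1)) K :=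
    Matrix.of fun i j => if i < j then c j i else if i = j then 1 else 0
  have hU : U.det = 1 := by
    rw [Matrix.det_of_isUpperTriangular]
    · simp [U]
    · intro i j hij
      have h1 : ¬ i < j := not_lt.2 hij.le
      have h2 : i ≠ j := hij.ne'
      simp [U, h1, h2]
  have hmul : krylov z = krylov y * U.submatrix finSumFinEquiv finSumFinEquiv := by
    ext i j
    rw [Matrix.mul_apply, ← finSumFinEquiv.symm.sum_comp]
    simp only [krylov, Matrix.of_apply, Equiv.apply_symm_apply, Matrix.submatrix_apply]
    rw [hc]
    set l := finSumFinEquiv j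
    simp only [Pi.add_apply, Finset.sum_apply, Pi.smul_apply, smul_eq_mul, U, Matrix.of_apply]
    have h1 : ∀ k : Fin (m + 1), ((y ^ (k : ℕ)) *ᵥ eVec m K) i *
        (if k < l then c l k else if k = l then 1 else 0) =
        (if (k : ℕ) < l then c l k * ((y ^ (k : ℕ)) *ᵥ eVec m K) i else 0) +
          (if k = l then ((y ^ (k : ℕ)) *ᵥ eVec m K) i else 0) := by
      intro k
      simp only [← Fin.lt_def]
      rcases lt_trichotomy k l with h | h | h
      · simp [h, h.ne, mul_comm]
      · simp [h]
      · simp [h.ne', not_lt.2 h.le]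
    simp only [h1, Finset.sum_add_distrib, Finset.sum_ite_eq', Finset.mem_univ, if_true]
    rw [add_comm]
    congr 1
    rw [Fin.sum_univ_eq_sum_range
      (fun k : ℕ => if k < l then c l k * ((y ^ k) *ᵥ eVec m K) i else 0) (m + 1),
      ← Finset.sum_filter]
    refine Finset.sum_congr ?_ fun _ _ => rfl
    ext k
    simp only [Finset.mem_range, Finset.mem_filter]
    have := l.2
    omega
  rw [hmul, det_mul, det_submatrix_equiv_self, hU, mul_one]

theorem krylov_conj_of_fixes (D D' z : Matrix (Idx m) (Idx m) K) (h : D' * D = 1)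
    (he : D *ᵥ eVec m K = eVec m K) :
    krylov (D * z * D') = D * krylov z := by
  have hpow : ∀ j : ℕ, (D * z * D') ^ j *ᵥ eVec m K = D *ᵥ (z ^ j *ᵥ eVec m K) := by
    intro j
    induction j with
    | zero => simp [he]
    | succ j ih =>
      rw [pow_succ', ← mulVec_mulVec, ih, pow_succ', mulVec_mulVec, mulVec_mulVec, mulVec_mulVec,
        Matrix.mul_assoc (D * z), h, Matrix.mul_one, Matrix.mul_assoc]
  ext i j
  rw [Matrix.mul_apply]
  simp only [krylov, of_apply, hpow]
  rfl

end Krylov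

/-! ## Orders generated by a matrix with integral characteristic polynomial -/

section Integral

variable {K : Type*} [NormedField K] [IsUltrametricDist K]
variable {ι : Type*} [Fintype ι] [DecidableEq ι]

/-- The characteristic polynomial of `a` has integral coefficients. -/
def IntegralCharpoly (a : Matrix ι ι K) : Prop := ∀ i, ‖a.charpoly.coeff i‖ ≤ 1

/-- All entries of `a` are integral. -/
def IntegralEntries {κ : Type*} (a : Matrix ι κ K) : Prop := ∀ i j, ‖a i j‖ ≤ 1

omit [Fintype ι] [DecidableEq ι] in
theorem IntegralEntries.exists_map {κ : Type*} {a : Matrix ι κ K} (h : IntegralEntries a) :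
    ∃ b : Matrix ι κ (intRing K), b.map (algebraMap (intRing K) K) = a :=
  ⟨Matrix.of fun i j => ⟨a i j, mem_intRing.2 (h i j)⟩, by ext; rfl⟩

omit [Fintype ι] [DecidableEq ι] in
theorem integralEntries_map {κ : Type*} (b : Matrix ι κ (intRing K)) :
    IntegralEntries (b.map (algebraMap (intRing K) K)) := fun i j => norm_coe_le_one (b i j)

omit [DecidableEq ι] in
theorem IntegralEntries.mul {a b : Matrix ι ι K} (ha : IntegralEntries a)
    (hb : IntegralEntries b) : IntegralEntries (a * b) := by
  obtain ⟨a, rfl⟩ := ha.exists_map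
  obtain ⟨b, rfl⟩ := hb.exists_map
  rw [← Matrix.map_mul]
  exact integralEntries_map _

theorem IntegralEntries.norm_det_le {a : Matrix ι ι K} (ha : IntegralEntries a) :
    ‖a.det‖ ≤ 1 := by
  obtain ⟨a, rfl⟩ := ha.exists_map
  rw [← RingHom.mapMatrix_apply, ← RingHom.map_det]
  exact norm_coe_le_one _

theorem IntegralEntries.integralCharpoly {a : Matrix ι ι K} (ha : IntegralEntries a) :
    IntegralCharpoly a := by
  obtain ⟨a, rfl⟩ := ha.exists_map
  intro i
  rw [Matrix.charpoly_map, Polynomial.coeff_map]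
  exact norm_coe_le_one _

theorem IntegralCharpoly.exists_map {a : Matrix ι ι K} (h : IntegralCharpoly a) :
    ∃ P : Polynomial (intRing K), P.Monic ∧ P.natDegree = Fintype.card ι ∧
      P.map (algebraMap (intRing K) K) = a.charpoly ∧ Polynomial.aeval a P = 0 := by
  have hl : a.charpoly ∈ Polynomial.lifts (algebraMap (intRing K) K) := by
    rw [Polynomial.lifts_iff_coeff_lifts]
    intro n
    exact ⟨⟨_, mem_intRing.2 (h n)⟩, rfl⟩
  obtain ⟨P, hP, hdeg, hm⟩ := Polynomial.lifts_and_degree_eq_and_monic hl a.charpoly_monic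
  refine ⟨P, hm, ?_, hP, ?_⟩
  · rw [← Matrix.charpoly_natDegree_eq_dim a]
    exact Polynomial.natDegree_eq_of_degree_eq hdeg
  · have := Matrix.aeval_self_charpoly a
    rwa [← hP, Polynomial.aeval_map_algebraMap] at this

/-- By Cayley–Hamilton, Q(a) a + P(0) = 0 with P = Q X + P(0). The constant term is ± det a, a unit,
so the inverse is an integral polynomial in a. -/
theorem IntegralCharpoly.inv_mem_adjoin {a b : Matrix ι ι K} (h : IntegralCharpoly a)
    (hab : a * b = 1) (hd : ‖a.det‖ = 1) : b ∈ Algebra.adjoin (intRing K) {a} := by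
  obtain ⟨P, hm, hdeg, hP, ha⟩ := h.exists_map
  have hu : IsUnit (P.coeff 0) := by
    rw [intRing_isUnit_iff, ← hd, det_eq_sign_charpoly_coeff, ← hP, Polynomial.coeff_map]
    rw [norm_mul, norm_pow, norm_neg, norm_one, one_pow, one_mul]
    rfl
  obtain ⟨u, hu⟩ := hu
  have h0 : Polynomial.aeval a P.divX * a + algebraMap _ _ (P.coeff 0) = 0 := by
    have := congrArg (Polynomial.aeval a) P.divX_mul_X_add
    rwa [map_add, map_mul, Polynomial.aeval_X, Polynomial.aeval_C, ha] at this
  have h1 : (P.coeff 0) • b = - Polynomial.aeval a P.divX := by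
    have := congrArg (· * b) h0
    simp only [add_mul, zero_mul, Matrix.mul_assoc, hab, Matrix.mul_one] at this
    rw [← Algebra.smul_def] at this
    rw [add_comm] at this
    exact eq_neg_of_add_eq_zero_left this
  have h2 : b = (↑u⁻¹ : intRing K) • (- Polynomial.aeval a P.divX) := by
    rw [← h1, ← hu, smul_smul, Units.inv_mul, one_smul]
  rw [h2]
  refine Subalgebra.smul_mem _ (neg_mem ?_) _
  rw [Algebra.adjoin_singleton_eq_range_aeval]
  exact ⟨_, rfl⟩

variable {m : ℕ}

/-- Division with remainder by the monic integral characteristic polynomial leaves degree at most m,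
so O[a]e is spanned over O by e, ae, …, aᵐe. -/
theorem IntegralCharpoly.exists_mulVec_eq {a c : Matrix (Idx m) (Idx m) K}
    (h : IntegralCharpoly a) (hc : c ∈ Algebra.adjoin (intRing K) {a}) :
    ∃ v : Idx m → K, (∀ i, ‖v i‖ ≤ 1) ∧ c *ᵥ eVec m K = krylov a *ᵥ v := by
  obtain ⟨P, hm, hdeg, -, ha⟩ := h.exists_map
  rw [Algebra.adjoin_singleton_eq_range_aeval] at hc
  obtain ⟨p, rfl⟩ := hc
  have hlt : (p %ₘ P).natDegree < m + 1 := by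
    have hP1 : P ≠ 1 := by
      rintro rfl
      simp at hdeg
    have := Polynomial.natDegree_modByMonic_lt p hm hP1
    rw [hdeg] at this
    simpa using this
  refine ⟨fun i => ((p %ₘ P).coeff (finSumFinEquiv i : ℕ) : K), fun i => norm_coe_le_one _, ?_⟩
  change (Polynomial.aeval a p) *ᵥ _ = _
  rw [← Polynomial.aeval_modByMonic_eq_self_of_root ha, Polynomial.aeval_eq_sum_range' hlt,
    sum_mulVec]
  ext i
  rw [Finset.sum_apply, Finset.sum_range, ← finSumFinEquiv.sum_comp, Matrix.mulVec, dotProduct]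
  refine Finset.sum_congr rfl fun j _ => ?_
  rw [smul_mulVec, Pi.smul_apply, Algebra.smul_def, mul_comm]
  rfl

/-- Each column c bʲ e lies in O[a]e, the lattice spanned by the columns of `krylov a`. With c = 1
this compares Krylov determinants. With b = a it says that c preserves that lattice. -/
theorem IntegralCharpoly.exists_mul_krylov {a b c : Matrix (Idx m) (Idx m) K}
    (h : IntegralCharpoly a) (hb : b ∈ Algebra.adjoin (intRing K) {a})
    (hc : c ∈ Algebra.adjoin (intRing K) {a}) :
    ∃ M : Matrix (Idx m) (Idx m) K, IntegralEntries M ∧ c * krylov b = krylov a * M := by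
  have key : ∀ j : Idx m, ∃ v : Idx m → K, (∀ i, ‖v i‖ ≤ 1) ∧
      (c * b ^ (finSumFinEquiv j : ℕ)) *ᵥ eVec m K = krylov a *ᵥ v := fun j =>
    h.exists_mulVec_eq (mul_mem hc (pow_mem hb _))
  choose v hv hv' using key
  refine ⟨Matrix.of fun i j => v j i, fun i j => hv j i, ?_⟩
  ext i j
  have := congrFun (hv' j) i
  rw [← mulVec_mulVec] at this
  simpa [Matrix.mul_apply, mulVec, dotProduct, krylov] using this

theorem IntegralCharpoly.norm_det_krylov_le {a b : Matrix (Idx m) (Idx m) K}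
    (h : IntegralCharpoly a) (hb : b ∈ Algebra.adjoin (intRing K) {a}) :
    ‖(krylov b).det‖ ≤ ‖(krylov a).det‖ := by
  obtain ⟨M, hM, hk⟩ := h.exists_mul_krylov hb (one_mem _)
  rw [one_mul] at hk
  rw [hk, det_mul, norm_mul]
  exact mul_le_of_le_one_right (norm_nonneg _) hM.norm_det_le

/-- Elements of O[a] preserve the lattice O[a]e, which has full rank since the Krylov determinant is
nonzero. In its basis they are integral matrices. -/
theorem IntegralCharpoly.of_mem_adjoin {a b : Matrix (Idx m) (Idx m) K}
    (h : IntegralCharpoly a) (hk : (krylov a).det ≠ 0)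
    (hb : b ∈ Algebra.adjoin (intRing K) {a}) : IntegralCharpoly b := by
  obtain ⟨M, hM, hM'⟩ := h.exists_mul_krylov (Algebra.self_mem_adjoin_singleton _ a) hb
  have hu : IsUnit (krylov a) := (Matrix.isUnit_iff_isUnit_det _).2 (isUnit_iff_ne_zero.2 hk)
  obtain ⟨k, hk⟩ := hu
  rw [← hk] at hM'
  have : b = (k : Matrix _ _ K) * M * ((k⁻¹ : GL (Idx m) K) : Matrix _ _ K) := by
    rw [← hM', Matrix.mul_assoc, ← Units.val_mul, mul_inv_cancel, Units.val_one, Matrix.mul_one]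
  rw [this]
  intro i
  rw [Matrix.coe_units_inv, Matrix.charpoly_units_conj k M]
  exact hM.integralCharpoly i

theorem transpose_mem_adjoin {a b : Matrix ι ι K} (hb : b ∈ Algebra.adjoin (intRing K) {a}) :
    bᵀ ∈ Algebra.adjoin (intRing K) {aᵀ} := by
  induction hb using Algebra.adjoin_induction with
  | mem x hx =>
    rw [Set.mem_singleton_iff.1 hx]
    exact Algebra.self_mem_adjoin_singleton _ _
  | algebraMap r =>
    rw [Matrix.algebraMap_eq_diagonal, Matrix.diagonal_transpose, ← Matrix.algebraMap_eq_diagonal]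
    exact Subalgebra.algebraMap_mem _ _
  | add x y _ _ hx hy => exact add_mem hx hy
  | mul x y _ _ hx hy => rw [transpose_mul]; exact mul_mem hy hx

/-- Two matrices generate the same order. -/
def SameOrder (a b : Matrix ι ι K) : Prop :=
  a ∈ Algebra.adjoin (intRing K) {b} ∧ b ∈ Algebra.adjoin (intRing K) {a}

/-- The point of the notion: 𝔨', K' and lattice stabilizers are all cut out by membership in some
order R, which cannot distinguish two generators of one order. -/
theorem SameOrder.mem_iff {a b : Matrix ι ι K} (h : SameOrder a b)
    (R : Subalgebra (intRing K) (Matrix ι ι K)) : a ∈ R ↔ b ∈ R :=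
  ⟨fun ha => Algebra.adjoin_singleton_le ha h.2, fun hb => Algebra.adjoin_singleton_le hb h.1⟩

theorem SameOrder.transpose {a b : Matrix ι ι K} (h : SameOrder a b) : SameOrder aᵀ bᵀ :=
  ⟨transpose_mem_adjoin h.1, transpose_mem_adjoin h.2⟩

theorem SameOrder.map {a b : Matrix ι ι K} (h : SameOrder a b)
    (f : Matrix ι ι K →ₐ[intRing K] Matrix ι ι K) : SameOrder (f a) (f b) := by
  constructor
  · rw [← AlgHom.map_adjoin_singleton]
    exact ⟨_, h.1, rfl⟩
  · rw [← AlgHom.map_adjoin_singleton]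
    exact ⟨_, h.2, rfl⟩

theorem SameOrder.trans {a b c : Matrix ι ι K} (h : SameOrder a b) (h' : SameOrder b c) :
    SameOrder a c :=
  ⟨Algebra.adjoin_singleton_le h'.1 h.1, Algebra.adjoin_singleton_le h.2 h'.2⟩

/-- Both Krylov matrices have columns spanning the same lattice O[a]e = O[b]e. This gives the
equality of transfer factors. -/
theorem SameOrder.norm_det_krylov_eq {a b : Matrix (Idx m) (Idx m) K} (h : SameOrder a b)
    (ha : IntegralCharpoly a) (hb : IntegralCharpoly b) :
    ‖(krylov a).det‖ = ‖(krylov b).det‖ :=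
  le_antisymm (hb.norm_det_krylov_le h.1) (ha.norm_det_krylov_le h.2)

theorem SameOrder.isRS {a b : Matrix (Idx m) (Idx m) K} (h : SameOrder a b)
    (ha : IntegralCharpoly a) (hrs : IsRS a) : IsRS b ∧ IntegralCharpoly b := by
  rw [isRS_iff] at hrs
  have hb := ha.of_mem_adjoin hrs.1 h.2
  refine ⟨?_, hb⟩
  rw [isRS_iff, ← norm_ne_zero_iff, ← h.norm_det_krylov_eq ha hb, norm_ne_zero_iff,
    ← norm_ne_zero_iff (a := (krylov bᵀ).det), ← h.transpose.norm_det_krylov_eq, norm_ne_zero_iff]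
  · exact hrs
  · intro i; rw [Matrix.charpoly_transpose]; exact ha i
  · intro i; rw [Matrix.charpoly_transpose]; exact hb i

/-- The Cayley transform of `ξ⁻¹ γ`. -/
def cayley (ξ : K) (γ : Matrix ι ι K) : Matrix ι ι K :=
  (1 + ξ⁻¹ • γ) * (1 - ξ⁻¹ • γ)⁻¹

/-- With a = 1 - ξ⁻¹γ, the Cayley transform equals 2a⁻¹ - 1. Each passage γ, a, a⁻¹, 2a⁻¹ - 1 is
reversible inside the generated order because ξ, det a and 2 are units. -/
theorem sameOrder_cayley (h2 : ‖(2 : K)‖ = 1) {γ : Matrix (Idx m) (Idx m) K}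
    (h : IntegralCharpoly γ) (hk : (krylov γ).det ≠ 0) {ξ : K} (hξ : ‖ξ‖ = 1)
    (hd : ‖(1 - ξ⁻¹ • γ).det‖ = 1) : SameOrder γ (cayley ξ γ) := by
  have hξ0 : ξ ≠ 0 := norm_ne_zero_iff.1 (by rw [hξ]; exact one_ne_zero)
  have h20 : (2 : K) ≠ 0 := norm_ne_zero_iff.1 (by rw [h2]; exact one_ne_zero)
  set a := 1 - ξ⁻¹ • γ with ha
  set b := a⁻¹ with hb
  have hdu : IsUnit a.det := isUnit_iff_ne_zero.2 (norm_ne_zero_iff.1 (by rw [hd]; exact one_ne_zero))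
  have hab : a * b = 1 := Matrix.mul_nonsing_inv _ hdu
  have hba : b * a = 1 := Matrix.nonsing_inv_mul _ hdu
  have smul_mem' : ∀ (c : K) (x : Matrix (Idx m) (Idx m) K)
      (R : Subalgebra (intRing K) (Matrix (Idx m) (Idx m) K)), ‖c‖ ≤ 1 → x ∈ R → c • x ∈ R :=
    fun c x R hc hx => R.smul_mem hx ⟨c, mem_intRing.2 hc⟩
  have hγa : SameOrder γ a := by
    constructor
    · have : γ = ξ • (1 - a) := by
        rw [ha, sub_sub_cancel, smul_smul, mul_inv_cancel₀ hξ0, one_smul]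
      nth_rewrite 1 [this]
      exact smul_mem' _ _ _ hξ.le (sub_mem (one_mem _) (Algebra.self_mem_adjoin_singleton _ _))
    · exact sub_mem (one_mem _) (smul_mem' _ _ _ (by simp [hξ])
        (Algebra.self_mem_adjoin_singleton _ _))
  have hac : IntegralCharpoly a := h.of_mem_adjoin hk hγa.2
  have hbm : b ∈ Algebra.adjoin (intRing K) {a} := hac.inv_mem_adjoin hab hd
  have hka : (krylov a).det ≠ 0 := by
    rw [← norm_ne_zero_iff, ← hγa.norm_det_krylov_eq h hac, norm_ne_zero_iff]
    exact hk
  have hbc : IntegralCharpoly b := hac.of_mem_adjoin hka hbm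
  have hbd : ‖b.det‖ = 1 := by
    have := congrArg (fun x => ‖x.det‖) hab
    simpa [det_mul, hd] using this
  have hSab : SameOrder a b := ⟨hbc.inv_mem_adjoin hba hbd, hbm⟩
  refine (hγa.trans hSab).trans ?_
  have hy : cayley ξ γ = (2 : K) • b - 1 := by
    have : (1 + ξ⁻¹ • γ) = (2 : K) • 1 - a := by
      rw [ha, two_smul]; abel
    rw [cayley, this, sub_mul, smul_mul_assoc, one_mul]
    change _ - a * b = _
    rw [hab]
  constructor
  · have : b = (2 : K)⁻¹ • (cayley ξ γ + 1) := by
      rw [hy, sub_add_cancel, smul_smul, inv_mul_cancel₀ h20, one_smul]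
    nth_rewrite 1 [this]
    exact smul_mem' _ _ _ (by simp [h2]) (add_mem (Algebra.self_mem_adjoin_singleton _ _)
      (one_mem _))
  · rw [hy]
    exact sub_mem (smul_mem' _ _ _ h2.le (Algebra.self_mem_adjoin_singleton _ _)) (one_mem _)

end Integral


/-! ## Hermitian matrices over local rings -/

section LocalHermitian

variable {R : Type*} [CommRing R] {ι : Type*} [Fintype ι] [DecidableEq ι]

/-- A vector with an invertible coordinate is a column of an invertible matrix. -/
theorem exists_GL_mulVec_single (v : ι → R) (i l : ι) (hi : IsUnit (v i)) :
    ∃ T : GL ι R, (T : Matrix ι ι R) *ᵥ Pi.single l 1 = v := by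
  let A : Matrix ι ι R := Matrix.updateCol 1 i v
  have hA : IsUnit A := by
    rw [Matrix.isUnit_iff_isUnit_det]
    have : A.det = v i := by
      rw [← Matrix.cramer_apply, Matrix.cramer_one]; rfl
    rwa [this]
  let P : Matrix ι ι R := (Equiv.swap l i).permMatrix R
  have hP : IsUnit P := by
    rw [Matrix.isUnit_iff_isUnit_det, Matrix.det_permutation]
    exact (Units.isUnit _).map (Int.castRingHom R)
  refine ⟨hA.unit * hP.unit, ?_⟩
  rw [Units.val_mul, ← mulVec_mulVec]
  have h1 : P *ᵥ Pi.single l 1 = Pi.single i 1 := by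
    rw [Matrix.permMatrix_mulVec]
    ext k
    simp only [Function.comp_apply, Pi.single_apply]
    congr 1
    rw [Equiv.swap_apply_eq_iff, Equiv.swap_apply_left]
  change A *ᵥ (P *ᵥ _) = _
  rw [h1, Matrix.mulVec_single_one]
  ext k
  simp [A]

/-- Congruence of hermitian matrices. -/
def HermCong (τ : R →+* R) (J J' : Matrix ι ι R) : Prop :=
  ∃ T : GL ι R, (T : Matrix ι ι R)ᵀ * J * (T : Matrix ι ι R).map τ = J'

variable {τ : R →+* R}

theorem HermCong.trans {J J' J'' : Matrix ι ι R} (h : HermCong τ J J') (h' : HermCong τ J' J'') :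
    HermCong τ J J'' := by
  obtain ⟨T, rfl⟩ := h
  obtain ⟨T', rfl⟩ := h'
  refine ⟨T * T', ?_⟩
  simp only [Units.val_mul, transpose_mul, Matrix.map_mul, Matrix.mul_assoc]

theorem HermCong.symm {J J' : Matrix ι ι R} (h : HermCong τ J J') : HermCong τ J' J := by
  obtain ⟨T, rfl⟩ := h
  refine ⟨T⁻¹, ?_⟩
  have h1 : ((T⁻¹ : GL ι R) : Matrix ι ι R)ᵀ * (T : Matrix ι ι R)ᵀ = 1 := by
    rw [← Matrix.transpose_mul, ← Units.val_mul]; simp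
  have h2 : (T : Matrix ι ι R).map τ * ((T⁻¹ : GL ι R) : Matrix ι ι R).map τ = 1 := by
    rw [← Matrix.map_mul, ← Units.val_mul]; simp
  calc _ = (((T⁻¹ : GL ι R) : Matrix ι ι R)ᵀ * (T : Matrix ι ι R)ᵀ) * J *
        ((T : Matrix ι ι R).map τ * ((T⁻¹ : GL ι R) : Matrix ι ι R).map τ) := by
          simp only [Matrix.mul_assoc]
    _ = J := by rw [h1, h2, Matrix.one_mul, Matrix.mul_one]

theorem HermCong.refl (J : Matrix ι ι R) : HermCong τ J J := ⟨1, by simp⟩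

theorem HermCong.reindex {κ : Type*} [Fintype κ] [DecidableEq κ] (e : κ ≃ ι) {J J' : Matrix ι ι R}
    (h : HermCong τ (J.submatrix e e) (J'.submatrix e e)) : HermCong τ J J' := by
  obtain ⟨T, hT⟩ := h
  have hu : IsUnit ((T : Matrix κ κ R).submatrix e.symm e.symm) := by
    rw [Matrix.isUnit_submatrix_equiv]
    exact T.isUnit
  refine ⟨hu.unit, ?_⟩
  have := congrArg (fun M : Matrix κ κ R => M.submatrix e.symm e.symm) hT
  simp only [Matrix.submatrix_submatrix, Equiv.self_comp_symm, Matrix.submatrix_id_id] at this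
  rw [← this]
  change ((T : Matrix κ κ R).submatrix e.symm e.symm)ᵀ * J *
    ((T : Matrix κ κ R).submatrix e.symm e.symm).map τ = _
  rw [← Matrix.submatrix_mul_equiv _ _ _ e.symm, ← Matrix.submatrix_mul_equiv _ _ _ e.symm,
    Matrix.submatrix_submatrix, Equiv.self_comp_symm, Matrix.submatrix_id_id]
  rfl

theorem HermCong.isHermitian (hτ : ∀ x, τ (τ x) = x) {J J' : Matrix ι ι R} (h : HermCong τ J J')
    (hJ : Jᵀ = J.map τ) : J'ᵀ = J'.map τ := by
  obtain ⟨T, rfl⟩ := h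
  have : ((T : Matrix ι ι R).map τ).map τ = T := by ext; simp [hτ]
  rw [transpose_mul, transpose_mul, transpose_transpose, hJ, Matrix.map_mul, Matrix.map_mul, this,
    Matrix.mul_assoc]
  rfl

theorem HermCong.fromBlocks {κ : Type*} [Fintype κ] [DecidableEq κ] {J J' : Matrix ι ι R}
    (h : HermCong τ J J') (D : Matrix κ κ R) :
    HermCong τ (Matrix.fromBlocks J 0 0 D) (Matrix.fromBlocks J' 0 0 D) := by
  obtain ⟨T, rfl⟩ := h
  have hu : IsUnit (Matrix.fromBlocks (T : Matrix ι ι R) 0 0 (1 : Matrix κ κ R)) := by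
    rw [Matrix.isUnit_iff_isUnit_det, Matrix.det_fromBlocks_zero₂₁, det_one, mul_one]
    exact (Matrix.isUnit_iff_isUnit_det _).1 T.isUnit
  refine ⟨hu.unit, ?_⟩
  rw [IsUnit.unit_spec, Matrix.fromBlocks_transpose, Matrix.fromBlocks_map,
    Matrix.fromBlocks_multiply, Matrix.fromBlocks_multiply]
  simp

/-- The value of a hermitian form at a vector. -/
def hermValue (τ : R →+* R) (J : Matrix ι ι R) (v : ι → R) : R := v ⬝ᵥ (J *ᵥ fun i => τ (v i))

theorem hermValue_mulVec (J : Matrix ι ι R) (T : Matrix ι ι R) (v : ι → R) :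
    hermValue τ J (T *ᵥ v) = hermValue τ (Tᵀ * J * T.map τ) v := by
  have h : (fun i => τ ((T *ᵥ v) i)) = T.map τ *ᵥ fun i => τ (v i) := by
    ext i; exact RingHom.map_mulVec τ T v i
  rw [hermValue, h, hermValue, mulVec_mulVec, ← vecMul_transpose, ← dotProduct_mulVec,
    mulVec_mulVec, Matrix.mul_assoc]

theorem hermValue_single (J : Matrix ι ι R) (i : ι) : hermValue τ J (Pi.single i 1) = J i i := by
  have : (fun k => τ ((Pi.single i (1 : R) : ι → R) k)) = Pi.single i 1 := by
    ext k; by_cases h : k = i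
    · subst h; simp
    · simp [h]
  rw [hermValue, this, Matrix.mulVec_single_one, single_one_dotProduct]
  rfl

theorem exists_isUnit_apply_of_isUnit_dotProduct [IsLocalRing R] {v w : ι → R}
    (h : IsUnit (v ⬝ᵥ w)) : ∃ i, IsUnit (v i) := by
  by_contra! hne
  have : v ⬝ᵥ w ∈ IsLocalRing.maximalIdeal R :=
    Ideal.sum_mem _ fun i _ => Ideal.mul_mem_right _ _ (hne i)
  exact this h

variable {n : ℕ}

/-- Splitting off a vector of invertible norm from a hermitian form. -/
theorem exists_hermCong_fromBlocks [IsLocalRing R] (hτ : ∀ x, τ (τ x) = x)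
    {J : Matrix (Idx n) (Idx n) R} (hJ : Jᵀ = J.map τ) {v : Idx n → R}
    (hv : IsUnit (hermValue τ J v)) :
    ∃ J₁ : Matrix (Fin n) (Fin n) R, J₁ᵀ = J₁.map τ ∧
      HermCong τ J (Matrix.fromBlocks J₁ 0 0 (Matrix.of fun _ _ => hermValue τ J v)) := by
  obtain ⟨i, hi⟩ := exists_isUnit_apply_of_isUnit_dotProduct hv
  obtain ⟨T, hT⟩ := exists_GL_mulVec_single v i (Sum.inr 0) hi
  set a := hermValue τ J v with ha
  let J₂ := (T : Matrix (Idx n) (Idx n) R)ᵀ * J * (T : Matrix (Idx n) (Idx n) R).map τ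
  have hc : HermCong τ J J₂ := ⟨T, rfl⟩
  have hJ₂ := hc.isHermitian hτ hJ
  have ha2 : J₂ (Sum.inr 0) (Sum.inr 0) = a := by
    rw [ha, ← hT, hermValue_mulVec, hermValue_single]
  have hta : τ a = a := by
    have := congrFun (congrFun hJ₂ (Sum.inr 0)) (Sum.inr 0)
    rw [transpose_apply, map_apply, ha2] at this
    exact this.symm
  obtain ⟨u, hu⟩ := hv
  -- Gram–Schmidt: from each remaining basis vector the multiple of v is subtracted that makes it
  -- orthogonal to v. The division is by the value at v, a unit.
  let X : Matrix (Fin 1) (Fin n) R := Matrix.of fun _ j => -(↑u⁻¹ * J₂ (Sum.inl j) (Sum.inr 0))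
  have hUnit : IsUnit (Matrix.fromBlocks (1 : Matrix (Fin n) (Fin n) R) 0 X (1 : Matrix (Fin 1) (Fin 1) R)) := by
    rw [Matrix.isUnit_iff_isUnit_det, Matrix.det_fromBlocks_zero₁₂]
    simp
  have hua : (↑u⁻¹ : R) * a = 1 := by rw [← hu]; simp
  have htu : τ (↑u⁻¹ : R) = ↑u⁻¹ := by
    have h1 : τ (↑u⁻¹ : R) * a = 1 := by rw [← hta, ← map_mul, hua, map_one]
    calc τ (↑u⁻¹ : R) = τ (↑u⁻¹ : R) * (↑u⁻¹ * a) := by rw [hua, mul_one]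
      _ = (τ (↑u⁻¹ : R) * a) * ↑u⁻¹ := by ring
      _ = _ := by rw [h1, one_mul]
  have hcong : HermCong τ J₂ (Matrix.fromBlocks (J₂.toBlocks₁₁ + Xᵀ * J₂.toBlocks₂₁ +
      (J₂.toBlocks₁₂ + Xᵀ * J₂.toBlocks₂₂) * X.map τ) 0 0 (Matrix.of fun _ _ => a)) := by
    refine ⟨hUnit.unit, ?_⟩
    rw [IsUnit.unit_spec]
    nth_rewrite 1 [← Matrix.fromBlocks_toBlocks J₂]
    rw [Matrix.fromBlocks_transpose, Matrix.fromBlocks_map, Matrix.fromBlocks_multiply,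
      Matrix.fromBlocks_multiply]
    have h12 : J₂.toBlocks₁₂ + Xᵀ * J₂.toBlocks₂₂ = 0 := by
      ext j k
      have hk : k = 0 := Subsingleton.elim _ _
      subst hk
      simp only [Matrix.add_apply, Matrix.mul_apply, Matrix.transpose_apply, X, Matrix.of_apply,
        Matrix.toBlocks₁₂, Matrix.toBlocks₂₂, Finset.univ_unique, Fin.default_eq_zero,
        Finset.sum_singleton, Matrix.zero_apply, Fin.isValue]
      rw [ha2]
      linear_combination (-J₂ (Sum.inl j) (Sum.inr 0)) * hua
    have h21 : J₂.toBlocks₂₁ + J₂.toBlocks₂₂ * X.map τ = 0 := by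
      ext k j
      have hk : k = 0 := Subsingleton.elim _ _
      subst hk
      have hj := congrFun (congrFun hJ₂ (Sum.inl j)) (Sum.inr 0)
      rw [transpose_apply, map_apply] at hj
      simp only [Matrix.add_apply, Matrix.mul_apply, X, Matrix.of_apply, Matrix.map_apply,
        Matrix.toBlocks₂₁, Matrix.toBlocks₂₂, Finset.univ_unique, Fin.default_eq_zero,
        Finset.sum_singleton, Matrix.zero_apply, Fin.isValue]
      rw [ha2, map_neg, map_mul, htu, hj]
      linear_combination (-τ (J₂ (Sum.inl j) (Sum.inr 0))) * hua
    have h22 : J₂.toBlocks₂₂ = Matrix.of fun _ _ => a := by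
      ext k j
      have hk : k = 0 := Subsingleton.elim _ _
      have hj : j = 0 := Subsingleton.elim _ _
      subst hk hj
      exact ha2
    have e1 : (1 : Matrix (Fin n) (Fin n) R).map τ = 1 := by simp
    have e2 : (1 : Matrix (Fin 1) (Fin 1) R).map τ = 1 := by simp
    simp only [Matrix.transpose_one, Matrix.transpose_zero, Matrix.one_mul, Matrix.zero_mul,
      zero_add, e1, e2, Matrix.mul_one, Matrix.mul_zero, Matrix.map_zero τ (map_zero τ), h22]
    rw [h22] at h12 h21
    rw [h12, h21]
  have hfinal := hc.trans hcong
  refine ⟨_, ?_, hfinal⟩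
  have hh := hfinal.isHermitian hτ hJ
  rw [Matrix.fromBlocks_transpose, Matrix.fromBlocks_map, Matrix.fromBlocks_inj] at hh
  exact hh.1

/-- If some diagonal entry is a unit, a basis vector serves. Otherwise some J i j off the diagonal
is a unit, and with t = τ(J i j)⁻¹ the vector e_i + t e_j has value 2 plus an element of the maximal
ideal. -/
theorem exists_isUnit_hermValue [IsLocalRing R] (h2 : IsUnit (2 : R)) (hτ : ∀ x, τ (τ x) = x)
    [Nonempty ι] {J : Matrix ι ι R} (hJ : Jᵀ = J.map τ) (hd : IsUnit J.det) :
    ∃ v, IsUnit (hermValue τ J v) := by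
  by_cases hdiag : ∃ i, IsUnit (J i i)
  · obtain ⟨i, hi⟩ := hdiag
    exact ⟨Pi.single i 1, by rwa [hermValue_single]⟩
  push Not at hdiag
  obtain ⟨i₀⟩ := ‹Nonempty ι›
  obtain ⟨i, j, hij⟩ : ∃ i j, IsUnit (J i j) := by
    have h1 : IsUnit ((J * J⁻¹) i₀ i₀) := by
      rw [Matrix.mul_nonsing_inv _ hd]; simp
    rw [Matrix.mul_apply'] at h1
    obtain ⟨j, hj⟩ := exists_isUnit_apply_of_isUnit_dotProduct h1
    exact ⟨_, j, hj⟩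
  have hne : i ≠ j := by rintro rfl; exact hdiag _ hij
  obtain ⟨u, hu⟩ := hij
  have hji : J j i = τ (J i j) := congrFun (congrFun hJ i) j
  let t : R := τ ↑u⁻¹
  have ht : τ t = ↑u⁻¹ := hτ _
  refine ⟨Pi.single i 1 + Pi.single j t, ?_⟩
  have h1 : (fun k => τ ((Pi.single i 1 + Pi.single j t : ι → R) k)) =
      Pi.single i 1 + Pi.single j (τ t) := by
    ext k
    rw [Pi.add_apply, map_add, Pi.add_apply, Pi.single_apply, Pi.single_apply, Pi.single_apply]
    split_ifs <;> simp
  have hval : hermValue τ J (Pi.single i 1 + Pi.single j t) =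
      2 + (J i i + t * τ t * J j j) := by
    rw [hermValue, h1, add_dotProduct, single_dotProduct, single_dotProduct, mulVec_add,
      Pi.add_apply, Pi.add_apply]
    simp only [mulVec_single, Pi.smul_apply, MulOpposite.smul_eq_mul_unop, MulOpposite.unop_op,
      Matrix.col_apply]
    rw [ht]
    have e1 : J i j * ↑u⁻¹ = 1 := by rw [← hu]; simp
    have e2 : t * J j i = 1 := by
      rw [hji, ← map_mul, ← hu]; simp
    linear_combination e1 + e2
  rw [hval]
  have hm : J i i + t * τ t * J j j ∈ IsLocalRing.maximalIdeal R :=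
    add_mem (hdiag i) (Ideal.mul_mem_left _ _ (hdiag j))
  by_contra hnu
  have h3 : (2 : R) ∈ IsLocalRing.maximalIdeal R := by
    have := sub_mem (show _ ∈ IsLocalRing.maximalIdeal R from hnu) hm
    rwa [add_sub_cancel_right] at this
  exact h3 h2

theorem hermValue_smul (J : Matrix ι ι R) (c : R) (v : ι → R) :
    hermValue τ J (c • v) = c * τ c * hermValue τ J v := by
  have : (fun i => τ ((c • v) i)) = τ c • fun i => τ (v i) := by ext; simp
  rw [hermValue, this, mulVec_smul, smul_dotProduct, dotProduct_smul, hermValue, smul_eq_mul,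
    smul_eq_mul, mul_assoc]

theorem hermValue_fixed (hτ : ∀ x, τ (τ x) = x) {J : Matrix ι ι R} (hJ : Jᵀ = J.map τ)
    (v : ι → R) : τ (hermValue τ J v) = hermValue τ J v := by
  rw [hermValue, RingHom.map_dotProduct, dotProduct_comm]
  have h1 : (τ ∘ (J *ᵥ fun i => τ (v i))) = Jᵀ *ᵥ v := by
    rw [hJ]
    ext i
    rw [Function.comp_apply, RingHom.map_mulVec]
    congr 1
    ext k; simp [hτ]
  rw [h1, mulVec_transpose, ← dotProduct_mulVec]
  rfl

theorem HermCong.isUnit_det {J J' : Matrix ι ι R} (h : HermCong τ J J') (hJ : IsUnit J.det) :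
    IsUnit J'.det := by
  obtain ⟨T, rfl⟩ := h
  have hT := (Matrix.isUnit_iff_isUnit_det _).1 T.isUnit
  rw [det_mul, det_mul, det_transpose, ← RingHom.mapMatrix_apply, ← RingHom.map_det]
  exact (hT.mul hJ).mul (hT.map τ)

/-- A unimodular hermitian form over a local ring in which all invariant units are norms has an
orthonormal basis. -/
theorem hermCong_one_of_norms [IsLocalRing R] (h2 : IsUnit (2 : R)) (hτ : ∀ x, τ (τ x) = x)
    (hN : ∀ u : R, IsUnit u → τ u = u → ∃ c, c * τ c = u) :
    ∀ (n : ℕ) (J : Matrix (Fin n) (Fin n) R), Jᵀ = J.map τ → IsUnit J.det → HermCong τ J 1 := by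
  intro n
  induction n with
  | zero =>
    intro J _ _
    have : J = 1 := by ext i; exact i.elim0
    rw [this]; exact HermCong.refl _
  | succ n ih =>
    intro J hJ hd
    refine HermCong.reindex finSumFinEquiv ?_
    set J' := J.submatrix (finSumFinEquiv : Idx n ≃ _) finSumFinEquiv
    have hJ' : J'ᵀ = J'.map τ := by
      rw [transpose_submatrix, hJ]; rfl
    have hd' : IsUnit J'.det := by rwa [det_submatrix_equiv_self]
    obtain ⟨v, hv⟩ := exists_isUnit_hermValue h2 hτ hJ' hd'
    have hfix := hermValue_fixed hτ hJ' v
    obtain ⟨u, hu⟩ := hv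
    have hfix' : τ (↑u⁻¹ : R) = ↑u⁻¹ := by
      rw [← hu] at hfix
      have h1 : τ (↑u⁻¹ : R) * u = 1 := by rw [← hfix, ← map_mul]; simp
      calc τ (↑u⁻¹ : R) = τ (↑u⁻¹ : R) * (u * ↑u⁻¹) := by rw [Units.mul_inv, mul_one]
        _ = (τ (↑u⁻¹ : R) * u) * ↑u⁻¹ := by ring
        _ = _ := by rw [h1, one_mul]
    -- Rescaling v by c multiplies its value by c τ(c) and normalizes it to 1.
    obtain ⟨c, hc⟩ := hN _ u⁻¹.isUnit hfix'
    have h1 : hermValue τ J' (c • v) = 1 := by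
      rw [hermValue_smul, hc, ← hu, Units.inv_mul]
    obtain ⟨J₁, hJ₁, hcong⟩ := exists_hermCong_fromBlocks hτ hJ' (v := c • v) (by rw [h1]; simp)
    rw [h1] at hcong
    have e1 : (Matrix.of fun _ _ => 1 : Matrix (Fin 1) (Fin 1) R) = 1 := by
      ext i j
      rw [Subsingleton.elim i j]; simp
    rw [e1] at hcong
    have hd1 := hcong.isUnit_det hd'
    rw [det_fromBlocks_zero₂₁, det_one, mul_one] at hd1
    have := hcong.trans ((ih J₁ hJ₁ hd1).fromBlocks 1)
    rw [fromBlocks_one] at this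
    rwa [submatrix_one_equiv]

end LocalHermitian

/-! ## Hermitian spaces over unramified quadratic extensions -/

section Classification

variable {F₀ F : Type*} [NormedField F₀] [NormedField F] [NormedAlgebra F₀ F]
variable {σ : F ≃ₐ[F₀] F} {ϖ : F₀}

namespace UnramifiedQuadratic

variable (D : UnramifiedQuadratic σ ϖ)
include D

theorem two_ne_zero : (2 : F) ≠ 0 :=
  norm_ne_zero_iff.1 (by rw [D.norm_two]; exact one_ne_zero)

/-- A nonzero invariant element is, up to norms, either `1` or `ϖ`. -/
theorem exists_mul_norm_eq {a : F₀} (ha : a ≠ 0) :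
    ∃ c : F, algebraMap F₀ F a * (c * σ c) = 1 ∨
      algebraMap F₀ F a * (c * σ c) = algebraMap F₀ F ϖ := by
  obtain ⟨k, hk⟩ := D.unif.exists_norm_eq ha
  rcases Int.even_or_odd k with ⟨l, hl⟩ | ⟨l, hl⟩
  · obtain ⟨c, -, hc⟩ := D.exists_eq_norm_iff.2 ⟨-l, show ‖a⁻¹‖ = _ by
      rw [norm_inv, hk, ← _root_.zpow_neg]; congr 1; omega⟩
    exact ⟨c, Or.inl (by rw [hc, ← map_mul, mul_inv_cancel₀ ha, map_one])⟩
  · obtain ⟨c, -, hc⟩ := D.exists_eq_norm_iff.2 ⟨-l, show ‖a⁻¹ * ϖ‖ = _ by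
      rw [norm_mul, norm_inv, hk, ← _root_.zpow_neg, ← zpow_add_one₀ D.unif.norm_pos.ne']
      congr 1; omega⟩
    exact ⟨c, Or.inr (by rw [hc, ← map_mul, mul_inv_cancel_left₀ ha])⟩

/-- A binary hermitian form represents `1`. -/
theorem exists_binary_eq_one [IsUltrametricDist F₀] {a b : F₀} (ha : a ≠ 0) (hb : b ≠ 0) :
    ∃ x y : F, algebraMap F₀ F a * (x * σ x) + algebraMap F₀ F b * (y * σ y) = 1 := by
  obtain ⟨c, hc | hc⟩ := D.exists_mul_norm_eq ha
  · exact ⟨c, 0, by simpa using hc⟩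
  obtain ⟨d, hd | hd⟩ := D.exists_mul_norm_eq hb
  · exact ⟨0, d, by simpa using hd⟩
  have h0 : algebraMap F₀ F ϖ ≠ 0 := D.unif'.1
  -- When both coefficients reduce to ϖ, the identity ϖ · (-1)/ϖ² + ϖ · (1 + ϖ)/ϖ² = 1 is used. The
  -- units -1 and 1 + ϖ are norms.
  obtain ⟨z, hz⟩ := D.exists_norm_eq_unit (-1) (by simp)
  obtain ⟨w, hw⟩ := D.exists_norm_eq_unit (1 + ϖ) (by
    rw [IsUltrametricDist.norm_add_eq_max_of_norm_ne_norm (by rw [norm_one]; exact D.unif.2.1.ne'),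
      norm_one, max_eq_left D.unif.2.1.le])
  refine ⟨c * z * (algebraMap F₀ F ϖ)⁻¹, d * w * (algebraMap F₀ F ϖ)⁻¹, ?_⟩
  simp only [map_mul, map_inv₀, AlgEquiv.commutes]
  have e1 : algebraMap F₀ F a * (c * z * (algebraMap F₀ F ϖ)⁻¹ *
      (σ c * σ z * (algebraMap F₀ F ϖ)⁻¹)) =
      (algebraMap F₀ F a * (c * σ c)) * (z * σ z) * (algebraMap F₀ F ϖ)⁻¹ ^ 2 := by ring
  have e2 : algebraMap F₀ F b * (d * w * (algebraMap F₀ F ϖ)⁻¹ *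
      (σ d * σ w * (algebraMap F₀ F ϖ)⁻¹)) =
      (algebraMap F₀ F b * (d * σ d)) * (w * σ w) * (algebraMap F₀ F ϖ)⁻¹ ^ 2 := by ring
  rw [e1, e2, hc, hd, hz, hw, map_neg, map_add, map_one]
  field_simp
  ring

/-- A nondegenerate hermitian form in at least two variables represents `1`. -/
theorem exists_hermValue_eq_one [IsUltrametricDist F₀] {n : ℕ}
    {J : Matrix (Idx (n + 1)) (Idx (n + 1)) F} (hJ : Jᵀ = J.map σ) (hd : J.det ≠ 0) :
    ∃ v, hermValue (σ : F →+* F) J v = 1 := by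
  have h2 : IsUnit (2 : F) := isUnit_iff_ne_zero.2 D.two_ne_zero
  obtain ⟨v, hv⟩ := exists_isUnit_hermValue (τ := (σ : F →+* F)) h2 D.conj_conj hJ
    (isUnit_iff_ne_zero.2 hd)
  obtain ⟨J₁, hJ₁, hc⟩ := exists_hermCong_fromBlocks (τ := (σ : F →+* F)) D.conj_conj hJ hv
  have hd1 := hc.isUnit_det (isUnit_iff_ne_zero.2 hd)
  rw [det_fromBlocks_zero₂₁, IsUnit.mul_iff] at hd1
  obtain ⟨w, hw⟩ := exists_isUnit_hermValue (τ := (σ : F →+* F)) h2 D.conj_conj hJ₁ hd1.1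
  obtain ⟨a, ha⟩ := D.exists_of_fixed _ (hermValue_fixed (τ := (σ : F →+* F)) D.conj_conj hJ v)
  obtain ⟨b, hb⟩ := D.exists_of_fixed _ (hermValue_fixed (τ := (σ : F →+* F)) D.conj_conj hJ₁ w)
  obtain ⟨x, y, hxy⟩ := D.exists_binary_eq_one (a := b) (b := a)
    (by rintro rfl; rw [map_zero] at hb; rw [← hb] at hw; exact not_isUnit_zero hw)
    (by rintro rfl; rw [map_zero] at ha; rw [← ha] at hv; exact not_isUnit_zero hv)
  obtain ⟨T, hT⟩ := hc
  refine ⟨(T : Matrix (Idx (n + 1)) (Idx (n + 1)) F) *ᵥ Sum.elim (x • w) (fun _ => y), ?_⟩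
  rw [hermValue_mulVec, hT, hermValue]
  have : (fun i => (σ : F →+* F) (Sum.elim (x • w) (fun _ : Fin 1 => y) i)) =
      Sum.elim (fun i => (σ : F →+* F) ((x • w) i)) (fun _ => (σ : F →+* F) y) := by
    ext i; cases i <;> rfl
  rw [this, fromBlocks_mulVec, sumElim_dotProduct_sumElim]
  simp only [Sum.elim_comp_inl, Sum.elim_comp_inr, zero_mulVec, add_zero, zero_add]
  change hermValue (σ : F →+* F) J₁ (x • w) + _ = 1
  rw [hermValue_smul, ← hb, ← ha, ← hxy]
  simp [mulVec, dotProduct]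
  ring

/-- Hermitian forms whose discriminants differ by a norm are equivalent. -/
theorem hermCong_of_det [IsUltrametricDist F₀] :
    ∀ (n : ℕ) (J J' : Matrix (Fin n) (Fin n) F), Jᵀ = J.map σ → J'ᵀ = J'.map σ → J.det ≠ 0 →
      J'.det ≠ 0 → (∃ c : F, J'.det = J.det * (c * σ c)) → HermCong (σ : F →+* F) J J' := by
  intro n
  induction n with
  | zero =>
    intro J J' _ _ _ _ _
    have : J = J' := by ext i; exact i.elim0
    rw [this]; exact HermCong.refl _
  | succ n ih =>
    intro J J' hJ hJ' hd hd' hc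
    -- Dimension one is treated apart: a form in one variable need not represent 1.
    rcases n with _ | n
    · obtain ⟨c, hc⟩ := hc
      rw [det_fin_one, det_fin_one] at hc
      rw [det_fin_one] at hd hd'
      have hc0 : c ≠ 0 := by rintro rfl; simp [hc] at hd'
      have hu : IsUnit (c • (1 : Matrix (Fin 1) (Fin 1) F)) := by
        rw [Matrix.isUnit_iff_isUnit_det]; simp [hc0]
      refine ⟨hu.unit, ?_⟩
      ext i j
      rw [Fin.fin_one_eq_zero i, Fin.fin_one_eq_zero j, hc]
      simp [Matrix.mul_apply]
      ring
    refine HermCong.reindex finSumFinEquiv ?_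
    set K := J.submatrix (finSumFinEquiv : Idx (n + 1) ≃ _) finSumFinEquiv
    set K' := J'.submatrix (finSumFinEquiv : Idx (n + 1) ≃ _) finSumFinEquiv
    have hK : Kᵀ = K.map σ := by rw [transpose_submatrix, hJ]; rfl
    have hK' : K'ᵀ = K'.map σ := by rw [transpose_submatrix, hJ']; rfl
    have hKd : K.det = J.det := det_submatrix_equiv_self _ _
    have hKd' : K'.det = J'.det := det_submatrix_equiv_self _ _
    obtain ⟨v, hv⟩ := D.exists_hermValue_eq_one hK (by rwa [hKd])
    obtain ⟨v', hv'⟩ := D.exists_hermValue_eq_one hK' (by rwa [hKd'])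
    obtain ⟨K₁, hK₁, h1⟩ := exists_hermCong_fromBlocks (τ := (σ : F →+* F)) D.conj_conj hK
      (v := v) (by rw [hv]; exact isUnit_one)
    obtain ⟨K₁', hK₁', h1'⟩ := exists_hermCong_fromBlocks (τ := (σ : F →+* F)) D.conj_conj hK'
      (v := v') (by rw [hv']; exact isUnit_one)
    rw [hv] at h1
    rw [hv'] at h1'
    have e1 : (Matrix.of fun _ _ => 1 : Matrix (Fin 1) (Fin 1) F) = 1 := by
      ext i j
      rw [Subsingleton.elim i j]; simp
    rw [e1] at h1 h1'
    -- Splitting off a vector of value 1 changes the discriminant only by a norm, so the complements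
    -- again satisfy the induction hypothesis.
    have hdet : ∀ {M : Matrix (Idx (n + 1)) (Idx (n + 1)) F} {M₁ : Matrix (Fin (n + 1)) _ F},
        HermCong (σ : F →+* F) M (fromBlocks M₁ 0 0 1) →
        ∃ t : F, t ≠ 0 ∧ M₁.det = M.det * (t * σ t) := by
      rintro M M₁ ⟨T, hT⟩
      refine ⟨(T : Matrix (Idx (n + 1)) (Idx (n + 1)) F).det, ?_, ?_⟩
      · exact ((Matrix.isUnit_iff_isUnit_det _).1 T.isUnit).ne_zero
      · have := congrArg Matrix.det hT
        rw [det_fromBlocks_zero₂₁, det_one, mul_one, det_mul, det_mul, det_transpose,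
          ← RingHom.mapMatrix_apply, ← RingHom.map_det] at this
        rw [← this]
        change _ * _ * σ _ = _
        ring
    obtain ⟨t, ht, h2⟩ := hdet h1
    obtain ⟨t', ht', h2'⟩ := hdet h1'
    obtain ⟨c, hc⟩ := hc
    have hσt : σ t ≠ 0 := by simpa using ht
    have hσt' : σ t' ≠ 0 := by simpa using ht'
    have := ih K₁ K₁' hK₁ hK₁'
      (by rw [h2, hKd]; exact mul_ne_zero hd (mul_ne_zero ht hσt))
      (by rw [h2', hKd']; exact mul_ne_zero hd' (mul_ne_zero ht' hσt'))
      ⟨c * t' * t⁻¹, by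
        rw [h2, h2', hKd, hKd', hc, map_mul, map_mul, map_inv₀]
        field_simp⟩
    exact (h1.trans (this.fromBlocks 1)).trans h1'.symm

end UnramifiedQuadratic

end Classification


/-! ## Self-dual lattices -/

section SelfDual

variable {F₀ F : Type*} [NormedField F₀] [NormedField F] [NormedAlgebra F₀ F]
  [IsUltrametricDist F] {σ : F ≃ₐ[F₀] F} {ϖ : F₀} {m : ℕ}

/-- A lattice in a finite-dimensional space has a basis. -/
theorem exists_GL_of_isLattice [IsPrincipalIdealRing (intRing F)]
    (Λ : Submodule (intRing F) (Fin m → F)) [hΛ : Submodule.IsLattice F Λ] :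
    ∃ B : GL (Fin m) F, ∀ x, (B : Matrix (Fin m) (Fin m) F) *ᵥ x ∈ Λ ↔ ∀ i, ‖x i‖ ≤ 1 := by
  have hr : Module.finrank (intRing F) Λ = m := by
    have := Submodule.IsLattice.finrank_of_pi (K := F) (R := intRing F) Λ
    simpa using this
  let b : Module.Basis (Fin m) (intRing F) Λ := Module.finBasisOfFinrankEq _ _ hr
  let B : Matrix (Fin m) (Fin m) F := Matrix.of fun i j => (b j : Fin m → F) i
  have hcol : ∀ x : Fin m → F, B *ᵥ x = ∑ j, x j • (b j : Fin m → F) := by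
    intro x
    ext i
    simp [B, mulVec, dotProduct, mul_comm]
  have hmem : ∀ x : Fin m → F, (∀ i, ‖x i‖ ≤ 1) → B *ᵥ x ∈ Λ := by
    intro x hx
    rw [hcol]
    exact Submodule.sum_mem _ fun j _ => Λ.smul_mem ⟨x j, mem_intRing.2 (hx j)⟩ (b j).2
  have hsurj : ∀ v ∈ Λ, ∃ x : Fin m → F, (∀ i, ‖x i‖ ≤ 1) ∧ B *ᵥ x = v := by
    intro v hv
    refine ⟨fun i => (b.repr ⟨v, hv⟩ i : F), fun i => norm_coe_le_one _, ?_⟩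
    rw [hcol]
    have := congrArg Subtype.val (b.sum_repr ⟨v, hv⟩)
    rw [AddSubmonoidClass.coe_finsetSum] at this
    exact this
  have hspan : Submodule.span F (Set.range B.col) = ⊤ := by
    rw [eq_top_iff, ← hΛ.span_eq_top, Submodule.span_le]
    intro v hv
    obtain ⟨x, -, rfl⟩ := hsurj v hv
    rw [hcol]
    exact Submodule.sum_mem _ fun j _ => Submodule.smul_mem _ _ (Submodule.subset_span ⟨j, rfl⟩)
  have hu : IsUnit B := by
    rw [← Matrix.linearIndependent_cols_iff_isUnit]
    exact linearIndependent_of_top_le_span_of_card_eq_finrank hspan.ge (by simp)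
  refine ⟨hu.unit, fun x => ⟨fun hx => ?_, hmem x⟩⟩
  obtain ⟨y, hy, hxy⟩ := hsurj _ hx
  rwa [← Matrix.mulVec_injective_iff_isUnit.2 hu hxy]

/-- The restriction of `σ` to the ring of integers. -/
def UnramifiedQuadratic.conjInt (D : UnramifiedQuadratic σ ϖ) : intRing F →+* intRing F :=
  RingHom.restrict (σ : F →+* F) (intRing F) (intRing F) fun x hx =>
    mem_intRing.2 ((D.norm_conj x).le.trans (mem_intRing.1 hx))

theorem UnramifiedQuadratic.isUnit_two (D : UnramifiedQuadratic σ ϖ) :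
    IsUnit (2 : intRing F) := intRing_isUnit_iff.2 D.norm_two

theorem integralEntries_of_mulVec {ι : Type*} [Fintype ι] [DecidableEq ι] {M : Matrix ι ι F}
    (h : ∀ x : ι → F, (∀ i, ‖x i‖ ≤ 1) → ∀ i, ‖(M *ᵥ x) i‖ ≤ 1) : IntegralEntries M := by
  intro i j
  have := h (Pi.single j 1) (fun k => by
    by_cases hk : k = j
    · subst hk; simp
    · simp [hk]) i
  simpa using this

theorem IntegralEntries.norm_mulVec_le {ι κ : Type*} [Fintype κ] {M : Matrix ι κ F}
    (h : IntegralEntries M) {x : κ → F} (hx : ∀ i, ‖x i‖ ≤ 1) (i : ι) : ‖(M *ᵥ x) i‖ ≤ 1 := by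
  rw [mulVec, dotProduct]
  refine IsUltrametricDist.norm_sum_le_of_forall_le_of_nonneg zero_le_one fun j _ => ?_
  rw [norm_mul]
  exact mul_le_one₀ (h i j) (norm_nonneg _) (hx j)

/-- A self-dual lattice has an orthonormal basis. -/
theorem UnramifiedQuadratic.exists_orthonormal_basis (D : UnramifiedQuadratic σ ϖ)
    {J : Matrix (Fin m) (Fin m) F} (hJ : IsHermForm σ J)
    {Λ : Submodule (intRing F) (Fin m → F)} (hΛ : IsSelfDual σ J Λ) :
    ∃ T : GL (Fin m) F, (∀ x, (T : Matrix (Fin m) (Fin m) F) *ᵥ x ∈ Λ ↔ ∀ i, ‖x i‖ ≤ 1) ∧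
      (T : Matrix (Fin m) (Fin m) F)ᵀ * J * (T : Matrix (Fin m) (Fin m) F).map σ = 1 := by
  have := D.unif'.isPrincipalIdealRing
  have := hΛ.1
  obtain ⟨B, hB⟩ := exists_GL_of_isLattice Λ
  have hsurj : ∀ v : Fin m → F, ∃ x, (B : Matrix (Fin m) (Fin m) F) *ᵥ x = v := fun v =>
    ⟨((B⁻¹ : GL (Fin m) F) : Matrix (Fin m) (Fin m) F) *ᵥ v, by
      rw [mulVec_mulVec, ← Units.val_mul, mul_inv_cancel, Units.val_one, one_mulVec]⟩
  let J₀ := (B : Matrix (Fin m) (Fin m) F)ᵀ * J * (B : Matrix (Fin m) (Fin m) F).map σ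
  have hform : ∀ x y, hermForm σ J ((B : Matrix (Fin m) (Fin m) F) *ᵥ x)
      ((B : Matrix (Fin m) (Fin m) F) *ᵥ y) = x ⬝ᵥ (J₀ *ᵥ fun i => σ (y i)) := by
    intro x y
    have h : (fun i => σ (((B : Matrix (Fin m) (Fin m) F) *ᵥ y) i)) =
        (B : Matrix (Fin m) (Fin m) F).map σ *ᵥ fun i => σ (y i) := by
      ext i; exact RingHom.map_mulVec (σ : F →+* F) B y i
    rw [hermForm, h, mulVec_mulVec, ← vecMul_transpose, ← dotProduct_mulVec, mulVec_mulVec,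
      ← Matrix.mul_assoc]
  have hsd : ∀ x : Fin m → F, (∀ i, ‖x i‖ ≤ 1) ↔
      ∀ y : Fin m → F, (∀ i, ‖y i‖ ≤ 1) → ‖x ⬝ᵥ (J₀ *ᵥ fun i => σ (y i))‖ ≤ 1 := by
    intro x
    rw [← hB, hΛ.2]
    constructor
    · intro h y hy
      rw [← hform]
      exact mem_intRing.1 (h _ ((hB y).2 hy))
    · intro h v hv
      obtain ⟨y, rfl⟩ := hsurj v
      rw [hform]
      exact mem_intRing.2 (h y ((hB y).1 hv))
  have hint_single : ∀ i j : Fin m, ‖(Pi.single i 1 : Fin m → F) j‖ ≤ 1 := by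
    intro i j
    by_cases hj : j = i
    · subst hj; simp
    · simp [hj]
  have hσsingle : ∀ j : Fin m, (fun i => σ ((Pi.single j 1 : Fin m → F) i)) = Pi.single j 1 := by
    intro j
    ext k
    by_cases hk : k = j
    · subst hk; simp
    · simp [hk]
  have hJ₀int : IntegralEntries J₀ := by
    intro i j
    have := (hsd (Pi.single i 1)).1 (hint_single i) (Pi.single j 1) (hint_single j)
    rw [hσsingle, mulVec_single_one, single_one_dotProduct] at this
    exact this
  have hdetB : ∀ C : GL (Fin m) F, (C : Matrix (Fin m) (Fin m) F).det ≠ 0 := fun C =>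
    ((Matrix.isUnit_iff_isUnit_det _).1 C.isUnit).ne_zero
  have hJ₀det : J₀.det ≠ 0 := by
    have : J₀.det = (B : Matrix (Fin m) (Fin m) F).det * J.det *
        σ (B : Matrix (Fin m) (Fin m) F).det := by
      simp only [J₀, det_mul, det_transpose]
      congr 1
      exact (RingHom.map_det (σ : F →+* F) _).symm
    rw [this]
    exact mul_ne_zero (mul_ne_zero (hdetB B) hJ.2) (by simpa using hdetB B)
  have hJ₀u : IsUnit J₀ᵀ.det := by rw [det_transpose]; exact isUnit_iff_ne_zero.2 hJ₀det
  -- For integral x, the vector J₀⁻ᵀ x pairs with y to x · σ(y), which is integral whenever y is.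
  -- Self-duality then makes J₀⁻ᵀ x integral, so J₀ is unimodular.
  have hinv : IntegralEntries (J₀ᵀ)⁻¹ := by
    refine integralEntries_of_mulVec fun x hx => (hsd _).2 fun y hy => ?_
    have e : J₀ᵀ⁻¹ *ᵥ x ⬝ᵥ J₀ *ᵥ (fun i => σ (y i)) = x ⬝ᵥ fun i => σ (y i) := by
      rw [dotProduct_mulVec, ← mulVec_transpose, mulVec_mulVec, Matrix.mul_nonsing_inv _ hJ₀u,
        one_mulVec]
    rw [e, dotProduct]
    refine IsUltrametricDist.norm_sum_le_of_forall_le_of_nonneg zero_le_one fun j _ => ?_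
    rw [norm_mul, D.norm_conj]
    exact mul_le_one₀ (hx j) (norm_nonneg _) (hy j)
  have hdet1 : ‖J₀.det‖ = 1 := by
    have h1 := hJ₀int.norm_det_le
    have h2 := hinv.norm_det_le
    have h3 := congrArg norm (Matrix.det_nonsing_inv_mul_det _ hJ₀u)
    rw [norm_mul, det_transpose, norm_one] at h3
    nlinarith [norm_nonneg J₀.det]
  have hherm : J₀ᵀ = J₀.map σ :=
    HermCong.isHermitian (τ := (σ : F →+* F)) D.conj_conj ⟨B, rfl⟩ hJ.1
  obtain ⟨Ji, hJi⟩ := hJ₀int.exists_map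
  have hinj : Function.Injective (algebraMap (intRing F) F) := Subtype.val_injective
  have hJiherm : Jiᵀ = Ji.map D.conjInt := by
    apply Matrix.map_injective hinj
    change (Ji.map (algebraMap (intRing F) F))ᵀ = (Ji.map (algebraMap (intRing F) F)).map σ
    rw [hJi, hherm]
  have hJidet : IsUnit Ji.det := by
    rw [intRing_isUnit_iff, ← hdet1, ← hJi]
    exact congrArg norm (RingHom.map_det (algebraMap (intRing F) F) Ji)
  have hN : ∀ u : intRing F, IsUnit u → D.conjInt u = u → ∃ c, c * D.conjInt c = u := by
    intro u hu hfix
    obtain ⟨a, ha⟩ := D.exists_of_fixed u (congrArg Subtype.val hfix)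
    have ha1 : ‖a‖ = 1 := by
      rw [← norm_algebraMap' F a, ha]; exact intRing_isUnit_iff.1 hu
    obtain ⟨c, hc⟩ := D.exists_norm_eq_unit a ha1
    have hc1 : ‖c‖ = 1 := by
      have := congrArg norm hc
      rw [norm_mul, D.norm_conj, norm_algebraMap', ha1] at this
      nlinarith [norm_nonneg c]
    exact ⟨⟨c, mem_intRing.2 hc1.le⟩, Subtype.ext (hc.trans ha)⟩
  obtain ⟨T, hT⟩ := hermCong_one_of_norms D.isUnit_two
    (fun x => Subtype.ext (D.conj_conj x)) hN m Ji hJiherm hJidet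
  let T' : GL (Fin m) F := Matrix.GeneralLinearGroup.map (algebraMap (intRing F) F) T
  have hT'int : IntegralEntries (T' : Matrix (Fin m) (Fin m) F) :=
    integralEntries_map (T : Matrix (Fin m) (Fin m) (intRing F))
  have hT'int' : IntegralEntries ((T'⁻¹ : GL (Fin m) F) : Matrix (Fin m) (Fin m) F) := by
    have : T'⁻¹ = Matrix.GeneralLinearGroup.map (algebraMap (intRing F) F) T⁻¹ :=
      (map_inv _ _).symm
    rw [this]
    exact integralEntries_map ((T⁻¹ : GL (Fin m) (intRing F)) : Matrix (Fin m) (Fin m) (intRing F))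
  refine ⟨B * T', fun x => ?_, ?_⟩
  · rw [Units.val_mul, ← mulVec_mulVec, hB]
    refine ⟨fun h => ?_, fun h => hT'int.norm_mulVec_le h⟩
    have := hT'int'.norm_mulVec_le h
    rwa [mulVec_mulVec, ← Units.val_mul, inv_mul_cancel, Units.val_one, one_mulVec] at this
  · have h := congrArg (fun M => M.map (algebraMap (intRing F) F)) hT
    simp only [Matrix.map_mul] at h
    rw [hJi] at h
    calc _ = (T' : Matrix (Fin m) (Fin m) F)ᵀ * J₀ * (T' : Matrix (Fin m) (Fin m) F).map σ := by
          simp only [Units.val_mul, transpose_mul, Matrix.map_mul, J₀, Matrix.mul_assoc]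
      _ = 1 := by
          refine Eq.trans h ?_
          exact Matrix.map_one _ (map_zero _) (map_one _)

end SelfDual


/-! ## The conjugation action -/

section ConjAct

variable {m : ℕ} {K : Type*} [Field K]

theorem conjAct_one (y : Matrix (Idx m) (Idx m) K) : conjAct y 1 = y := by
  simp [conjAct]

theorem conjAct_mul (y : Matrix (Idx m) (Idx m) K) (h k : GL (Fin m) K) :
    conjAct y (h * k) = conjAct (conjAct y h) k := by
  simp only [conjAct, _root_.mul_inv_rev, map_mul, Units.val_mul, Matrix.mul_assoc]

theorem coe_glEmb (h : GL (Fin m) K) :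
    ((glEmb h : GL (Idx m) K) : Matrix (Idx m) (Idx m) K) = fromBlocks (h : Matrix (Fin m) (Fin m) K) 0 0 1 :=
  rfl

theorem conjAct_fromBlocks (A : Matrix (Fin m) (Fin m) K) (B : Matrix (Fin m) (Fin 1) K)
    (C : Matrix (Fin 1) (Fin m) K) (D : Matrix (Fin 1) (Fin 1) K) (h : GL (Fin m) K) :
    conjAct (fromBlocks A B C D) h =
      fromBlocks (((h⁻¹ : GL (Fin m) K) : Matrix (Fin m) (Fin m) K) * A * (h : Matrix (Fin m) (Fin m) K))
        (((h⁻¹ : GL (Fin m) K) : Matrix (Fin m) (Fin m) K) * B) (C * (h : Matrix (Fin m) (Fin m) K)) D := by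
  rw [conjAct, coe_glEmb, coe_glEmb, fromBlocks_multiply, fromBlocks_multiply]
  simp

theorem glEmb_inv_mul (h : GL (Fin m) K) :
    ((glEmb h⁻¹ : GL (Idx m) K) : Matrix (Idx m) (Idx m) K) *
      ((glEmb h : GL (Idx m) K) : Matrix (Idx m) (Idx m) K) = 1 := by
  rw [← Units.val_mul, ← map_mul]; simp

theorem glEmb_mul_inv (h : GL (Fin m) K) :
    ((glEmb h : GL (Idx m) K) : Matrix (Idx m) (Idx m) K) *
      ((glEmb h⁻¹ : GL (Idx m) K) : Matrix (Idx m) (Idx m) K) = 1 := by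
  rw [← Units.val_mul, ← map_mul]; simp

/-- Conjugation as an algebra homomorphism. -/
def conjAlgHom (R : Type*) [CommSemiring R] [Algebra R K] (h : GL (Fin m) K) :
    Matrix (Idx m) (Idx m) K →ₐ[R] Matrix (Idx m) (Idx m) K where
  toFun y := conjAct y h
  map_one' := by rw [conjAct, Matrix.mul_one, glEmb_inv_mul]
  map_mul' x y := by
    calc conjAct (x * y) h = ((glEmb h⁻¹ : GL (Idx m) K) : Matrix (Idx m) (Idx m) K) * x *
          (((glEmb h : GL (Idx m) K) : Matrix (Idx m) (Idx m) K) *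
          ((glEmb h⁻¹ : GL (Idx m) K) : Matrix (Idx m) (Idx m) K)) * y *
          ((glEmb h : GL (Idx m) K) : Matrix (Idx m) (Idx m) K) := by
            rw [glEmb_mul_inv, Matrix.mul_one, conjAct, Matrix.mul_assoc _ x y]
      _ = conjAct x h * conjAct y h := by simp only [conjAct, Matrix.mul_assoc]
  map_zero' := by simp [conjAct]
  map_add' x y := by simp [conjAct, Matrix.mul_add, Matrix.add_mul]
  commutes' r := by
    rw [conjAct, ← Algebra.commutes, Matrix.mul_assoc, glEmb_inv_mul, Matrix.mul_one]

theorem glEmb_mulVec_eVec (h : GL (Fin m) K) :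
    ((glEmb h : GL (Idx m) K) : Matrix (Idx m) (Idx m) K) *ᵥ eVec m K = eVec m K := by
  rw [eVec, mulVec_single_one, coe_glEmb]
  ext i
  rcases i with i | i
  · simp
  · rw [Subsingleton.elim i 0]; simp

theorem charpoly_conjAct (y : Matrix (Idx m) (Idx m) K) (h : GL (Fin m) K) :
    (conjAct y h).charpoly = y.charpoly := by
  rw [conjAct, map_inv, Matrix.coe_units_inv, Matrix.charpoly_units_conj']

/-- Scaling of the upper right block of a matrix. -/
def scaleUR (t : K) (y : Matrix (Idx m) (Idx m) K) : Matrix (Idx m) (Idx m) K :=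
  fromBlocks y.toBlocks₁₁ (t • y.toBlocks₁₂) y.toBlocks₂₁ y.toBlocks₂₂

theorem scaleUR_fromBlocks (t : K) (A : Matrix (Fin m) (Fin m) K) (B : Matrix (Fin m) (Fin 1) K)
    (C : Matrix (Fin 1) (Fin m) K) (D : Matrix (Fin 1) (Fin 1) K) :
    scaleUR t (fromBlocks A B C D) = fromBlocks A (t • B) C D := by
  simp [scaleUR]

theorem scaleUR_scaleUR (s t : K) (y : Matrix (Idx m) (Idx m) K) :
    scaleUR s (scaleUR t y) = scaleUR (s * t) y := by
  rw [← fromBlocks_toBlocks y]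
  simp only [scaleUR_fromBlocks, smul_smul]

theorem scaleUR_one (y : Matrix (Idx m) (Idx m) K) : scaleUR 1 y = y := by
  rw [scaleUR, one_smul, fromBlocks_toBlocks]

theorem scaleUR_conjAct (t : K) (y : Matrix (Idx m) (Idx m) K) (h : GL (Fin m) K) :
    scaleUR t (conjAct y h) = conjAct (scaleUR t y) h := by
  rw [← fromBlocks_toBlocks y]
  simp only [conjAct_fromBlocks, scaleUR_fromBlocks, Matrix.mul_smul]

/-- Conjugation by diag(t, 1) multiplies the upper right block by t and the lower left block by t⁻¹.
The latter is compensated beforehand by a change of the last row only, which adds multiples of e to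
the columns and leaves the Krylov determinant unchanged. The factor tᵐ is the determinant of diag(t,
1). -/
theorem det_krylov_scaleUR {t : K} (ht : t ≠ 0) (y : Matrix (Idx m) (Idx m) K) :
    (krylov (scaleUR t y)).det = t ^ m * (krylov y).det := by
  let w : Idx m → K := Sum.elim (fun j => (t - 1) * y (Sum.inr 0) (Sum.inl j)) 0
  let D : Matrix (Idx m) (Idx m) K := fromBlocks (t • 1) 0 0 1
  let D' : Matrix (Idx m) (Idx m) K := fromBlocks (t⁻¹ • 1) 0 0 1
  have h1 : D' * D = 1 := by
    simp [D, D', fromBlocks_multiply, smul_smul, ht]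
  have h2 : D *ᵥ eVec m K = eVec m K := by
    rw [eVec, mulVec_single_one]
    ext i
    rcases i with i | i
    · simp [D]
    · rw [Subsingleton.elim i 0]; simp [D]
  have h3 : scaleUR t y = D * (y + vecMulVec (eVec m K) w) * D' := by
    have hz : y + vecMulVec (eVec m K) w =
        fromBlocks y.toBlocks₁₁ y.toBlocks₁₂ (t • y.toBlocks₂₁) y.toBlocks₂₂ := by
      ext i j
      rcases i with i | i <;> rcases j with j | j
      · simp [vecMulVec_apply, eVec, toBlocks₁₁]
      · simp [vecMulVec_apply, eVec, toBlocks₁₂]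
      · rw [Subsingleton.elim i 0]
        simp [vecMulVec_apply, eVec, toBlocks₂₁, w]
        ring
      · rw [Subsingleton.elim i 0]
        simp [vecMulVec_apply, eVec, toBlocks₂₂, w]
    rw [hz, scaleUR]
    simp [D, D', fromBlocks_multiply, smul_smul, ht]
  rw [h3, krylov_conj_of_fixes D D' _ h1 h2, det_mul, det_krylov_add_vecMulVec]
  simp [D]

/-- After transposition the scaled block lies in the last row, so only multiples of e are added to
the columns. -/
theorem det_krylov_transpose_scaleUR (t : K) (y : Matrix (Idx m) (Idx m) K) :
    (krylov (scaleUR t y)ᵀ).det = (krylov yᵀ).det := by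
  let w : Idx m → K := Sum.elim (fun j => (t - 1) * y (Sum.inl j) (Sum.inr 0)) 0
  have h : (scaleUR t y)ᵀ = yᵀ + vecMulVec (eVec m K) w := by
    ext i j
    rcases i with i | i <;> rcases j with j | j
    · simp [vecMulVec_apply, eVec, toBlocks₁₁, scaleUR]
    · simp [vecMulVec_apply, eVec, toBlocks₂₁, scaleUR]
    · rw [Subsingleton.elim i 0]
      simp [vecMulVec_apply, eVec, toBlocks₁₂, w, scaleUR]
      ring
    · rw [Subsingleton.elim i 0]
      simp [vecMulVec_apply, eVec, toBlocks₂₂, w, scaleUR]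
  rw [h, det_krylov_add_vecMulVec]

theorem isRS_scaleUR {t : K} (ht : t ≠ 0) (y : Matrix (Idx m) (Idx m) K) :
    IsRS (scaleUR t y) ↔ IsRS y := by
  rw [isRS_iff, isRS_iff, det_krylov_scaleUR ht, det_krylov_transpose_scaleUR,
    mul_ne_zero_iff, and_iff_right (pow_ne_zero m ht)]

theorem krylov_conjAct (y : Matrix (Idx m) (Idx m) K) (h : GL (Fin m) K) :
    krylov (conjAct y h) = ((glEmb h⁻¹ : GL (Idx m) K) : Matrix (Idx m) (Idx m) K) * krylov y :=
  krylov_conj_of_fixes _ _ _ (glEmb_mul_inv h) (glEmb_mulVec_eVec _)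

theorem isRS_conjAct (y : Matrix (Idx m) (Idx m) K) (h : GL (Fin m) K) :
    IsRS (conjAct y h) ↔ IsRS y := by
  have e2 : (conjAct y h)ᵀ = ((glEmb h : GL (Idx m) K) : Matrix (Idx m) (Idx m) K)ᵀ * yᵀ *
      ((glEmb h⁻¹ : GL (Idx m) K) : Matrix (Idx m) (Idx m) K)ᵀ := by
    simp only [conjAct, transpose_mul, Matrix.mul_assoc]
  have hu : ∀ h : GL (Fin m) K, ((glEmb h : GL (Idx m) K) : Matrix (Idx m) (Idx m) K).det ≠ 0 :=
    fun h => ((Matrix.isUnit_iff_isUnit_det _).1 (glEmb h).isUnit).ne_zero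
  rw [isRS_iff, isRS_iff, krylov_conjAct, e2, krylov_conj_of_fixes, det_mul, det_mul,
    mul_ne_zero_iff, mul_ne_zero_iff, det_transpose, and_iff_right (hu _), and_iff_right (hu _)]
  · rw [← transpose_mul, glEmb_mul_inv, transpose_one]
  · rw [coe_glEmb, fromBlocks_transpose, eVec, mulVec_single_one]
    ext i
    rcases i with i | i
    · simp
    · rw [Subsingleton.elim i 0]; simp

end ConjAct

/-! ## Comparison of special vectors of different norms -/

section Comparison

variable {F₀ F : Type*} [NormedField F₀] [NormedField F] [NormedAlgebra F₀ F]
variable {σ : F ≃ₐ[F₀] F} {ϖ : F₀} {m : ℕ}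

theorem gram_inv {J J' : Matrix (Fin m) (Fin m) F} {S : GL (Fin m) F}
    (h : (S : Matrix (Fin m) (Fin m) F)ᵀ * J * (S : Matrix (Fin m) (Fin m) F).map σ = J') :
    ((S⁻¹ : GL (Fin m) F) : Matrix (Fin m) (Fin m) F)ᵀ * J' *
      ((S⁻¹ : GL (Fin m) F) : Matrix (Fin m) (Fin m) F).map σ = J := by
  have h1 : ((S⁻¹ : GL (Fin m) F) : Matrix (Fin m) (Fin m) F)ᵀ *
      (S : Matrix (Fin m) (Fin m) F)ᵀ = 1 := by
    rw [← Matrix.transpose_mul, ← Units.val_mul]; simp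
  have h2 : (S : Matrix (Fin m) (Fin m) F).map σ *
      ((S⁻¹ : GL (Fin m) F) : Matrix (Fin m) (Fin m) F).map σ = 1 := by
    rw [← Matrix.map_mul, ← Units.val_mul]; simp
  rw [← h, Matrix.mul_assoc, Matrix.mul_assoc, h2, Matrix.mul_one, ← Matrix.mul_assoc, h1,
    Matrix.one_mul]

theorem charFn_congr {X Y : Type*} {A : Set X} {B : Set Y} {a : X} {b : Y} (h : a ∈ A ↔ b ∈ B) :
    charFn A a = charFn B b := by
  by_cases ha : a ∈ A
  · rw [charFn, charFn, Set.indicator_of_mem ha, Set.indicator_of_mem (h.1 ha)]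
  · rw [charFn, charFn, Set.indicator_of_notMem ha, Set.indicator_of_notMem (mt h.2 ha)]

theorem conjAct_map_conj (σ : F ≃ₐ[F₀] F) (y : Matrix (Idx m) (Idx m) F) (h : GL (Fin m) F₀) :
    (conjAct y (baseGL h)).map σ = conjAct (y.map σ) (baseGL h) := by
  have hb : ∀ h : GL (Fin m) F₀, ((baseGL h : GL (Fin m) F) : Matrix (Fin m) (Fin m) F).map σ =
      ((baseGL h : GL (Fin m) F) : Matrix (Fin m) (Fin m) F) := by
    intro h
    ext i j
    exact AlgEquiv.commutes σ _
  have hi : (baseGL h : GL (Fin m) F)⁻¹ = baseGL h⁻¹ := (map_inv _ _).symm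
  rw [← fromBlocks_toBlocks y]
  simp only [conjAct_fromBlocks, fromBlocks_map, hi, Matrix.map_mul, hb]

theorem map_conj_scaleUR (σ : F ≃ₐ[F₀] F) (t : F₀) (y : Matrix (Idx m) (Idx m) F) :
    (scaleUR (algebraMap F₀ F t) y).map σ = scaleUR (algebraMap F₀ F t) (y.map σ) := by
  rw [← fromBlocks_toBlocks y, fromBlocks_map, scaleUR_fromBlocks, scaleUR_fromBlocks,
    fromBlocks_map]
  congr 1
  ext i j
  simp [Algebra.smul_def]

theorem scaleUR_mem_symLie {y : Matrix (Idx m) (Idx m) F} (hy : y ∈ symLie σ m) (t : F₀) :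
    scaleUR (algebraMap F₀ F t) y ∈ symLie σ m := by
  have hy' : y + y.map σ = 0 := hy
  change scaleUR (algebraMap F₀ F t) y + (scaleUR (algebraMap F₀ F t) y).map σ = 0
  rw [map_conj_scaleUR]
  have : scaleUR (algebraMap F₀ F t) y + scaleUR (algebraMap F₀ F t) (y.map σ) =
      scaleUR (algebraMap F₀ F t) (y + y.map σ) := by
    ext i j
    rcases i with i | i <;> rcases j with j | j <;>
      simp [scaleUR, toBlocks₁₁, toBlocks₁₂, toBlocks₂₁, toBlocks₂₂]
  rw [this, hy']
  ext i j
  rcases i with i | i <;> rcases j with j | j <;>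
    simp [scaleUR, toBlocks₁₁, toBlocks₁₂, toBlocks₂₁, toBlocks₂₂]

/-- The Lie algebra of the unitary group of `W♭ ⊕ F u` in terms of blocks. -/
theorem fromBlocks_mem_unitaryLie_iff {J : Matrix (Fin m) (Fin m) F} {ε : F₀}
    {A : Matrix (Fin m) (Fin m) F} {B : Matrix (Fin m) (Fin 1) F}
    {C : Matrix (Fin 1) (Fin m) F} {E : Matrix (Fin 1) (Fin 1) F} :
    fromBlocks A B C E ∈ unitaryLie σ (extForm J ε) ↔
      Aᵀ * J + J * A.map σ = 0 ∧ algebraMap F₀ F ε • Cᵀ + J * B.map σ = 0 ∧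
        Bᵀ * J + algebraMap F₀ F ε • C.map σ = 0 ∧
        algebraMap F₀ F ε • (Eᵀ + E.map σ) = 0 := by
  have e : (Matrix.of fun _ _ => algebraMap F₀ F ε : Matrix (Fin 1) (Fin 1) F) =
      algebraMap F₀ F ε • 1 := by
    ext i j
    rw [Subsingleton.elim i j]; simp
  have hz : (0 : Matrix (Idx m) (Idx m) F) = fromBlocks 0 0 0 0 := fromBlocks_zero.symm
  change (fromBlocks A B C E)ᵀ * extForm J ε + extForm J ε * (fromBlocks A B C E).map σ = 0 ↔ _
  rw [extForm, e, fromBlocks_transpose, fromBlocks_map, fromBlocks_multiply, fromBlocks_multiply,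
    fromBlocks_add, hz, fromBlocks_inj]
  simp only [Matrix.mul_zero, Matrix.zero_mul, add_zero, zero_add, Matrix.mul_smul,
    Matrix.smul_mul, Matrix.mul_one, Matrix.one_mul, smul_add]

/-- In the off-diagonal conditions ε Cᵀ + J σ(B) = 0 and its conjugate, multiplication of B by ε'/ε
∈ F₀ replaces ε by ε'. The condition on the upper left block does not involve ε. -/
theorem scaleUR_mem_unitaryLie {J : Matrix (Fin m) (Fin m) F} {ε ε' : F₀} (hε : ε ≠ 0)
    {x : Matrix (Idx m) (Idx m) F} (hx : x ∈ unitaryLie σ (extForm J ε)) :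
    scaleUR (algebraMap F₀ F (ε' / ε)) x ∈ unitaryLie σ (extForm J ε') := by
  have hε' : algebraMap F₀ F ε ≠ 0 := by simpa using hε
  have hmul : algebraMap F₀ F ε' = algebraMap F₀ F (ε' / ε) * algebraMap F₀ F ε := by
    rw [← map_mul, div_mul_cancel₀ _ hε]
  rw [← fromBlocks_toBlocks x] at hx ⊢
  rw [scaleUR_fromBlocks]
  rw [fromBlocks_mem_unitaryLie_iff] at hx ⊢
  obtain ⟨h1, h2, h3, h4⟩ := hx
  refine ⟨h1, ?_, ?_, ?_⟩
  · have : (algebraMap F₀ F (ε' / ε) • x.toBlocks₁₂).map σ =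
        algebraMap F₀ F (ε' / ε) • x.toBlocks₁₂.map σ := by
      ext i j; simp
    rw [this, hmul, mul_smul, Matrix.mul_smul, ← smul_add, h2, smul_zero]
  · rw [transpose_smul, Matrix.smul_mul, hmul, mul_smul, ← smul_add, h3, smul_zero]
  · rw [hmul, mul_smul, h4, smul_zero]

theorem extForm_conj (J : Matrix (Fin m) (Fin m) F) (ε : F₀) (T : GL (Fin m) F) :
    ((glEmb T : GL (Idx m) F) : Matrix (Idx m) (Idx m) F)ᵀ * extForm J ε *
      ((glEmb T : GL (Idx m) F) : Matrix (Idx m) (Idx m) F).map σ =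
    extForm ((T : Matrix (Fin m) (Fin m) F)ᵀ * J * (T : Matrix (Fin m) (Fin m) F).map σ) ε := by
  rw [coe_glEmb, extForm, fromBlocks_transpose, fromBlocks_map, fromBlocks_multiply,
    fromBlocks_multiply, extForm]
  simp

theorem conjAct_mem_unitaryLie {J : Matrix (Fin m) (Fin m) F} {ε : F₀}
    {x : Matrix (Idx m) (Idx m) F} (hx : x ∈ unitaryLie σ (extForm J ε)) (T : GL (Fin m) F) :
    conjAct x T ∈ unitaryLie σ (extForm
      ((T : Matrix (Fin m) (Fin m) F)ᵀ * J * (T : Matrix (Fin m) (Fin m) F).map σ) ε) := by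
  have hx' : xᵀ * extForm J ε + extForm J ε * x.map σ = 0 := hx
  rw [← extForm_conj]
  set G := ((glEmb T : GL (Idx m) F) : Matrix (Idx m) (Idx m) F)
  set G' := ((glEmb T⁻¹ : GL (Idx m) F) : Matrix (Idx m) (Idx m) F)
  have h1 : G'ᵀ * Gᵀ = 1 := by rw [← transpose_mul, glEmb_mul_inv, transpose_one]
  have h2 : G.map σ * G'.map σ = 1 := by
    rw [← Matrix.map_mul, glEmb_mul_inv]; simp
  change (G' * x * G)ᵀ * (Gᵀ * extForm J ε * G.map σ) +
    (Gᵀ * extForm J ε * G.map σ) * (G' * x * G).map σ = 0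
  calc _ = Gᵀ * (xᵀ * ((G'ᵀ * Gᵀ) * extForm J ε)) * G.map σ +
        Gᵀ * (extForm J ε * ((G.map σ * G'.map σ) * x.map σ)) * G.map σ := by
          simp only [transpose_mul, Matrix.map_mul, Matrix.mul_assoc]
    _ = Gᵀ * (xᵀ * extForm J ε + extForm J ε * x.map σ) * G.map σ := by
          rw [h1, h2, Matrix.one_mul, Matrix.one_mul, ← Matrix.add_mul, ← Matrix.mul_add]
    _ = 0 := by rw [hx', Matrix.mul_zero, Matrix.zero_mul]

/-- The Krylov determinant acquires the factor tᵐ, of valuation -m. This is the source of the sign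
in the almost self-dual statements. -/
theorem omegaLie_scaleUR (D : UnramifiedQuadratic σ ϖ) {t : F} (ht : t ≠ 0)
    (ht' : ‖t‖ = ‖ϖ‖⁻¹) {y : Matrix (Idx m) (Idx m) F} (hy : IsRS y) :
    omegaLie ϖ (scaleUR t y) = (-1) ^ m * omegaLie ϖ y := by
  rw [omegaLie, omegaLie, det_krylov_scaleUR ht, D.etaTilde_mul (pow_ne_zero m ht)
    ((isRS_iff y).1 hy).1]
  congr 1
  rw [etaTilde_of_norm_eq D.unif (k := -(m : ℤ))]
  · rw [_root_.zpow_neg, zpow_natCast, ← inv_pow]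
    norm_num
  · rw [norm_pow, ht', _root_.zpow_neg, zpow_natCast, inv_pow]

theorem scaleUR_mem_symLieInt_iff (D : UnramifiedQuadratic σ ϖ) {t : F₀} (ht : t ≠ 0)
    (ht' : ‖t‖ = ‖ϖ‖⁻¹) (y : Matrix (Idx m) (Idx m) F) :
    scaleUR (algebraMap F₀ F t) y ∈ symLieInt σ m ↔ y ∈ symLieK σ ϖ m := by
  have hp := D.unif.norm_pos
  have hUR : ∀ i, ‖scaleUR (algebraMap F₀ F t) y (Sum.inl i) (Sum.inr 0)‖ ≤ 1 ↔
      ‖y (Sum.inl i) (Sum.inr 0)‖ ≤ ‖ϖ‖ := by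
    intro i
    have : scaleUR (algebraMap F₀ F t) y (Sum.inl i) (Sum.inr 0) =
        algebraMap F₀ F t * y (Sum.inl i) (Sum.inr 0) := by
      simp [scaleUR, toBlocks₁₂, Algebra.smul_def]
    rw [this, norm_mul, norm_algebraMap', ht', inv_mul_le_iff₀ hp, mul_one]
  constructor
  · rintro ⟨h1, h2⟩
    have hK : ∀ i, ‖y (Sum.inl i) (Sum.inr 0)‖ ≤ ‖ϖ‖ := fun i => (hUR i).1 (h2 _ _)
    refine ⟨⟨?_, ?_⟩, hK⟩
    · have := scaleUR_mem_symLie h1 t⁻¹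
      rwa [scaleUR_scaleUR, ← map_mul, inv_mul_cancel₀ ht, map_one, scaleUR_one] at this
    · intro i j
      rcases i with i | i <;> rcases j with j | j
      · simpa [scaleUR, toBlocks₁₁] using h2 (Sum.inl i) (Sum.inl j)
      · rw [Subsingleton.elim j 0]
        exact (hK i).trans D.unif.2.1.le
      · simpa [scaleUR, toBlocks₂₁] using h2 (Sum.inr i) (Sum.inl j)
      · simpa [scaleUR, toBlocks₂₂] using h2 (Sum.inr i) (Sum.inr j)
  · rintro ⟨⟨h1, h2⟩, h3⟩
    refine ⟨scaleUR_mem_symLie h1 t, ?_⟩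
    intro i j
    rcases i with i | i <;> rcases j with j | j
    · simpa [scaleUR, toBlocks₁₁] using h2 (Sum.inl i) (Sum.inl j)
    · rw [Subsingleton.elim j 0]
      exact (hUR i).2 (h3 i)
    · simpa [scaleUR, toBlocks₂₁] using h2 (Sum.inr i) (Sum.inl j)
    · simpa [scaleUR, toBlocks₂₂] using h2 (Sum.inr i) (Sum.inr j)

/-- Comparison of the linear sides of the two Lie algebra statements. -/
theorem omegaLie_mul_orbLin_scaleUR (D : UnramifiedQuadratic σ ϖ) {t : F₀} (ht : t ≠ 0)
    (ht' : ‖t‖ = ‖ϖ‖⁻¹) (μ : Measure (GL (Fin m) F₀)) {y : Matrix (Idx m) (Idx m) F}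
    (hy : IsRS y) :
    omegaLie ϖ (scaleUR (algebraMap F₀ F t) y) *
        orbLin σ μ (scaleUR (algebraMap F₀ F t) y) (charFn (symLieInt σ m)) =
      omegaLie ϖ y * orbLin σ μ y (fun y => (-1) ^ m * charFn (symLieK σ ϖ m) y) := by
  have h1 : orbLin σ μ y (fun y => (-1) ^ m * charFn (symLieK σ ϖ m) y) =
      (-1) ^ m * orbLin σ μ (scaleUR (algebraMap F₀ F t) y) (charFn (symLieInt σ m)) := by
    rw [orbLin, orbLin, ← integral_const_mul]
    congr 1
    ext h
    rw [mul_assoc]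
    congr 2
    rw [← scaleUR_conjAct]
    exact charFn_congr (scaleUR_mem_symLieInt_iff D ht ht' _).symm
  rw [h1, omegaLie_scaleUR D (by simpa using ht) (by rwa [norm_algebraMap']) hy]
  ring

/-- Transport of the Lie algebra identities along an isometry and a change of special vector. -/
theorem forall_lie_iff (D : UnramifiedQuadratic σ ϖ) {ε : F₀} (hε : ‖ε‖ = 1)
    (μ : Measure (GL (Fin m) F₀)) {J J' : Matrix (Fin m) (Fin m) F} (T : GL (Fin m) F)
    (hT : (T : Matrix (Fin m) (Fin m) F)ᵀ * J * (T : Matrix (Fin m) (Fin m) F).map σ = J')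
    (L L' : Matrix (Idx m) (Idx m) F → ℂ)
    (hL : ∀ x ∈ unitaryLie σ (extForm J ϖ),
      L' (scaleUR (algebraMap F₀ F (ε / ϖ)) (conjAct x T)) = L x) :
    (∀ x ∈ unitaryLie σ (extForm J' ε), IsRS x → ∀ y ∈ symLie σ m, IsRS y → Match y x →
        L' x = omegaLie ϖ y * orbLin σ μ y (charFn (symLieInt σ m))) ↔
      ∀ x ∈ unitaryLie σ (extForm J ϖ), IsRS x → ∀ y ∈ symLie σ m, IsRS y → Match y x →
        L x = omegaLie ϖ y * orbLin σ μ y (fun y => (-1) ^ m * charFn (symLieK σ ϖ m) y) := by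
  have hε0 : ε ≠ 0 := norm_ne_zero_iff.1 (by rw [hε]; exact one_ne_zero)
  have ht : ε / ϖ ≠ 0 := div_ne_zero hε0 D.unif.1
  have ht' : ‖ε / ϖ‖ = ‖ϖ‖⁻¹ := by rw [norm_div, hε, one_div]
  have htF : algebraMap F₀ F (ε / ϖ) ≠ 0 := by simpa using ht
  have hs : ϖ / ε ≠ 0 := div_ne_zero D.unif.1 hε0
  have hsF : algebraMap F₀ F (ϖ / ε) ≠ 0 := by simpa using hs
  have hst : algebraMap F₀ F (ϖ / ε) * algebraMap F₀ F (ε / ϖ) = 1 := by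
    rw [← map_mul, div_mul_div_cancel₀ hε0, div_self D.unif.1, map_one]
  constructor
  · intro H x hx hxrs y hy hyrs ⟨g, hg⟩
    rw [← hL x hx, ← omegaLie_mul_orbLin_scaleUR D ht ht' μ hyrs]
    refine H _ ?_ ?_ _ (scaleUR_mem_symLie hy _) ((isRS_scaleUR htF y).2 hyrs) ⟨g * T, ?_⟩
    · rw [← hT]
      exact scaleUR_mem_unitaryLie D.unif.1 (conjAct_mem_unitaryLie hx T)
    · rw [isRS_scaleUR htF, isRS_conjAct]; exact hxrs
    · rw [← scaleUR_conjAct, conjAct_mul, hg]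
  · intro H x hx hxrs y hy hyrs ⟨g, hg⟩
    have hT' : ((T⁻¹ : GL (Fin m) F) : Matrix (Fin m) (Fin m) F)ᵀ * J' *
        ((T⁻¹ : GL (Fin m) F) : Matrix (Fin m) (Fin m) F).map σ = J := gram_inv hT
    set x₁ := scaleUR (algebraMap F₀ F (ϖ / ε)) (conjAct x T⁻¹) with hx₁
    have hx₁m : x₁ ∈ unitaryLie σ (extForm J ϖ) := by
      have := scaleUR_mem_unitaryLie (ε' := ϖ) hε0 (conjAct_mem_unitaryLie hx T⁻¹)
      rwa [hT'] at this
    have hx₁s : scaleUR (algebraMap F₀ F (ε / ϖ)) (conjAct x₁ T) = x := by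
      rw [hx₁, ← scaleUR_conjAct, scaleUR_scaleUR, mul_comm, hst, scaleUR_one, ← conjAct_mul,
        inv_mul_cancel, conjAct_one]
    set y₁ := scaleUR (algebraMap F₀ F (ϖ / ε)) y with hy₁
    have hy₁s : scaleUR (algebraMap F₀ F (ε / ϖ)) y₁ = y := by
      rw [hy₁, scaleUR_scaleUR, mul_comm, hst, scaleUR_one]
    have hy₁rs : IsRS y₁ := (isRS_scaleUR hsF y).2 hyrs
    have := H x₁ hx₁m (by rw [hx₁, isRS_scaleUR hsF, isRS_conjAct]; exact hxrs) y₁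
      (scaleUR_mem_symLie hy _) hy₁rs
      ⟨g * T⁻¹, by rw [hy₁, ← scaleUR_conjAct, conjAct_mul, hg]⟩
    rw [← hL x₁ hx₁m, hx₁s, ← omegaLie_mul_orbLin_scaleUR D ht ht' μ hy₁rs, hy₁s] at this
    exact this

end Comparison


/-! ## Unitary orbital integrals -/

section Unitary

variable {F₀ F : Type*} [NormedField F₀] [NormedField F] [NormedAlgebra F₀ F]
variable {σ : F ≃ₐ[F₀] F} {ϖ : F₀} {m : ℕ}

theorem UnramifiedQuadratic.continuous_conj (D : UnramifiedQuadratic σ ϖ) : Continuous σ := by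
  have : Isometry σ := AddMonoidHomClass.isometry_of_norm σ D.norm_conj
  exact this.continuous

theorem UnramifiedQuadratic.isClosed_unitaryGp (D : UnramifiedQuadratic σ ϖ) {ι : Type*}
    [Fintype ι] [DecidableEq ι] (J : Matrix ι ι F) :
    IsClosed (unitaryGp σ J : Set (GL ι F)) := by
  have h1 : Continuous fun g : GL ι F => (g : Matrix ι ι F)ᵀ * J * (g : Matrix ι ι F).map σ :=
    ((Units.continuous_val.matrix_transpose).matrix_mul continuous_const).matrix_mul
      (Units.continuous_val.matrix_map D.continuous_conj)
  exact isClosed_eq h1 continuous_const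

/-- Conjugation by `T` as an isomorphism between unitary groups of congruent forms. -/
def unitaryConj {J J' : Matrix (Fin m) (Fin m) F} (T : GL (Fin m) F)
    (h : ∀ g : GL (Fin m) F, g ∈ unitaryGp σ J' ↔ T * g * T⁻¹ ∈ unitaryGp σ J) :
    unitaryGp σ J' ≃* unitaryGp σ J where
  toFun g := ⟨T * g * T⁻¹, (h g).1 g.2⟩
  invFun g := ⟨T⁻¹ * g * T, (h _).2 (by
    have : T * (T⁻¹ * (g : GL (Fin m) F) * T) * T⁻¹ = g := by group
    rw [this]; exact g.2)⟩
  left_inv g := by ext1; simp only; group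
  right_inv g := by ext1; simp only; group
  map_mul' a b := by ext1; simp only [Subgroup.coe_mul]; group

theorem mem_unitaryGp_conj {J J' : Matrix (Fin m) (Fin m) F} {T : GL (Fin m) F}
    (hT : (T : Matrix (Fin m) (Fin m) F)ᵀ * J * (T : Matrix (Fin m) (Fin m) F).map σ = J')
    (g : GL (Fin m) F) : g ∈ unitaryGp σ J' ↔ T * g * T⁻¹ ∈ unitaryGp σ J := by
  let M : GL (Fin m) F → Matrix (Fin m) (Fin m) F := fun g => g
  have key : ∀ (J J' : Matrix (Fin m) (Fin m) F) (S g : GL (Fin m) F),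
      (M S)ᵀ * J * (M S).map σ = J' → g ∈ unitaryGp σ J → S⁻¹ * g * S ∈ unitaryGp σ J' := by
    intro J J' S g hS hg
    have hg' : (M g)ᵀ * J * (M g).map σ = J := hg
    have h1 : (M S⁻¹)ᵀ * (M S)ᵀ = 1 := by
      rw [← Matrix.transpose_mul, ← Units.val_mul]; simp
    have h2 : (M S).map σ * (M S⁻¹).map σ = 1 := by
      rw [← Matrix.map_mul, ← Units.val_mul]; simp
    change (M (S⁻¹ * g * S))ᵀ * J' * (M (S⁻¹ * g * S)).map σ = J'
    rw [← hS]
    calc _ = (M S)ᵀ * ((M g)ᵀ * (((M S⁻¹)ᵀ * (M S)ᵀ) * (J * (((M S).map σ * (M S⁻¹).map σ) *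
          (M g).map σ)))) * (M S).map σ := by
            simp only [M, Units.val_mul, transpose_mul, Matrix.map_mul, Matrix.mul_assoc]
      _ = (M S)ᵀ * J * (M S).map σ := by
            rw [h1, h2, Matrix.one_mul, Matrix.one_mul, ← Matrix.mul_assoc (M g)ᵀ, hg']
  constructor
  · intro hg
    have := key J' J T⁻¹ g (gram_inv hT) hg
    rwa [inv_inv] at this
  · intro hg
    have := key J J' T _ hT hg
    have e : T⁻¹ * (T * g * T⁻¹) * T = g := by group
    rwa [e] at this

theorem continuous_unitaryConj {J J' : Matrix (Fin m) (Fin m) F} (T : GL (Fin m) F)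
    (h : ∀ g : GL (Fin m) F, g ∈ unitaryGp σ J' ↔ T * g * T⁻¹ ∈ unitaryGp σ J) :
    Continuous (unitaryConj T h) ∧ Continuous (unitaryConj T h).symm := by
  constructor
  · exact Continuous.subtype_mk ((continuous_const.mul continuous_subtype_val).mul
      continuous_const) _
  · exact Continuous.subtype_mk ((continuous_const.mul continuous_subtype_val).mul
      continuous_const) _

/-- Haar measures on a locally compact second countable group are equal if they give measure one
to the same set. -/
theorem eq_of_isHaarMeasure {G : Type*} [Group G] [TopologicalSpace G] [IsTopologicalGroup G]
    [LocallyCompactSpace G] [SecondCountableTopology G] [MeasurableSpace G] [BorelSpace G]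
    (μ ν : Measure G) [μ.IsHaarMeasure] [ν.IsHaarMeasure] (S : Set G) (h1 : μ S = 1)
    (h2 : ν S = 1) : μ = ν := by
  have h := Measure.isMulLeftInvariant_eq_smul μ ν
  have hS := congrArg (fun ρ : Measure G => ρ S) h
  simp only [Measure.smul_apply, h1, h2] at hS
  rw [h]
  have : (Measure.haarScalarFactor μ ν : ENNReal) = 1 := by
    simpa [ENNReal.smul_def] using hS.symm
  rw [ENNReal.coe_eq_one] at this
  rw [this, one_smul]

/-- The pushforward of a Haar measure under the isomorphism is again Haar, and the normalization on
S forces it to be ν. No integrability is needed, since the map is a measurable equivalence. -/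
theorem integral_unitaryConj [LocallyCompactSpace F] [SecondCountableTopology F]
    (D : UnramifiedQuadratic σ ϖ) {J J' : Matrix (Fin m) (Fin m) F} (T : GL (Fin m) F)
    (h : ∀ g : GL (Fin m) F, g ∈ unitaryGp σ J' ↔ T * g * T⁻¹ ∈ unitaryGp σ J)
    (ν : Measure (unitaryGp σ J)) (ν' : Measure (unitaryGp σ J')) [ν.IsHaarMeasure]
    [ν'.IsHaarMeasure] (S : Set (unitaryGp σ J)) (hS : ν S = 1)
    (hS' : ν' (unitaryConj T h ⁻¹' S) = 1) (f : unitaryGp σ J → ℂ) :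
    ∫ g, f (unitaryConj T h g) ∂ν' = ∫ g, f g ∂ν := by
  have : LocallyCompactSpace (unitaryGp σ J) :=
    (D.isClosed_unitaryGp J).isClosedEmbedding_subtypeVal.locallyCompactSpace
  have : SecondCountableTopology (unitaryGp σ J) :=
    TopologicalSpace.Subtype.secondCountableTopology (unitaryGp σ J : Set (GL (Fin m) F))
  have hc := continuous_unitaryConj T h
  let e : unitaryGp σ J' ≃ₜ unitaryGp σ J :=
    { (unitaryConj T h).toEquiv with
      continuous_toFun := hc.1
      continuous_invFun := hc.2 }
  have hH : (ν'.map (unitaryConj T h)).IsHaarMeasure :=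
    (unitaryConj T h).isHaarMeasure_map ν' hc.1 hc.2
  have hmap : ν'.map (unitaryConj T h) = ν := by
    refine eq_of_isHaarMeasure _ _ S ?_ hS
    rw [← hS']
    exact e.toMeasurableEquiv.map_apply S
  rw [← hmap]
  exact (integral_map_equiv e.toMeasurableEquiv f).symm

end Unitary

/-! ## Lattices and the comparison of Lie algebra statements -/

section LatticeStabilizers

variable {F₀ F : Type*} [NormedField F₀] [NormedField F] [NormedAlgebra F₀ F]
variable [IsUltrametricDist F] {σ : F ≃ₐ[F₀] F} {ϖ : F₀} {m : ℕ}
variable {Λ : Submodule (intRing F) (Fin m → F)} {T : GL (Fin m) F}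

theorem mem_extLattice_iff
    (hT : ∀ x, (T : Matrix (Fin m) (Fin m) F) *ᵥ x ∈ Λ ↔ ∀ i, ‖x i‖ ≤ 1) (w : Idx m → F) :
    ((glEmb T : GL (Idx m) F) : Matrix (Idx m) (Idx m) F) *ᵥ w ∈ extLattice Λ ↔
      ∀ i, ‖w i‖ ≤ 1 := by
  have h1 : ((glEmb T : GL (Idx m) F) : Matrix (Idx m) (Idx m) F) *ᵥ w =
      Sum.elim ((T : Matrix (Fin m) (Fin m) F) *ᵥ (w ∘ Sum.inl)) (w ∘ Sum.inr) := by
    rw [coe_glEmb, fromBlocks_mulVec]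
    simp
  rw [h1]
  change (T : Matrix (Fin m) (Fin m) F) *ᵥ (w ∘ Sum.inl) ∈ Λ ∧ w (Sum.inr 0) ∈ intRing F ↔ _
  rw [hT, mem_intRing, Sum.forall]
  simp [Fin.forall_fin_one]

/-- The matrix diag(T, 1) carries the standard lattice onto Λ ⊕ O u, so preserving the latter means
being integral in the corresponding basis. -/
theorem stabilizes_extLattice_iff
    (hT : ∀ x, (T : Matrix (Fin m) (Fin m) F) *ᵥ x ∈ Λ ↔ ∀ i, ‖x i‖ ≤ 1)
    (z : Matrix (Idx m) (Idx m) F) :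
    (∀ w ∈ extLattice Λ, z *ᵥ w ∈ extLattice Λ) ↔ IntegralEntries (conjAct z T) := by
  set E := ((glEmb T : GL (Idx m) F) : Matrix (Idx m) (Idx m) F) with hE
  set E' := ((glEmb T⁻¹ : GL (Idx m) F) : Matrix (Idx m) (Idx m) F) with hE'
  have key : ∀ w, z *ᵥ (E *ᵥ w) = E *ᵥ (conjAct z T *ᵥ w) := by
    intro w
    rw [mulVec_mulVec, mulVec_mulVec, conjAct, ← hE, ← hE', Matrix.mul_assoc E', ← Matrix.mul_assoc,
      glEmb_mul_inv, Matrix.one_mul]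
  constructor
  · intro h
    refine integralEntries_of_mulVec fun x hx => ?_
    rw [← mem_extLattice_iff hT, ← hE, ← key]
    exact h _ ((mem_extLattice_iff hT x).2 hx)
  · intro h w hw
    have hw' : w = E *ᵥ (E' *ᵥ w) := by
      rw [mulVec_mulVec, glEmb_mul_inv, one_mulVec]
    rw [hw', key, hE, mem_extLattice_iff hT]
    rw [hw', hE, mem_extLattice_iff hT] at hw
    exact h.norm_mulVec_le hw

/-- For forms of the shape `1 ⊕ ϖ`, integrality is the same as integrality after scaling. -/
theorem integralEntries_scaleUR_iff (D : UnramifiedQuadratic σ ϖ) {t : F} (ht : ‖t‖ = ‖ϖ‖⁻¹)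
    {z : Matrix (Idx m) (Idx m) F} (hz : z ∈ unitaryLie σ (extForm 1 ϖ)) :
    IntegralEntries (scaleUR t z) ↔ IntegralEntries z := by
  have hp := D.unif.norm_pos
  -- The relation ϖ Cᵀ + σ(B) = 0 makes the upper right entries smaller than the lower left ones by
  -- exactly ‖ϖ‖. Scaling by t equalizes them, so neither version imposes a further condition.
  have hbc : ∀ i, ‖z (Sum.inl i) (Sum.inr 0)‖ = ‖ϖ‖ * ‖z (Sum.inr 0) (Sum.inl i)‖ := by
    intro i
    have h := hz
    rw [← fromBlocks_toBlocks z, fromBlocks_mem_unitaryLie_iff] at h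
    have h2 := congrFun (congrFun h.2.1 i) 0
    rw [Matrix.one_mul] at h2
    simp only [Matrix.add_apply, Matrix.smul_apply, Matrix.transpose_apply, toBlocks₂₁, of_apply,
      Matrix.map_apply, toBlocks₁₂, Matrix.zero_apply, smul_eq_mul] at h2
    rw [← D.norm_conj, ← norm_algebraMap' F ϖ, ← norm_mul, eq_neg_of_add_eq_zero_left h2, norm_neg]
  have e12 : ∀ i, ‖scaleUR t z (Sum.inl i) (Sum.inr 0)‖ = ‖z (Sum.inr 0) (Sum.inl i)‖ := by
    intro i
    have : scaleUR t z (Sum.inl i) (Sum.inr 0) = t * z (Sum.inl i) (Sum.inr 0) := by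
      simp [scaleUR, toBlocks₁₂]
    rw [this, norm_mul, ht, hbc, inv_mul_cancel_left₀ hp.ne']
  constructor
  · intro h i j
    rcases i with i | i <;> rcases j with j | j
    · simpa [scaleUR, toBlocks₁₁] using h (Sum.inl i) (Sum.inl j)
    · rw [Subsingleton.elim j 0, hbc, ← e12]
      exact mul_le_one₀ D.unif.2.1.le (norm_nonneg _) (h _ _)
    · simpa [scaleUR, toBlocks₂₁] using h (Sum.inr i) (Sum.inl j)
    · simpa [scaleUR, toBlocks₂₂] using h (Sum.inr i) (Sum.inr j)
  · intro h i j
    rcases i with i | i <;> rcases j with j | j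
    · simpa [scaleUR, toBlocks₁₁] using h (Sum.inl i) (Sum.inl j)
    · rw [Subsingleton.elim j 0, e12]
      exact h _ _
    · simpa [scaleUR, toBlocks₂₁] using h (Sum.inr i) (Sum.inl j)
    · simpa [scaleUR, toBlocks₂₂] using h (Sum.inr i) (Sum.inr j)

/-- Comparison of the unitary sides of the two Lie algebra statements. -/
theorem orbU_scaleUR_eq [LocallyCompactSpace F] [SecondCountableTopology F]
    (D : UnramifiedQuadratic σ ϖ) {ε : F₀} (hε : ‖ε‖ = 1) {J J' : Matrix (Fin m) (Fin m) F}
    {Λ Λ' : Submodule (intRing F) (Fin m → F)} {T₁ T₂ : GL (Fin m) F}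
    (h₁ : ∀ x, (T₁ : Matrix (Fin m) (Fin m) F) *ᵥ x ∈ Λ ↔ ∀ i, ‖x i‖ ≤ 1)
    (h₁' : (T₁ : Matrix (Fin m) (Fin m) F)ᵀ * J * (T₁ : Matrix (Fin m) (Fin m) F).map σ = 1)
    (h₂ : ∀ x, (T₂ : Matrix (Fin m) (Fin m) F) *ᵥ x ∈ Λ' ↔ ∀ i, ‖x i‖ ≤ 1)
    (hT : ((T₁ * T₂⁻¹ : GL (Fin m) F) : Matrix (Fin m) (Fin m) F)ᵀ * J *
      ((T₁ * T₂⁻¹ : GL (Fin m) F) : Matrix (Fin m) (Fin m) F).map σ = J')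
    (ν : Measure (unitaryGp σ J)) (ν' : Measure (unitaryGp σ J')) [ν.IsHaarMeasure]
    [ν'.IsHaarMeasure] (hν : ν {h | (h : GL (Fin m) F) ∈ stabGp (unitaryGp σ J) Λ} = 1)
    (hν' : ν' {h | (h : GL (Fin m) F) ∈ stabGp (unitaryGp σ J') Λ'} = 1)
    {x : Matrix (Idx m) (Idx m) F} (hx : x ∈ unitaryLie σ (extForm J ϖ)) :
    orbU ν' (scaleUR (algebraMap F₀ F (ε / ϖ)) (conjAct x (T₁ * T₂⁻¹)))
        (charFn (stabLie (unitaryLie σ (extForm J' ε)) (extLattice Λ'))) =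
      orbU ν x (charFn (stabLie (unitaryLie σ (extForm J ϖ)) (extLattice Λ))) := by
  set T := T₁ * T₂⁻¹ with hTdef
  have hconj := mem_unitaryGp_conj hT
  have hnorm : ‖algebraMap F₀ F (ε / ϖ)‖ = ‖ϖ‖⁻¹ := by
    rw [norm_algebraMap', norm_div, hε, one_div]
  have hΛ : ∀ v : Fin m → F, (T : Matrix (Fin m) (Fin m) F) *ᵥ v ∈ Λ ↔ v ∈ Λ' := by
    intro v
    have : v = (T₂ : Matrix (Fin m) (Fin m) F) *ᵥ
        (((T₂⁻¹ : GL (Fin m) F) : Matrix (Fin m) (Fin m) F) *ᵥ v) := by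
      rw [mulVec_mulVec, ← Units.val_mul, mul_inv_cancel, Units.val_one, one_mulVec]
    rw [hTdef, Units.val_mul, ← mulVec_mulVec, h₁, ← h₂, ← this]
  rw [orbU, orbU, ← integral_unitaryConj D T hconj ν ν' _ hν]
  · congr 1
    ext h'
    apply charFn_congr
    set h : unitaryGp σ J := unitaryConj T hconj h' with hh
    have hTh : T * (h' : GL (Fin m) F) = (h : GL (Fin m) F) * T := by
      change _ = T * (h' : GL (Fin m) F) * T⁻¹ * T
      group
    have e1 : conjAct (scaleUR (algebraMap F₀ F (ε / ϖ)) (conjAct x T)) (h' : GL (Fin m) F) =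
        scaleUR (algebraMap F₀ F (ε / ϖ)) (conjAct (conjAct x (h : GL (Fin m) F)) T) := by
      rw [← scaleUR_conjAct, ← conjAct_mul, hTh, conjAct_mul]
    have hz : conjAct x (h : GL (Fin m) F) ∈ unitaryLie σ (extForm J ϖ) := by
      have := conjAct_mem_unitaryLie hx (h : GL (Fin m) F)
      have hm : ((h : GL (Fin m) F) : Matrix (Fin m) (Fin m) F)ᵀ * J *
        ((h : GL (Fin m) F) : Matrix (Fin m) (Fin m) F).map σ = J := h.2
      rwa [hm] at this
    rw [e1]
    set z := conjAct x (h : GL (Fin m) F) with hzdef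
    have hz' : scaleUR (algebraMap F₀ F (ε / ϖ)) (conjAct z T) ∈
        unitaryLie σ (extForm J' ε) := by
      rw [← hT]
      exact scaleUR_mem_unitaryLie D.unif.1 (conjAct_mem_unitaryLie hz T)
    have hz₁ : conjAct z T₁ ∈ unitaryLie σ (extForm 1 ϖ) := by
      rw [← h₁']
      exact conjAct_mem_unitaryLie hz T₁
    change (_ ∧ _) ↔ (_ ∧ _)
    -- Since T T₂ = T₁, both lattice conditions become integrality of conjugates by T₁, where the
    -- Gram matrix of the small space is 1.
    rw [and_iff_right hz, and_iff_right hz', stabilizes_extLattice_iff h₁,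
      stabilizes_extLattice_iff h₂, ← scaleUR_conjAct, ← conjAct_mul, hTdef,
      inv_mul_cancel_right, integralEntries_scaleUR_iff D hnorm hz₁]
  · rw [← hν']
    congr 1
    ext h'
    change (T * (h' : GL (Fin m) F) * T⁻¹ ∈ unitaryGp σ J ∧ _) ↔
      ((h' : GL (Fin m) F) ∈ unitaryGp σ J' ∧ _)
    rw [← hconj]
    refine and_congr_right fun _ => ⟨fun H v => ?_, fun H v => ?_⟩
    · have := H ((T : Matrix (Fin m) (Fin m) F) *ᵥ v)
      rw [mulVec_mulVec, ← Units.val_mul, hΛ] at this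
      have e : unitaryConj T hconj h' * T = T * (h' : GL (Fin m) F) := by
        change T * (h' : GL (Fin m) F) * T⁻¹ * T = _
        group
      rw [e, Units.val_mul, ← mulVec_mulVec, hΛ] at this
      exact this
    · have e : v = (T : Matrix (Fin m) (Fin m) F) *ᵥ
          (((T⁻¹ : GL (Fin m) F) : Matrix (Fin m) (Fin m) F) *ᵥ v) := by
        rw [mulVec_mulVec, ← Units.val_mul, mul_inv_cancel, Units.val_one, one_mulVec]
      change (((T * (h' : GL (Fin m) F) * T⁻¹ : GL (Fin m) F) : Matrix (Fin m) (Fin m) F) *ᵥ v ∈ Λ)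
        ↔ _
      rw [Units.val_mul, Units.val_mul, ← mulVec_mulVec, ← mulVec_mulVec, hΛ, H]
      nth_rewrite 2 [e]
      rw [hΛ]

theorem UnramifiedQuadratic.exists_det_eq (D : UnramifiedQuadratic σ ϖ)
    {J : Matrix (Fin m) (Fin m) F} (hJ : IsHermForm σ J) :
    ∃ a : F₀, algebraMap F₀ F a = J.det ∧ a ≠ 0 := by
  obtain ⟨a, ha⟩ := D.exists_of_fixed J.det (by
    have h := congrArg Matrix.det hJ.1
    rw [det_transpose] at h
    exact (RingHom.map_det (σ : F →+* F) J).trans h.symm)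
  refine ⟨a, ha, ?_⟩
  rintro rfl
  exact hJ.2 (by rw [← ha, map_zero])

/-- The sign in the definition of a split form is a unit, so only the parity of the valuation of the
discriminant matters. -/
theorem UnramifiedQuadratic.isSplitForm_extForm_iff (D : UnramifiedQuadratic σ ϖ)
    {J : Matrix (Fin m) (Fin m) F} (ε : F₀) {a : F₀} (ha : algebraMap F₀ F a = J.det) :
    IsSplitForm σ (extForm J ε) ↔ ∃ k : ℤ, ‖a * ε‖ = ‖ϖ‖ ^ (2 * k) := by
  have hd : (extForm J ε).det = algebraMap F₀ F (a * ε) := by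
    rw [extForm, det_fromBlocks_zero₂₁, ← ha, map_mul]
    simp
  rw [IsSplitForm, hd]
  set N := Fintype.card (Idx m) * (Fintype.card (Idx m) - 1) / 2
  have e : (-1 : F) ^ N * algebraMap F₀ F (a * ε) = algebraMap F₀ F ((-1) ^ N * (a * ε)) := by
    rw [map_mul _ ((-1) ^ N), map_pow, map_neg, map_one]
  rw [e, D.exists_eq_norm_iff, norm_mul ((-1) ^ N), norm_pow, norm_neg, norm_one, one_pow, one_mul]

/-- The Lie algebra statements for special vectors of unit norm and of norm `ϖ` are equivalent. -/
theorem lieFL_iff_lieAFL [LocallyCompactSpace F] [SecondCountableTopology F]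
    [IsUltrametricDist F₀]
    (D : UnramifiedQuadratic σ ϖ) (μ : Measure (GL (Fin m) F₀)) (W : HermPair σ m ϖ)
    (Λ : Submodule (intRing F) (Fin m → F)) (hΛ : IsSelfDual σ (W.J 1) Λ)
    (ν : ∀ i, Measure (W.H i)) [∀ i, (ν i).IsHaarMeasure]
    (hν : ν 1 {h | (h : GL (Fin m) F) ∈ stabGp (W.H 1) Λ} = 1)
    (ε : F₀) (hε : ‖ε‖ = 1) (W' : HermPair σ m ε) (Λ' : Submodule (intRing F) (Fin m → F))
    (hΛ' : IsSelfDual σ (W'.J 0) Λ') (ν' : ∀ i, Measure (W'.H i)) [∀ i, (ν' i).IsHaarMeasure]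
    (hν' : ν' 0 {h | (h : GL (Fin m) F) ∈ stabGp (W'.H 0) Λ'} = 1) :
    LieFL ϖ μ W' Λ' ν' ↔ LieAFL ϖ μ W Λ ν := by
  obtain ⟨T₁, h₁, h₁'⟩ := D.exists_orthonormal_basis (W.herm 1) hΛ
  obtain ⟨T₂, h₂, h₂'⟩ := D.exists_orthonormal_basis (W'.herm 0) hΛ'
  have hT : ((T₁ * T₂⁻¹ : GL (Fin m) F) : Matrix (Fin m) (Fin m) F)ᵀ * W.J 1 *
      ((T₁ * T₂⁻¹ : GL (Fin m) F) : Matrix (Fin m) (Fin m) F).map σ = W'.J 0 := by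
    rw [Units.val_mul, transpose_mul, Matrix.map_mul, ← gram_inv h₂', ← h₁']
    simp only [Matrix.mul_assoc]
  -- Both discriminants have odd valuation: W_0 is split with special norm ϖ of valuation one, and
  -- W'_1 is non-split with special norm a unit. Their quotient is therefore a norm.
  obtain ⟨T, hT'⟩ : HermCong (σ : F →+* F) (W.J 0) (W'.J 1) := by
    refine D.hermCong_of_det m _ _ (W.herm 0).1 (W'.herm 1).1 (W.herm 0).2 (W'.herm 1).2 ?_
    obtain ⟨a, ha, ha0⟩ := D.exists_det_eq (W.herm 0)
    obtain ⟨b, hb, hb0⟩ := D.exists_det_eq (W'.herm 1)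
    have hs := (D.isSplitForm_extForm_iff ϖ ha).1 W.split
    have hns := mt (D.isSplitForm_extForm_iff ε hb).2 W'.nonsplit
    obtain ⟨k, hk⟩ := hs
    obtain ⟨l, hl⟩ := D.unif.exists_norm_eq hb0
    have hodd : Odd l := by
      rw [← Int.not_even_iff_odd]
      rintro ⟨r, hr⟩
      exact hns ⟨r, by rw [norm_mul, hε, mul_one, hl, hr, two_mul]⟩
    obtain ⟨r, hr⟩ := hodd
    have hka : ‖a‖ = ‖ϖ‖ ^ (2 * k - 1) := by
      rw [norm_mul] at hk
      rw [zpow_sub_one₀ D.unif.norm_pos.ne', ← hk, mul_inv_cancel_right₀ D.unif.norm_pos.ne']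
    obtain ⟨c, -, hc⟩ := D.exists_eq_norm_iff.2 ⟨r - k + 1, show ‖b / a‖ = _ by
      rw [norm_div, hka, hl, ← zpow_sub₀ D.unif.norm_pos.ne']
      congr 1
      omega⟩
    refine ⟨c, ?_⟩
    rw [hc, ← ha, ← hb, ← map_mul, mul_div_cancel₀ _ ha0]
  -- The indices cross over: index 1 for norm ϖ corresponds to index 0 for norm ε, and conversely.
  have e0 := forall_lie_iff D hε μ (T₁ * T₂⁻¹) hT
    (fun x => orbU (ν 1) x (charFn (stabLie (W.g 1) (extLattice Λ))))
    (fun x => orbU (ν' 0) x (charFn (stabLie (W'.g 0) (extLattice Λ'))))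
    (fun x hx => orbU_scaleUR_eq D hε h₁ h₁' h₂ hT (ν 1) (ν' 0) hν hν' hx)
  have e1 := forall_lie_iff D hε μ T hT'
    (fun x => orbU (ν 0) x (0 : Matrix (Idx m) (Idx m) F → ℂ))
    (fun x => orbU (ν' 1) x (0 : Matrix (Idx m) (Idx m) F → ℂ))
    (fun x hx => by simp [orbU])
  rw [LieFL, LieAFL, TransferLie, TransferLie, Fin.forall_fin_two, Fin.forall_fin_two]
  constructor
  · exact fun ⟨a, b⟩ => ⟨e1.1 b, e0.1 a⟩
  · exact fun ⟨a, b⟩ => ⟨e0.2 b, e1.2 a⟩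

end LatticeStabilizers


/-! ## The Cayley transform -/

section Cayley

variable {F₀ F : Type*} [NormedField F₀] [NormedField F] [NormedAlgebra F₀ F]
variable {σ : F ≃ₐ[F₀] F} {ϖ : F₀} {m : ℕ}

/-- If the residue field of `F₀` has at least `n` elements, then a monic polynomial of degree `n`
over `O_F` takes a unit value at some element of norm one. -/
theorem UnramifiedQuadratic.exists_norm_one_eval_unit [IsUltrametricDist F₀] [IsUltrametricDist F]
    [ProperSpace F₀] (D : UnramifiedQuadratic σ ϖ) {n : ℕ} (hn : n ≤ residueCard F₀)
    (P : Polynomial (intRing F)) (hP : P.Monic) (hdeg : P.natDegree = n) :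
    ∃ ξ : intRing F, (ξ : F) * σ ξ = 1 ∧ ‖((P.eval ξ : intRing F) : F)‖ = 1 := by
  classical
  have hfin := D.unif.finite_residueField
  have := Fintype.ofFinite (IsLocalRing.ResidueField (intRing F₀))
  obtain ⟨δ, hδ, hδ1⟩ := D.exists_anti_unit
  have hle : ∀ a : intRing F₀, ‖algebraMap F₀ F a‖ ≤ 1 := fun a => by
    rw [norm_algebraMap']; exact norm_coe_le_one a
  -- The difference of a + δ and its conjugate is the unit 2δ, so a + δ cannot have norm below 1.
  have ht : ∀ a : intRing F₀, ‖algebraMap F₀ F a + δ‖ = 1 := by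
    intro a
    refine le_antisymm ((IsUltrametricDist.norm_add_le_max _ _).trans (max_le (hle a) hδ1.le)) ?_
    have h1 : (2 : F) * δ = (algebraMap F₀ F a + δ) - σ (algebraMap F₀ F a + δ) := by
      rw [map_add, AlgEquiv.commutes, hδ]; ring
    have h2 := congrArg norm h1
    rw [norm_mul, D.norm_two, hδ1, one_mul] at h2
    rw [h2, sub_eq_add_neg]
    refine (IsUltrametricDist.norm_add_le_max _ _).trans ?_
    rw [norm_neg, D.norm_conj, max_self]
  have hs : ∀ a : intRing F₀, ‖algebraMap F₀ F a - δ‖ = 1 := by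
    intro a
    rw [← ht a, ← D.norm_conj (algebraMap F₀ F a + δ), map_add, AlgEquiv.commutes, hδ,
      sub_eq_add_neg]
  have hs0 : ∀ a : intRing F₀, algebraMap F₀ F a - δ ≠ 0 := fun a =>
    norm_ne_zero_iff.1 (by rw [hs a]; exact one_ne_zero)
  have ht0 : ∀ a : intRing F₀, algebraMap F₀ F a + δ ≠ 0 := fun a =>
    norm_ne_zero_iff.1 (by rw [ht a]; exact one_ne_zero)
  let x : intRing F₀ → intRing F := fun a =>
    ⟨(algebraMap F₀ F a + δ) / (algebraMap F₀ F a - δ),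
      mem_intRing.2 (by rw [norm_div, ht, hs, div_one])⟩
  have hxval : ∀ a, (x a : F) = (algebraMap F₀ F a + δ) / (algebraMap F₀ F a - δ) := fun _ => rfl
  have hx1 : ∀ a, (x a : F) * σ (x a) = 1 := by
    intro a
    rw [hxval, map_div₀, map_add, map_sub, AlgEquiv.commutes, hδ, sub_neg_eq_add, ← sub_eq_add_neg]
    have := hs0 a
    have := ht0 a
    field_simp
  let k := IsLocalRing.ResidueField (intRing F₀)
  let lift : k → intRing F₀ := Function.surjInv IsLocalRing.residue_surjective
  have hlift : ∀ r, IsLocalRing.residue (intRing F₀) (lift r) = r :=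
    Function.surjInv_eq IsLocalRing.residue_surjective
  -- These are q + 1 elements of norm one: 1, and (a + δ)/(a - δ) for a running through lifts of the
  -- residue field of F₀. They are pairwise incongruent modulo the maximal ideal.
  let z : Option k → intRing F := fun o => o.elim 1 fun r => x (lift r)
  have hz1 : ∀ o, (z o : F) * σ (z o) = 1 := by
    rintro (_ | r)
    · change (1 : F) * σ (1 : F) = 1
      rw [map_one, one_mul]
    · exact hx1 _
  have hzinj : Function.Injective fun o => IsLocalRing.residue (intRing F) (z o) := by
    have h1 : ∀ a, ‖(x a : F) - 1‖ = 1 := by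
      intro a
      have : (x a : F) - 1 = 2 * δ / (algebraMap F₀ F a - δ) := by
        rw [hxval, eq_div_iff (hs0 a), sub_mul, div_mul_cancel₀ _ (hs0 a)]
        ring
      rw [this, norm_div, norm_mul, D.norm_two, hδ1, hs]
      norm_num
    rintro (_ | r) (_ | s) h
    · rfl
    · exfalso
      have h' := residue_eq_iff_norm.1 h
      rw [norm_sub_rev] at h'
      exact h'.ne (h1 (lift s))
    · exfalso
      exact (residue_eq_iff_norm.1 h).ne (h1 (lift r))
    · have h' := residue_eq_iff_norm.1 h
      have : (x (lift r) : F) - x (lift s) = 2 * δ * algebraMap F₀ F (lift s - lift r) /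
          ((algebraMap F₀ F (lift r) - δ) * (algebraMap F₀ F (lift s) - δ)) := by
        have h1 := hs0 (lift r)
        have h2 := hs0 (lift s)
        rw [hxval, hxval, map_sub]
        field_simp
        ring
      change ‖(x (lift r) : F) - x (lift s)‖ < 1 at h'
      rw [this, norm_div, norm_mul, norm_mul, norm_mul, D.norm_two, hδ1, hs, hs,
        norm_algebraMap', one_mul, one_mul, div_one, norm_sub_rev] at h'
      have h2 := residue_eq_iff_norm.2 h'
      rw [hlift, hlift] at h2
      rw [h2]
  -- Otherwise the reduction of P, of degree n ≤ q, would have q + 1 distinct roots.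
  by_contra! hno
  let Q := P.map (IsLocalRing.residue (intRing F))
  have hQ0 : Q ≠ 0 := (hP.map _).ne_zero
  have hroot : ∀ o, Q.IsRoot (IsLocalRing.residue (intRing F) (z o)) := by
    intro o
    rw [Polynomial.IsRoot.def, Polynomial.eval_map_apply, residue_eq_zero_iff_norm]
    exact lt_of_le_of_ne (norm_coe_le_one _) (hno _ (hz1 o))
  have hcard : (Finset.univ.image fun o => IsLocalRing.residue (intRing F) (z o)).card ≤
      Q.natDegree := by
    refine Polynomial.card_le_degree_of_subset_roots fun r hr => ?_
    obtain ⟨o, -, rfl⟩ := Finset.mem_image.1 hr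
    exact (Polynomial.mem_roots hQ0).2 (hroot o)
  rw [Finset.card_image_of_injective _ hzinj, Finset.card_univ, Fintype.card_option,
    hP.natDegree_map, hdeg] at hcard
  rw [residueCard, Nat.card_eq_fintype_card] at hn
  have hcard' : Fintype.card (IsLocalRing.ResidueField (intRing F₀)) + 1 ≤ n := hcard
  omega

theorem det_one_sub_smul {ι : Type*} [Fintype ι] [DecidableEq ι] (γ : Matrix ι ι F) {ξ : F}
    (hξ : ξ ≠ 0) : γ.charpoly.eval ξ = ξ ^ Fintype.card ι * (1 - ξ⁻¹ • γ).det := by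
  rw [Matrix.eval_charpoly, ← Matrix.det_smul]
  congr 1
  rw [smul_sub, smul_smul, mul_inv_cancel₀ hξ, one_smul]
  congr 1
  ext i j
  simp [Matrix.scalar_apply, Matrix.diagonal_apply, Matrix.one_apply]

theorem cayley_mul_one_sub {ι : Type*} [Fintype ι] [DecidableEq ι] {γ : Matrix ι ι F} {ξ : F}
    (h : IsUnit (1 - ξ⁻¹ • γ).det) : cayley ξ γ * (1 - ξ⁻¹ • γ) = 1 + ξ⁻¹ • γ := by
  rw [cayley, Matrix.mul_assoc, Matrix.nonsing_inv_mul _ h, Matrix.mul_one]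

/-- For c = ξ⁻¹γ one has c σ(c) = 1, so σ replaces c by c⁻¹, and this changes the sign of (1 + c)(1
- c)⁻¹. -/
theorem cayley_mem_symLie {γ : Matrix (Idx m) (Idx m) F} (hγ : γ ∈ symSpace σ m) {ξ : F}
    (hξ : ξ * σ ξ = 1) (hu : IsUnit (1 - ξ⁻¹ • γ).det) : cayley ξ γ ∈ symLie σ m := by
  have hγ' : γ * γ.map σ = 1 := hγ
  have hξ0 : ξ ≠ 0 := left_ne_zero_of_mul_eq_one hξ
  set c := ξ⁻¹ • γ with hc
  have hcm : c.map σ = ξ • γ.map σ := by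
    ext i j
    simp only [hc, Matrix.map_apply, Matrix.smul_apply, smul_eq_mul, map_mul, map_inv₀]
    rw [inv_eq_of_mul_eq_one_left hξ]
  have hcc : c * c.map σ = 1 := by
    rw [hcm, hc, smul_mul_smul_comm, inv_mul_cancel₀ hξ0, one_smul, hγ']
  have h1 := cayley_mul_one_sub hu
  rw [← hc] at h1
  have h2 : (cayley ξ γ).map σ * (1 - c.map σ) = 1 + c.map σ := by
    have := congrArg (fun M => M.map σ) h1
    simpa [Matrix.map_mul, Matrix.map_sub, Matrix.map_add] using this
  have h3 : (1 - c) * c.map σ = -(1 - c.map σ) := by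
    rw [sub_mul, one_mul, hcc, neg_sub]
  have h4 : cayley ξ γ * (1 - c.map σ) = -(1 + c.map σ) := by
    rw [← neg_neg (1 - c.map σ), ← h3, mul_neg, ← Matrix.mul_assoc, h1, add_mul, one_mul, hcc,
      add_comm]
  have hu' : IsUnit (1 - c.map σ).det := by
    have : (1 - c.map σ) = (σ : F →+* F).mapMatrix (1 - c) := by
      ext i j
      simp [Matrix.one_apply, apply_ite σ]
    rw [this, ← RingHom.map_det]
    exact hu.map _
  have h5 : (cayley ξ γ + (cayley ξ γ).map σ) * (1 - c.map σ) = 0 := by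
    rw [add_mul, h2, h4, neg_add_cancel]
  change cayley ξ γ + (cayley ξ γ).map σ = 0
  have := congrArg (· * (1 - c.map σ)⁻¹) h5
  simpa only [Matrix.mul_assoc, Matrix.mul_nonsing_inv _ hu', Matrix.mul_one, Matrix.zero_mul]
    using this

/-- As ξ has norm one, c = ξ⁻¹g is still unitary. The condition is checked after multiplication by
the invertible (1 - c)ᵀ and 1 - σ(c), where everything cancels against cᵀ J σ(c) = J. -/
theorem cayley_mem_unitaryLie {ι : Type*} [Fintype ι] [DecidableEq ι] {J g : Matrix ι ι F}
    (hg : gᵀ * J * g.map σ = J) {ξ : F} (hξ : ξ * σ ξ = 1) (hu : IsUnit (1 - ξ⁻¹ • g).det) :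
    cayley ξ g ∈ unitaryLie σ J := by
  have hξ0 : ξ ≠ 0 := left_ne_zero_of_mul_eq_one hξ
  set c := ξ⁻¹ • g with hc
  have hcm : c.map σ = ξ • g.map σ := by
    ext i j
    simp only [hc, Matrix.map_apply, Matrix.smul_apply, smul_eq_mul, map_mul, map_inv₀]
    rw [inv_eq_of_mul_eq_one_left hξ]
  have hcc : cᵀ * J * c.map σ = J := by
    rw [hcm, hc, transpose_smul, Matrix.smul_mul, smul_mul_smul_comm, inv_mul_cancel₀ hξ0, one_smul,
      hg]
  have h1 := cayley_mul_one_sub hu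
  rw [← hc] at h1
  set x := cayley ξ g
  have h1t : (1 - c)ᵀ * xᵀ = (1 + c)ᵀ := by rw [← transpose_mul, h1]
  have h2 : x.map σ * (1 - c.map σ) = 1 + c.map σ := by
    have := congrArg (fun M => M.map σ) h1
    simpa [Matrix.map_mul, Matrix.map_sub, Matrix.map_add] using this
  have hu' : IsUnit (1 - c.map σ).det := by
    have : (1 - c.map σ) = (σ : F →+* F).mapMatrix (1 - c) := by
      ext i j
      simp [Matrix.one_apply, apply_ite σ]
    rw [this, ← RingHom.map_det]
    exact hu.map _
  have hut : IsUnit ((1 - c)ᵀ).det := by rwa [det_transpose]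
  have key : (1 - c)ᵀ * (xᵀ * J + J * x.map σ) * (1 - c.map σ) = 0 := by
    calc _ = ((1 - c)ᵀ * xᵀ) * J * (1 - c.map σ) + (1 - c)ᵀ * J * (x.map σ * (1 - c.map σ)) := by
          simp only [Matrix.mul_add, Matrix.add_mul, Matrix.mul_assoc]
      _ = (J + J) - (cᵀ * J * c.map σ + cᵀ * J * c.map σ) := by
          rw [h1t, h2]
          simp only [transpose_add, transpose_sub, transpose_one]
          noncomm_ring
      _ = 0 := by rw [hcc, sub_self]
  change xᵀ * J + J * x.map σ = 0
  have := congrArg (fun M => ((1 - c)ᵀ)⁻¹ * M * (1 - c.map σ)⁻¹) key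
  simp only [Matrix.mul_zero, Matrix.zero_mul] at this
  rw [Matrix.mul_assoc ((1 - c)ᵀ), ← Matrix.mul_assoc, Matrix.nonsing_inv_mul _ hut,
    Matrix.one_mul, Matrix.mul_assoc, Matrix.mul_nonsing_inv _ hu', Matrix.mul_one] at this
  exact this

theorem cayley_conjAct (γ : Matrix (Idx m) (Idx m) F) (ξ : F) (h : GL (Fin m) F)
    (hu : IsUnit (1 - ξ⁻¹ • γ).det) : cayley ξ (conjAct γ h) = conjAct (cayley ξ γ) h := by
  have h1 : 1 - ξ⁻¹ • conjAct γ h = conjAlgHom F h (1 - ξ⁻¹ • γ) := by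
    rw [map_sub, map_one, map_smul]; rfl
  have h2 : 1 + ξ⁻¹ • conjAct γ h = conjAlgHom F h (1 + ξ⁻¹ • γ) := by
    rw [map_add, map_one, map_smul]; rfl
  have h3 : (1 - ξ⁻¹ • conjAct γ h)⁻¹ = conjAlgHom F h (1 - ξ⁻¹ • γ)⁻¹ := by
    apply Matrix.inv_eq_right_inv
    rw [h1, ← map_mul, Matrix.mul_nonsing_inv _ hu, map_one]
  rw [cayley, h3, h2, ← map_mul]
  rfl

end Cayley

/-! ## From the Lie algebra to the group -/

section LieToGroup

variable {F₀ F : Type*} [NormedField F₀] [NormedField F] [NormedAlgebra F₀ F]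
variable [IsUltrametricDist F] {σ : F ≃ₐ[F₀] F} {ϖ : F₀} {m : ℕ}

/-- The order of all integral matrices. -/
def integralOrder (ι K : Type*) [Fintype ι] [DecidableEq ι] [NormedField K]
    [IsUltrametricDist K] : Subalgebra (intRing K) (Matrix ι ι K) where
  carrier := {a | IntegralEntries a}
  mul_mem' ha hb := ha.mul hb
  add_mem' ha hb i j := (IsUltrametricDist.norm_add_le_max _ _).trans (max_le (ha i j) (hb i j))
  algebraMap_mem' r i j := by
    rw [Matrix.algebraMap_matrix_apply]
    split_ifs
    · exact norm_coe_le_one r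
    · simp

/-- The order of integral matrices whose upper right block vanishes modulo `ϖ`. -/
def parahoricOrder (ϖ : F₀) (m : ℕ) (F : Type*) [NormedField F]
    [IsUltrametricDist F] : Subalgebra (intRing F) (Matrix (Idx m) (Idx m) F) where
  carrier := {a | IntegralEntries a ∧ ∀ i, ‖a (Sum.inl i) (Sum.inr 0)‖ ≤ ‖ϖ‖}
  mul_mem' := by
    rintro a b ⟨ha, ha'⟩ ⟨hb, hb'⟩
    refine ⟨ha.mul hb, fun i => ?_⟩
    rw [Matrix.mul_apply]
    refine IsUltrametricDist.norm_sum_le_of_forall_le_of_nonneg (norm_nonneg _) fun k _ => ?_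
    rw [norm_mul]
    rcases k with k | k
    · calc _ ≤ 1 * ‖ϖ‖ := mul_le_mul (ha _ _) (hb' k) (norm_nonneg _) zero_le_one
        _ = _ := one_mul _
    · rw [Subsingleton.elim k 0]
      calc _ ≤ ‖ϖ‖ * 1 := mul_le_mul (ha' i) (hb _ _) (norm_nonneg _) (norm_nonneg _)
        _ = _ := mul_one _
  add_mem' ha hb := ⟨fun i j => (IsUltrametricDist.norm_add_le_max _ _).trans
    (max_le (ha.1 i j) (hb.1 i j)), fun i => (IsUltrametricDist.norm_add_le_max _ _).trans
    (max_le (ha.2 i) (hb.2 i))⟩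
  algebraMap_mem' r := by
    refine ⟨(integralOrder (Idx m) F).algebraMap_mem r, fun i => ?_⟩
    rw [Matrix.algebraMap_matrix_apply, if_neg (by simp), norm_zero]
    exact norm_nonneg _

theorem conjAct_mem_symLie {y : Matrix (Idx m) (Idx m) F} (hy : y ∈ symLie σ m)
    (h : GL (Fin m) F₀) : conjAct y (baseGL h) ∈ symLie σ m := by
  have hy' : y + y.map σ = 0 := hy
  change conjAct y (baseGL h) + (conjAct y (baseGL h)).map σ = 0
  rw [conjAct_map_conj]
  change conjAlgHom F (baseGL h) y + conjAlgHom F (baseGL h) (y.map σ) = 0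
  rw [← map_add, hy', map_zero]

theorem conjAct_mem_symSpace {γ : Matrix (Idx m) (Idx m) F} (hγ : γ ∈ symSpace σ m)
    (h : GL (Fin m) F₀) : conjAct γ (baseGL h) ∈ symSpace σ m := by
  have hγ' : γ * γ.map σ = 1 := hγ
  change conjAct γ (baseGL h) * (conjAct γ (baseGL h)).map σ = 1
  rw [conjAct_map_conj]
  change conjAlgHom F (baseGL h) γ * conjAlgHom F (baseGL h) (γ.map σ) = 1
  rw [← map_mul, hγ', map_one]

theorem mem_symLieK_iff {y : Matrix (Idx m) (Idx m) F} (hy : y ∈ symLie σ m) :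
    y ∈ symLieK σ ϖ m ↔ y ∈ parahoricOrder ϖ m F :=
  ⟨fun h => ⟨h.1.2, h.2⟩, fun h => ⟨⟨hy, h.1⟩, h.2⟩⟩

/-- The inverse of γ ∈ S is σ(γ), whose entries have the same norms as those of γ, so integrality of
the inverse is automatic. -/
theorem UnramifiedQuadratic.mem_symK_iff (D : UnramifiedQuadratic σ ϖ)
    {γ : Matrix (Idx m) (Idx m) F} (hγ : γ ∈ symSpace σ m) :
    γ ∈ symK σ ϖ m ↔ γ ∈ parahoricOrder ϖ m F := by
  constructor
  · rintro ⟨-, g, hg, rfl⟩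
    exact ⟨fun i j => (hg.1 i j).1, hg.2⟩
  · intro h
    have h1 : γ * γ.map σ = 1 := hγ
    have h2 : γ.map σ * γ = 1 := mul_eq_one_comm.1 h1
    refine ⟨hγ, ⟨γ, γ.map σ, h1, h2⟩, ⟨fun i j => ⟨h.1 i j, ?_⟩, h.2⟩, rfl⟩
    change ‖σ (γ i j)‖ ≤ 1
    rw [D.norm_conj]
    exact h.1 i j

theorem UnramifiedQuadratic.norm_det_of_mem_symSpace (D : UnramifiedQuadratic σ ϖ)
    {γ : Matrix (Idx m) (Idx m) F} (hγ : γ ∈ symSpace σ m) : ‖γ.det‖ = 1 := by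
  have h1 : γ * γ.map σ = 1 := hγ
  have h := congrArg (fun M => ‖M.det‖) h1
  have e : (γ.map σ).det = σ γ.det := (RingHom.map_det (σ : F →+* F) γ).symm
  simp only [det_mul, det_one, norm_mul, norm_one, e, D.norm_conj] at h
  nlinarith [norm_nonneg γ.det]

theorem integralCharpoly_congr {ι : Type*} [Fintype ι] [DecidableEq ι] {a b : Matrix ι ι F}
    (h : a.charpoly = b.charpoly) : IntegralCharpoly a ↔ IntegralCharpoly b := by
  rw [IntegralCharpoly, IntegralCharpoly, h]

/-- Elements of the unitary group with integral characteristic polynomial and unit determinant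
stabilize a lattice as soon as they preserve it. -/
theorem mem_toMat_stabGp_iff {Λ : Submodule (intRing F) (Fin m → F)} {T : GL (Fin m) F}
    (hT : ∀ x, (T : Matrix (Fin m) (Fin m) F) *ᵥ x ∈ Λ ↔ ∀ i, ‖x i‖ ≤ 1)
    {G : Subgroup (GL (Idx m) F)} {g : GL (Idx m) F} (hg : g ∈ G)
    (hc : IntegralCharpoly (g : Matrix (Idx m) (Idx m) F))
    (hd : ‖(g : Matrix (Idx m) (Idx m) F).det‖ = 1) :
    (g : Matrix (Idx m) (Idx m) F) ∈ toMat (stabGp G (extLattice Λ)) ↔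
      (g : Matrix (Idx m) (Idx m) F) ∈
        (integralOrder (Idx m) F).comap (conjAlgHom (intRing F) T) := by
  change _ ↔ IntegralEntries (conjAct (g : Matrix (Idx m) (Idx m) F) T)
  rw [← stabilizes_extLattice_iff hT]
  constructor
  · rintro ⟨g', hg', he⟩
    intro w hw
    rw [← he]
    exact (hg'.2 w).2 hw
  · intro h
    refine ⟨g, ⟨hg, fun w => ⟨fun hw => ?_, h w⟩⟩, rfl⟩
    -- The inverse lies in O[g], hence in every order containing g.
    have hinv : ((g⁻¹ : GL (Idx m) F) : Matrix (Idx m) (Idx m) F) ∈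
        (integralOrder (Idx m) F).comap (conjAlgHom (intRing F) T) := by
      refine Algebra.adjoin_singleton_le ?_ (hc.inv_mem_adjoin ?_ hd)
      · exact (stabilizes_extLattice_iff hT _).1 h
      · rw [← Units.val_mul, mul_inv_cancel, Units.val_one]
    have := (stabilizes_extLattice_iff hT _).2 hinv _ hw
    rwa [mulVec_mulVec, ← Units.val_mul, inv_mul_cancel, Units.val_one, one_mulVec] at this

theorem integralCharpoly_of_mem_toMat_stabGp {Λ : Submodule (intRing F) (Fin m → F)}
    {T : GL (Fin m) F} (hT : ∀ x, (T : Matrix (Fin m) (Fin m) F) *ᵥ x ∈ Λ ↔ ∀ i, ‖x i‖ ≤ 1)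
    {G : Subgroup (GL (Idx m) F)} {g : Matrix (Idx m) (Idx m) F}
    (hg : g ∈ toMat (stabGp G (extLattice Λ))) : IntegralCharpoly g := by
  obtain ⟨g, hg, rfl⟩ := hg
  rw [← integralCharpoly_congr (charpoly_conjAct _ T)]
  exact ((stabilizes_extLattice_iff hT _).1 fun w hw => (hg.2 w).2 hw).integralCharpoly

theorem conjAct_mem_unitaryGp {J : Matrix (Fin m) (Fin m) F} {ε : F₀} {g : GL (Idx m) F}
    (hg : g ∈ unitaryGp σ (extForm J ε)) {h : GL (Fin m) F} (hh : h ∈ unitaryGp σ J) :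
    ∃ g' ∈ unitaryGp σ (extForm J ε),
      (g' : Matrix (Idx m) (Idx m) F) = conjAct (g : Matrix (Idx m) (Idx m) F) h := by
  have hE : glEmb h ∈ unitaryGp σ (extForm J ε) := by
    have hh' : (h : Matrix (Fin m) (Fin m) F)ᵀ * J * (h : Matrix (Fin m) (Fin m) F).map σ = J := hh
    change _ * _ * _ = _
    rw [extForm_conj, hh']
  refine ⟨(glEmb h)⁻¹ * g * glEmb h, mul_mem (mul_mem (inv_mem hE) hg) hE, ?_⟩
  rw [conjAct, map_inv, Units.val_mul, Units.val_mul]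

/-- The Lie algebra statement implies the inhomogeneous group statement if the residue field is
large. -/
theorem inhomAFL_of_lieAFL [IsUltrametricDist F₀] [ProperSpace F₀] (D : UnramifiedQuadratic σ ϖ)
    (μ : Measure (GL (Fin m) F₀)) (W : HermPair σ m ϖ)
    (Λ : Submodule (intRing F) (Fin m → F)) (hΛ : IsSelfDual σ (W.J 1) Λ)
    (ν : ∀ i, Measure (W.H i)) (hq : m + 1 ≤ residueCard F₀) (H : LieAFL ϖ μ W Λ ν) :
    InhomAFL ϖ μ W Λ ν := by
  obtain ⟨T, hT, -⟩ := D.exists_orthonormal_basis (W.herm 1) hΛ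
  rintro i g hg hgrs γ hγ hγrs ⟨h₀, hh₀⟩
  have hcp : (g : Matrix (Idx m) (Idx m) F).charpoly = γ.charpoly := by
    rw [← hh₀, charpoly_conjAct]
  -- Elements of K' and of the lattice stabilizer have integral characteristic polynomial, which is
  -- constant along orbits and shared by g and γ. In the non-integral case both integrands vanish
  -- identically.
  by_cases hint : IntegralCharpoly γ
  swap
  · have h1 : orbLin σ μ γ (fun γ => (-1) ^ m * charFn (symK σ ϖ m) γ) = 0 := by
      rw [orbLin]
      refine integral_eq_zero_of_ae (Filter.Eventually.of_forall fun h => ?_)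
      have : conjAct γ (baseGL h) ∉ symK σ ϖ m := by
        intro hm
        apply hint
        rw [← integralCharpoly_congr (charpoly_conjAct γ (baseGL h))]
        exact ((D.mem_symK_iff (conjAct_mem_symSpace hγ h)).1 hm).1.integralCharpoly
      simp [charFn, Set.indicator_of_notMem this]
    rw [h1, mul_zero, orbU]
    refine integral_eq_zero_of_ae (Filter.Eventually.of_forall fun h => ?_)
    fin_cases i
    · rfl
    · have : conjAct (g : Matrix (Idx m) (Idx m) F) (h : GL (Fin m) F) ∉
          toMat (stabGp (W.G 1) (extLattice Λ)) := by
        intro hm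
        apply hint
        rw [← integralCharpoly_congr hcp, ← integralCharpoly_congr (charpoly_conjAct _ _)]
        exact integralCharpoly_of_mem_toMat_stabGp hT hm
      exact Set.indicator_of_notMem (f := fun _ => (1 : ℂ)) this
  have hdet := D.norm_det_of_mem_symSpace hγ
  obtain ⟨P, hP, hdeg, hPm, -⟩ := hint.exists_map
  -- A unit value of the characteristic polynomial at ξ means that 1 - ξ⁻¹a has unit determinant,
  -- for a = γ as well as for every conjugate and for g.
  obtain ⟨ξ, hξ, hξP⟩ := D.exists_norm_one_eval_unit hq P hP (by simpa using hdeg)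
  have hξ0 : (ξ : F) ≠ 0 := left_ne_zero_of_mul_eq_one hξ
  have hξ1 : ‖(ξ : F)‖ = 1 := by
    have := congrArg norm hξ
    rw [norm_mul, D.norm_conj, norm_one] at this
    nlinarith [norm_nonneg (ξ : F)]
  have hd : ∀ a : Matrix (Idx m) (Idx m) F, a.charpoly = γ.charpoly →
      ‖(1 - (ξ : F)⁻¹ • a).det‖ = 1 := by
    intro a ha
    have h1 := det_one_sub_smul a hξ0
    rw [ha, ← hPm] at h1
    have h2 := congrArg norm h1
    rw [norm_mul, norm_pow, hξ1, one_pow, one_mul] at h2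
    rw [← h2, ← hξP]
    congr 1
    exact Polynomial.eval_map_apply (algebraMap (intRing F) F) ξ
  have hu : ∀ a : Matrix (Idx m) (Idx m) F, a.charpoly = γ.charpoly →
      IsUnit (1 - (ξ : F)⁻¹ • a).det := fun a ha =>
    isUnit_iff_ne_zero.2 (norm_ne_zero_iff.1 (by rw [hd a ha]; exact one_ne_zero))
  have hsame : ∀ a : Matrix (Idx m) (Idx m) F, IsRS a → a.charpoly = γ.charpoly →
      SameOrder a (cayley (ξ : F) a) := fun a hrs ha =>
    sameOrder_cayley D.norm_two ((integralCharpoly_congr ha).2 hint) ((isRS_iff a).1 hrs).1 hξ1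
      (hd a ha)
  have hγy := hsame γ hγrs rfl
  have hgx := hsame _ hgrs hcp
  obtain ⟨hyrs, hyint⟩ := hγy.isRS hint hγrs
  obtain ⟨hxrs, -⟩ := hgx.isRS ((integralCharpoly_congr hcp).2 hint) hgrs
  have hyLie : cayley (ξ : F) γ ∈ symLie σ m := cayley_mem_symLie hγ hξ (hu γ rfl)
  have hxLie : cayley (ξ : F) (g : Matrix (Idx m) (Idx m) F) ∈ W.g i :=
    cayley_mem_unitaryLie hg hξ (hu _ hcp)
  have key := H i _ hxLie hxrs _ hyLie hyrs
    ⟨h₀, by rw [← hh₀, cayley_conjAct _ _ _ (hu γ rfl)]⟩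
  -- The Krylov determinants have equal norm and det γ is a unit, so the power of det γ in ω_S plays
  -- no role.
  have e1 : omegaLie ϖ (cayley (ξ : F) γ) = omegaS ϖ γ := by
    refine etaTilde_congr ?_
    rw [norm_mul, norm_inv, norm_pow, hdet, one_pow, inv_one, one_mul]
    exact (hγy.norm_det_krylov_eq hint hyint).symm
  have e2 : orbLin σ μ (cayley (ξ : F) γ) (fun y => (-1) ^ m * charFn (symLieK σ ϖ m) y) =
      orbLin σ μ γ (fun γ => (-1) ^ m * charFn (symK σ ϖ m) γ) := by
    rw [orbLin, orbLin]
    congr 1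
    ext h
    congr 2
    apply charFn_congr
    rw [mem_symLieK_iff (conjAct_mem_symLie hyLie h),
      D.mem_symK_iff (conjAct_mem_symSpace hγ h)]
    -- Conjugation by h preserves the equality of generated orders, so both conjugates lie in the
    -- parahoric order or neither does.
    exact ((hγy.map (conjAlgHom (intRing F) (baseGL h))).mem_iff _).symm
  have e3 : orbU (ν i) (cayley (ξ : F) (g : Matrix (Idx m) (Idx m) F))
      ((![0, charFn (stabLie (W.g 1) (extLattice Λ))] :
        Fin 2 → Matrix (Idx m) (Idx m) F → ℂ) i) =
      orbU (ν i) (g : Matrix (Idx m) (Idx m) F)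
        ((![0, charFn (toMat (stabGp (W.G 1) (extLattice Λ)))] :
        Fin 2 → Matrix (Idx m) (Idx m) F → ℂ) i) := by
    rw [orbU, orbU]
    congr 1
    ext h
    fin_cases i
    · rfl
    · refine charFn_congr ?_
      have hLie : conjAct (cayley (ξ : F) (g : Matrix (Idx m) (Idx m) F)) (h : GL (Fin m) F) ∈
          W.g 1 := by
        have := conjAct_mem_unitaryLie hxLie (h : GL (Fin m) F)
        have hm : ((h : GL (Fin m) F) : Matrix (Fin m) (Fin m) F)ᵀ * W.J 1 *
          ((h : GL (Fin m) F) : Matrix (Fin m) (Fin m) F).map σ = W.J 1 := h.2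
        change _ ∈ unitaryLie σ (extForm (_ * W.J 1 * _) ϖ) at this
        rwa [hm] at this
      obtain ⟨g', hg', he⟩ := conjAct_mem_unitaryGp hg h.2
      have hcp' : (g' : Matrix (Idx m) (Idx m) F).charpoly = γ.charpoly := by
        rw [he, charpoly_conjAct, hcp]
      have hdet' : ‖(g' : Matrix (Idx m) (Idx m) F).det‖ = 1 := by
        rw [← hdet, det_eq_sign_charpoly_coeff, hcp', ← det_eq_sign_charpoly_coeff]
      have h1 : conjAct (g : Matrix (Idx m) (Idx m) F) (h : GL (Fin m) F) ∈
          toMat (stabGp (W.G 1) (extLattice Λ)) ↔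
          conjAct (g : Matrix (Idx m) (Idx m) F) (h : GL (Fin m) F) ∈
            (integralOrder (Idx m) F).comap (conjAlgHom (intRing F) T) := by
        rw [← he]
        exact mem_toMat_stabGp_iff hT hg' ((integralCharpoly_congr hcp').2 hint) hdet'
      have h2 : conjAct (cayley (ξ : F) (g : Matrix (Idx m) (Idx m) F)) (h : GL (Fin m) F) ∈
          stabLie (W.g 1) (extLattice Λ) ↔
          conjAct (cayley (ξ : F) (g : Matrix (Idx m) (Idx m) F)) (h : GL (Fin m) F) ∈
            (integralOrder (Idx m) F).comap (conjAlgHom (intRing F) T) := by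
        change (_ ∧ _) ↔ IntegralEntries _
        rw [and_iff_right hLie]
        exact stabilizes_extLattice_iff hT _
      rw [h2]
      refine Iff.trans ?_ h1.symm
      exact ((hgx.map (conjAlgHom (intRing F) (h : GL (Fin m) F))).mem_iff _).symm
  rw [← e3, key, e1, e2]

end LieToGroup


/-! ## Hilbert 90 for general linear groups -/

section HilbertNinety

variable {ι : Type*} [Fintype ι] [DecidableEq ι]

/-- The map `a ↦ a + A ā`, whose values are coboundaries for `A` if `A Ā = 1`, takes an invertible
value. -/
theorem exists_isUnit_add_mul_map {k : Type*} [Field k] (τ : k →+* k)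
    (h2 : (2 : k) ≠ 0) {δ : k} (hδ0 : δ ≠ 0) (hδ : τ δ = -δ) (A : Matrix ι ι k) :
    ∃ a : Matrix ι ι k, IsUnit (a + A * a.map τ) := by
  let φ : (ι → k) → (ι → k) := fun v => v + A *ᵥ (τ ∘ v)
  have hspan : Submodule.span k (Set.range φ) = ⊤ := by
    rw [eq_top_iff]
    intro v _
    -- Since τ(δ) = -δ, the value at δv is δ(v - A τ(v)). After division by δ, its mean with the
    -- value at v is v. So the values of φ span, and a basis can be chosen among them.
    have e : v = (2 : k)⁻¹ • φ v + ((2 : k)⁻¹ * δ⁻¹) • φ (δ • v) := by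
      have h1 : τ ∘ (δ • v) = (-δ) • (τ ∘ v) := by
        ext i; simp [hδ]
      simp only [φ]
      rw [h1, Matrix.mulVec_smul]
      ext i
      simp only [Pi.add_apply, Pi.smul_apply, smul_eq_mul]
      field_simp
      ring
    rw [e]
    exact Submodule.add_mem _ (Submodule.smul_mem _ _ (Submodule.subset_span ⟨v, rfl⟩))
      (Submodule.smul_mem _ _ (Submodule.subset_span ⟨_, rfl⟩))
  obtain ⟨f, hf, -, hli⟩ := Submodule.exists_fun_fin_finrank_span_eq k (Set.range φ)
  have hcard : Module.finrank k (Submodule.span k (Set.range φ)) = Fintype.card ι := by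
    rw [hspan, finrank_top, Module.finrank_fintype_fun_eq_card]
  let e : ι ≃ Fin (Module.finrank k (Submodule.span k (Set.range φ))) :=
    Fintype.equivOfCardEq (by rw [Fintype.card_fin, hcard])
  choose v hv using fun j => hf (e j)
  refine ⟨Matrix.of fun i j => v j i, ?_⟩
  rw [← Matrix.linearIndependent_cols_iff_isUnit]
  have : (Matrix.of (fun i j => v j i) + A * (Matrix.of fun i j => v j i).map τ).col = f ∘ e := by
    funext j
    rw [Function.comp_apply, ← hv j]
    rfl
  rw [this]
  exact hli.comp _ e.injective

theorem isUnit_of_isUnit_map_residue {R : Type*} [CommRing R] [IsLocalRing R] {M : Matrix ι ι R}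
    (h : IsUnit (M.map (IsLocalRing.residue R))) : IsUnit M := by
  rw [Matrix.isUnit_iff_isUnit_det] at h ⊢
  rw [← RingHom.mapMatrix_apply, ← RingHom.map_det] at h
  exact isUnit_of_map_unit _ _ h

/-- The field case is applied to the residue field. Any lift of the solution works, because
invertibility is detected modulo the maximal ideal. -/
theorem exists_isUnit_add_mul_map_of_isLocalRing {R : Type*} [CommRing R] [IsLocalRing R]
    (τ : R →+* R) (hτ : ∀ x, τ (τ x) = x) (h2 : IsUnit (2 : R)) {δ : R} (hδ0 : IsUnit δ)
    (hδ : τ δ = -δ) (A : Matrix ι ι R) :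
    ∃ a : Matrix ι ι R, IsUnit (a + A * a.map τ) := by
  have hloc : IsLocalHom τ := ⟨fun x hx => by simpa [hτ] using hx.map τ⟩
  let τ' := IsLocalRing.ResidueField.map τ
  have hτ' : ∀ x, τ' (IsLocalRing.residue R x) = IsLocalRing.residue R (τ x) :=
    IsLocalRing.ResidueField.map_residue τ
  have hcomm : ∀ M : Matrix ι ι R, (M.map τ).map (IsLocalRing.residue R) =
      (M.map (IsLocalRing.residue R)).map τ' := by
    intro M; ext i j; simp [hτ']
  obtain ⟨a, ha⟩ := exists_isUnit_add_mul_map (ι := ι) τ'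
    (by rw [← map_ofNat (IsLocalRing.residue R) 2]; exact (h2.map _).ne_zero)
    (hδ0.map (IsLocalRing.residue R)).ne_zero
    (by rw [hτ', hδ, map_neg]) (A.map (IsLocalRing.residue R))
  let b : Matrix ι ι R := a.map (Function.surjInv IsLocalRing.residue_surjective)
  have hb : b.map (IsLocalRing.residue R) = a := by
    ext i j
    exact Function.surjInv_eq IsLocalRing.residue_surjective _
  refine ⟨b, isUnit_of_isUnit_map_residue ?_⟩
  rwa [Matrix.map_add _ (map_add _), Matrix.map_mul, hcomm, hb]

end HilbertNinety

/-! ### The fibres of r over S and over K' -/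

section SymmetricSpace

variable {F₀ F : Type*} [NormedField F₀] [NormedField F] [NormedAlgebra F₀ F]
variable {σ : F ≃ₐ[F₀] F} {ϖ : F₀} {m : ℕ}

theorem coe_inv_map (σ : F ≃ₐ[F₀] F) {ι : Type*} [Fintype ι] [DecidableEq ι] (k : GL ι F) :
    (k : Matrix ι ι F).map σ * ((k⁻¹ : GL ι F) : Matrix ι ι F).map σ = 1 ∧
    ((k⁻¹ : GL ι F) : Matrix ι ι F).map σ * (k : Matrix ι ι F).map σ = 1 := by
  constructor <;> rw [← Matrix.map_mul, ← Units.val_mul] <;> simp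

theorem rMap_eq_iff {k : GL (Idx m) F} {γ : Matrix (Idx m) (Idx m) F} :
    rMap σ k = γ ↔ (k : Matrix (Idx m) (Idx m) F) = γ * (k : Matrix (Idx m) (Idx m) F).map σ := by
  constructor
  · rintro rfl
    rw [rMap, Matrix.mul_assoc, (coe_inv_map σ k).2, Matrix.mul_one]
  · intro h
    rw [rMap]
    nth_rewrite 1 [h]
    rw [Matrix.mul_assoc, (coe_inv_map σ k).1, Matrix.mul_one]

theorem UnramifiedQuadratic.rMap_mem_symSpace (D : UnramifiedQuadratic σ ϖ) (k : GL (Idx m) F) :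
    rMap σ k ∈ symSpace σ m := by
  have h : (((k⁻¹ : GL (Idx m) F) : Matrix (Idx m) (Idx m) F).map σ).map σ =
      ((k⁻¹ : GL (Idx m) F) : Matrix (Idx m) (Idx m) F) := by
    ext i j; simp [D.conj_conj]
  change rMap σ k * (rMap σ k).map σ = 1
  rw [rMap, Matrix.map_mul, h, Matrix.mul_assoc, ← Matrix.mul_assoc (Matrix.map _ _),
    (coe_inv_map σ k).2, Matrix.one_mul, ← Units.val_mul, mul_inv_cancel, Units.val_one]

theorem coe_baseGL_map (σ : F ≃ₐ[F₀] F) {ι : Type*} [Fintype ι] [DecidableEq ι] (h : GL ι F₀) :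
    ((baseGL h : GL ι F) : Matrix ι ι F).map σ = ((baseGL h : GL ι F) : Matrix ι ι F) := by
  ext i j
  exact σ.commutes _

theorem UnramifiedQuadratic.exists_baseGL (D : UnramifiedQuadratic σ ϖ) {ι : Type*} [Fintype ι]
    [DecidableEq ι] {g : GL ι F} (hg : (g : Matrix ι ι F).map σ = g) :
    ∃ h : GL ι F₀, baseGL h = g := by
  choose a ha using fun i j => D.exists_of_fixed ((g : Matrix ι ι F) i j)
    (congrFun (congrFun hg i) j)
  have e : (algebraMap F₀ F).mapMatrix (Matrix.of a) = (g : Matrix ι ι F) := by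
    ext i j; exact ha i j
  have hu : IsUnit (Matrix.of a) := by
    rw [Matrix.isUnit_iff_isUnit_det, isUnit_iff_ne_zero]
    intro h0
    have h1 : (g : Matrix ι ι F).det = 0 := by rw [← e, ← RingHom.map_det, h0, map_zero]
    exact ((Matrix.isUnit_iff_isUnit_det _).1 g.isUnit).ne_zero h1
  exact ⟨hu.unit, Units.ext e⟩

/-- Fibres of `rMap` are cosets of `GL(F₀)`. -/
theorem UnramifiedQuadratic.rMap_eq_rMap_iff (D : UnramifiedQuadratic σ ϖ) {g k : GL (Idx m) F} :
    rMap σ g = rMap σ k ↔ ∃ h : GL (Idx m) F₀, g = k * baseGL h := by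
  constructor
  · intro h
    have h1 := rMap_eq_iff.1 h
    rw [rMap] at h1
    obtain ⟨x, hx⟩ := D.exists_baseGL (g := k⁻¹ * g) (by
      rw [Units.val_mul, Matrix.map_mul]
      nth_rewrite 2 [h1]
      rw [Matrix.mul_assoc, ← Matrix.mul_assoc, ← Units.val_mul, inv_mul_cancel, Units.val_one,
        Matrix.one_mul])
    exact ⟨x, by rw [hx, mul_inv_cancel_left]⟩
  · rintro ⟨h, rfl⟩
    rw [rMap_eq_iff, Units.val_mul, Matrix.map_mul, coe_baseGL_map, rMap, Matrix.mul_assoc,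
      ← Matrix.mul_assoc (Matrix.map _ _) (Matrix.map _ _), (coe_inv_map σ k).2, Matrix.one_mul]

/-- When γ σ(γ) = 1, the map x ↦ γ σ(x) exchanges the two summands. An invertible value of a + γ
σ(a) is therefore a preimage of γ under r. -/
theorem map_map_conj_of_mul {γ a : Matrix (Idx m) (Idx m) F} (hσ : ∀ x, σ (σ x) = x)
    (hγ : γ ∈ symSpace σ m) :
    a + γ * a.map σ = γ * (a + γ * a.map σ).map σ := by
  have hγ' : γ * γ.map σ = 1 := hγ
  have h : (a.map σ).map σ = a := by ext i j; simp [hσ]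
  rw [Matrix.map_add _ (map_add _), Matrix.map_mul, h, Matrix.mul_add, ← Matrix.mul_assoc, hγ',
    Matrix.one_mul, add_comm]

theorem UnramifiedQuadratic.exists_rMap_eq (D : UnramifiedQuadratic σ ϖ)
    {γ : Matrix (Idx m) (Idx m) F} (hγ : γ ∈ symSpace σ m) : ∃ g : GL (Idx m) F, rMap σ g = γ := by
  obtain ⟨δ, hδ, hδ1⟩ := D.exists_anti_unit
  obtain ⟨a, ha⟩ := exists_isUnit_add_mul_map (σ : F →+* F) D.two_ne_zero (δ := δ)
    (norm_ne_zero_iff.1 (by rw [hδ1]; exact one_ne_zero)) hδ γ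
  exact ⟨ha.unit, rMap_eq_iff.2 (map_map_conj_of_mul D.conj_conj hγ)⟩

theorem mem_integralGL_iff [IsUltrametricDist F] {ι : Type*} [Fintype ι] [DecidableEq ι]
    {g : GL ι F} : g ∈ integralGL ι F ↔ g ∈ (integralOrder ι F).toSubmonoid.units := by
  rw [Submonoid.mem_units_iff]
  exact ⟨fun h => ⟨fun i j => (h i j).1, fun i j => (h i j).2⟩, fun h i j => ⟨h.1 i j, h.2 i j⟩⟩

/-- For an integral matrix with unit determinant the inverse lies in the O-algebra it generates,
hence in S. -/
theorem mem_units_iff_norm_det [IsUltrametricDist F] {ι : Type*} [Fintype ι] [DecidableEq ι]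
    {S : Subalgebra (intRing F) (Matrix ι ι F)} (hS : S ≤ integralOrder ι F) {g : GL ι F} :
    g ∈ S.toSubmonoid.units ↔
      (g : Matrix ι ι F) ∈ S ∧ ‖(g : Matrix ι ι F).det‖ = 1 := by
  rw [Submonoid.mem_units_iff]
  constructor
  · rintro ⟨h1, h2⟩
    refine ⟨h1, ?_⟩
    have h3 : IntegralEntries (g : Matrix ι ι F) := hS h1
    have h4 : IntegralEntries ((g⁻¹ : GL ι F) : Matrix ι ι F) := hS h2
    have h5 : ‖(g : Matrix ι ι F).det‖ * ‖((g⁻¹ : GL ι F) : Matrix ι ι F).det‖ = 1 := by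
      rw [← norm_mul, ← det_mul, ← Units.val_mul, mul_inv_cancel, Units.val_one, det_one, norm_one]
    nlinarith [h3.norm_det_le, h4.norm_det_le, norm_nonneg (g : Matrix ι ι F).det]
  · rintro ⟨h1, h2⟩
    have h3 : IntegralEntries (g : Matrix ι ι F) := hS h1
    exact ⟨h1, Algebra.adjoin_singleton_le h1 (h3.integralCharpoly.inv_mem_adjoin
      (by rw [← Units.val_mul, mul_inv_cancel, Units.val_one]) h2)⟩

theorem parahoricOrder_le [IsUltrametricDist F] :
    parahoricOrder ϖ m F ≤ integralOrder (Idx m) F := fun _ h => h.1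

theorem mem_parK_iff [IsUltrametricDist F] {g : GL (Idx m) F} :
    g ∈ parK ϖ m ↔ g ∈ (parahoricOrder ϖ m F).toSubmonoid.units := by
  rw [mem_units_iff_norm_det parahoricOrder_le]
  constructor
  · rintro ⟨h1, h2⟩
    have h3 := (mem_units_iff_norm_det le_rfl).1 (mem_integralGL_iff.1 h1)
    exact ⟨⟨h3.1, h2⟩, h3.2⟩
  · rintro ⟨h1, h2⟩
    exact ⟨mem_integralGL_iff.2 ((mem_units_iff_norm_det le_rfl).2 ⟨h1.1, h2⟩), h1.2⟩

theorem norm_det_of_mem_parK [IsUltrametricDist F] {g : GL (Idx m) F} (hg : g ∈ parK ϖ m) :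
    ‖(g : Matrix (Idx m) (Idx m) F).det‖ = 1 :=
  ((mem_units_iff_norm_det parahoricOrder_le).1 (mem_parK_iff.1 hg)).2

theorem glEmb_mem_parK [IsUltrametricDist F] {k : GL (Fin m) F} (hk : k ∈ integralGL (Fin m) F) :
    glEmb k ∈ parK ϖ m := by
  have h : ∀ k ∈ integralGL (Fin m) F,
      ((glEmb k : GL (Idx m) F) : Matrix (Idx m) (Idx m) F) ∈ parahoricOrder ϖ m F := by
    intro k hk
    rw [coe_glEmb]
    refine ⟨?_, fun i => ?_⟩
    · rintro (i | i) (j | j)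
      · exact (hk i j).1
      · simp
      · simp
      · simp [Subsingleton.elim i j]
    · simp
  have hk' : k⁻¹ ∈ integralGL (Fin m) F := fun i j => ⟨(hk i j).2, by
    rw [inv_inv]; exact (hk i j).1⟩
  exact mem_parK_iff.2 (Submonoid.mem_units_iff _ _ |>.2 ⟨h k hk, by
    rw [← map_inv]; exact h _ hk'⟩)

theorem UnramifiedQuadratic.rMap_mem_symK [IsUltrametricDist F] (D : UnramifiedQuadratic σ ϖ)
    {k : GL (Idx m) F} (hk : k ∈ parK ϖ m) : rMap σ k ∈ symK σ ϖ m := by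
  rw [D.mem_symK_iff (D.rMap_mem_symSpace k)]
  rw [mem_parK_iff, Submonoid.mem_units_iff] at hk
  refine mul_mem hk.1 ⟨fun i j => ?_, fun i => ?_⟩
  · rw [map_apply, D.norm_conj]; exact hk.2.1 i j
  · rw [map_apply, D.norm_conj]; exact hk.2.2 i

/-- Hilbert 90 for K₀(ϖ). Modulo the maximal ideal γ is block lower triangular, so a block diagonal
matrix b solving the problem for the two diagonal blocks makes b + γ σ(b) invertible. This matrix
stays in the parahoric order since γ and b do. -/
theorem UnramifiedQuadratic.exists_mem_parK [IsUltrametricDist F] (D : UnramifiedQuadratic σ ϖ)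
    {γ : Matrix (Idx m) (Idx m) F} (hγ : γ ∈ symK σ ϖ m) : ∃ k ∈ parK ϖ m, rMap σ k = γ := by
  obtain ⟨δ, hδ, hδ1⟩ := D.exists_anti_unit
  have hs := hγ.1
  have hγ := (D.mem_symK_iff hγ.1).1 hγ
  obtain ⟨M, rfl⟩ := IntegralEntries.exists_map hγ.1
  have key := fun (ι : Type) [Fintype ι] [DecidableEq ι] (A : Matrix ι ι (intRing F)) =>
    exists_isUnit_add_mul_map_of_isLocalRing D.conjInt (fun x => Subtype.ext (D.conj_conj x))
      D.isUnit_two (δ := ⟨δ, mem_intRing.2 hδ1.le⟩) (intRing_isUnit_iff.2 hδ1) (Subtype.ext hδ) A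
  obtain ⟨a, ha⟩ := key (Fin m) M.toBlocks₁₁
  obtain ⟨d, hd⟩ := key (Fin 1) M.toBlocks₂₂
  let b : Matrix (Idx m) (Idx m) (intRing F) := fromBlocks a 0 0 d
  have hres : ∀ i j, IsLocalRing.residue (intRing F) (M.toBlocks₁₂ i j) = 0 := by
    intro i j
    rw [residue_eq_zero_iff_norm, Subsingleton.elim j 0]
    exact (hγ.2 i).trans_lt D.unif.2.1
  have hb : IsUnit (b + M * b.map D.conjInt) := by
    apply isUnit_of_isUnit_map_residue
    have hM : M = fromBlocks M.toBlocks₁₁ M.toBlocks₁₂ M.toBlocks₂₁ M.toBlocks₂₂ :=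
      (fromBlocks_toBlocks M).symm
    have e12 : (M.toBlocks₁₂ * d.map D.conjInt).map (IsLocalRing.residue (intRing F)) = 0 := by
      rw [Matrix.map_mul]
      have : M.toBlocks₁₂.map (IsLocalRing.residue (intRing F)) = 0 := by
        ext i j; exact hres i j
      rw [this, Matrix.zero_mul]
    rw [hM, fromBlocks_map, fromBlocks_multiply, fromBlocks_add, fromBlocks_map]
    simp only [Matrix.map_zero _ (map_zero D.conjInt), Matrix.mul_zero, zero_add, add_zero]
    rw [e12, Matrix.isUnit_iff_isUnit_det, det_fromBlocks_zero₁₂]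
    have hu : ∀ {ι : Type} [Fintype ι] [DecidableEq ι] {N : Matrix ι ι (intRing F)}, IsUnit N →
        IsUnit (N.map (IsLocalRing.residue (intRing F))).det := by
      intro ι _ _ N hN
      rw [← RingHom.mapMatrix_apply, ← RingHom.map_det]
      exact ((Matrix.isUnit_iff_isUnit_det _).1 hN).map _
    exact (hu ha).mul (hu hd)
  set c : Matrix (Idx m) (Idx m) F := b.map (algebraMap (intRing F) F) with hc
  have hcc : c.map σ = (b.map D.conjInt).map (algebraMap (intRing F) F) := by
    ext i j; rfl
  have hk : (b + M * b.map D.conjInt).map (algebraMap (intRing F) F) =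
      c + M.map (algebraMap (intRing F) F) * c.map σ := by
    rw [Matrix.map_add _ (map_add _), Matrix.map_mul, hcc]
  have hcpar : ∀ b' : Matrix (Idx m) (Idx m) (intRing F), b'.toBlocks₁₂ = 0 →
      b'.map (algebraMap (intRing F) F) ∈ parahoricOrder ϖ m F := by
    intro b' h'
    refine ⟨integralEntries_map _, fun i => ?_⟩
    have : b' (Sum.inl i) (Sum.inr 0) = 0 := congrFun (congrFun h' i) 0
    rw [map_apply, this, map_zero, norm_zero]
    exact norm_nonneg _
  have hmem : c + M.map (algebraMap (intRing F) F) * c.map σ ∈ parahoricOrder ϖ m F := by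
    refine add_mem (hcpar b (by simp [b])) (mul_mem hγ ?_)
    rw [hcc]
    exact hcpar _ (by simp [b, fromBlocks_map])
  have hdet : ‖(c + M.map (algebraMap (intRing F) F) * c.map σ).det‖ = 1 := by
    rw [← hk, ← RingHom.mapMatrix_apply, ← RingHom.map_det]
    exact intRing_isUnit_iff.1 ((Matrix.isUnit_iff_isUnit_det _).1 hb)
  have hu : IsUnit (c + M.map (algebraMap (intRing F) F) * c.map σ) := by
    rw [Matrix.isUnit_iff_isUnit_det, isUnit_iff_ne_zero, ← norm_ne_zero_iff, hdet]
    exact one_ne_zero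
  exact ⟨hu.unit, mem_parK_iff.2 ((mem_units_iff_norm_det parahoricOrder_le).2 ⟨hmem, hdet⟩),
    rMap_eq_iff.2 (map_map_conj_of_mul D.conj_conj hs)⟩

end SymmetricSpace


/-! ## The volume of the parahoric subgroup -/

section Volume

variable {K : Type*} [NormedField K] [IsUltrametricDist K] {m : ℕ}

/-- The integral invertible matrices whose last column is congruent to `w`. -/
def lastColumnCoset (w : Idx m → intRing K) : Set (GL (Idx m) K) :=
  {x | x ∈ integralGL (Idx m) K ∧
    ∀ i, ‖(x : Matrix (Idx m) (Idx m) K) i (Sum.inr 0) - w i‖ < 1}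

theorem isOpen_lastColumnCoset (w : Idx m → intRing K) : IsOpen (lastColumnCoset w) := by
  have : lastColumnCoset w = integralGL (Idx m) K ∩
      ⋂ i, {x : GL (Idx m) K | ‖(x : Matrix (Idx m) (Idx m) K) i (Sum.inr 0) - w i‖ < 1} := by
    ext x; simp only [lastColumnCoset, Set.mem_ofPred_eq, Set.mem_inter_iff, Set.mem_iInter]
  rw [this]
  exact isClopen_integralGL.isOpen.inter (isOpen_iInter_of_finite fun i =>
    isOpen_lt ((continuous_coe_apply _ _).sub continuous_const).norm continuous_const)

theorem mulVec_norm_lt_one {ι : Type*} [Fintype ι] {M : Matrix ι ι K} (hM : IntegralEntries M)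
    {x : ι → K} (hx : ∀ i, ‖x i‖ < 1) (i : ι) : ‖(M *ᵥ x) i‖ < 1 := by
  rw [mulVec, dotProduct]
  refine Finset.sum_induction _ (fun z : K => ‖z‖ < 1)
    (fun a b ha hb => (IsUltrametricDist.norm_add_le_max a b).trans_lt (max_lt ha hb))
    (by rw [norm_zero]; exact one_pos) fun j _ => ?_
  rw [norm_mul]
  calc _ ≤ 1 * ‖x j‖ := mul_le_mul_of_nonneg_right (hM i j) (norm_nonneg _)
    _ < 1 := by rw [one_mul]; exact hx j

theorem mul_mem_lastColumnCoset {T x : GL (Idx m) K} (hT : T ∈ integralGL (Idx m) K)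
    {v w : Idx m → intRing K}
    (hTv : ∀ i, ‖((T : Matrix (Idx m) (Idx m) K) *ᵥ fun j => (v j : K)) i - w i‖ < 1)
    (hx : x ∈ lastColumnCoset v) : T * x ∈ lastColumnCoset w := by
  refine ⟨?_, fun i => ?_⟩
  · rw [mem_integralGL_iff] at hT ⊢
    exact mul_mem hT (mem_integralGL_iff.1 hx.1)
  · have e : ((T * x : GL (Idx m) K) : Matrix (Idx m) (Idx m) K) i (Sum.inr 0) - w i =
        ((T : Matrix (Idx m) (Idx m) K) *ᵥ
          fun j => (x : Matrix (Idx m) (Idx m) K) j (Sum.inr 0) - v j) i +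
        (((T : Matrix (Idx m) (Idx m) K) *ᵥ fun j => (v j : K)) i - w i) := by
      have : (fun j => (x : Matrix (Idx m) (Idx m) K) j (Sum.inr 0) - (v j : K)) =
        (fun j => (x : Matrix (Idx m) (Idx m) K) j (Sum.inr 0)) - fun j => (v j : K) := rfl
      rw [this, Matrix.mulVec_sub, Pi.sub_apply, Units.val_mul, Matrix.mul_apply]
      simp only [mulVec, dotProduct]
      ring
    rw [e]
    exact (IsUltrametricDist.norm_add_le_max _ _).trans_lt
      (max_lt (mulVec_norm_lt_one (fun i j => (hT i j).1) hx.2 i) (hTv i))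

/-- A vector with a unit coordinate is the last column of some T ∈ GL(O), and left translation by T
maps the standard coset onto that of w. -/
theorem measure_lastColumnCoset [SecondCountableTopology K] (μ : Measure (GL (Idx m) K))
    [μ.IsMulLeftInvariant] (w : Idx m → intRing K) (l : Idx m) (hl : IsUnit (w l)) :
    μ (lastColumnCoset w) = μ (lastColumnCoset (Pi.single (Sum.inr 0) 1)) := by
  obtain ⟨T, hT⟩ := exists_GL_mulVec_single w l (Sum.inr 0) hl
  let T' : GL (Idx m) K := Matrix.GeneralLinearGroup.map (algebraMap (intRing K) K) T
  have hT' : T' ∈ integralGL (Idx m) K := fun i j => ⟨norm_coe_le_one _, by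
    rw [← map_inv]; exact norm_coe_le_one _⟩
  have hTinv : T'⁻¹ ∈ integralGL (Idx m) K := by
    rw [mem_integralGL_iff] at hT' ⊢
    exact inv_mem hT'
  have hcol : ((T' : Matrix (Idx m) (Idx m) K) *ᵥ
      fun j => ((Pi.single (Sum.inr 0) 1 : Idx m → intRing K) j : K)) = fun i => (w i : K) := by
    funext i
    rw [← hT]
    exact (RingHom.map_mulVec (algebraMap (intRing K) K) (T : Matrix (Idx m) (Idx m) (intRing K))
      (Pi.single (Sum.inr 0) 1) i).symm
  rw [← measure_preimage_mul μ T' (lastColumnCoset w)]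
  congr 1
  ext x
  constructor
  · intro hx
    have := mul_mem_lastColumnCoset hTinv (w := Pi.single (Sum.inr 0) 1) (fun i => ?_) hx
    · rwa [inv_mul_cancel_left] at this
    · rw [← hcol, mulVec_mulVec, ← Units.val_mul, inv_mul_cancel, Units.val_one, one_mulVec,
        sub_self, norm_zero]
      exact one_pos
  · intro hx
    exact mul_mem_lastColumnCoset hT' (fun i => by
      rw [hcol, sub_self, norm_zero]; exact one_pos) hx

theorem residue_eq_of_mem_lastColumnCoset {v w : Idx m → intRing K} {x : GL (Idx m) K}
    (hv : x ∈ lastColumnCoset v) (hw : x ∈ lastColumnCoset w) (i : Idx m) :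
    IsLocalRing.residue (intRing K) (v i) = IsLocalRing.residue (intRing K) (w i) := by
  rw [residue_eq_iff_norm]
  have : (v i : K) - w i = ((x : Matrix (Idx m) (Idx m) K) i (Sum.inr 0) - w i) -
      ((x : Matrix (Idx m) (Idx m) K) i (Sum.inr 0) - v i) := by ring
  rw [this, sub_eq_add_neg]
  refine (IsUltrametricDist.norm_add_le_max _ _).trans_lt (max_lt (hw.2 i) ?_)
  rw [norm_neg]
  exact hv.2 i

/-- A lift of a vector over the residue field. -/
def liftVec (w : Idx m → IsLocalRing.ResidueField (intRing K)) : Idx m → intRing K :=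
  fun i => Function.surjInv IsLocalRing.residue_surjective (w i)

theorem residue_liftVec (w : Idx m → IsLocalRing.ResidueField (intRing K)) (i : Idx m) :
    IsLocalRing.residue (intRing K) (liftVec w i) = w i :=
  Function.surjInv_eq IsLocalRing.residue_surjective (w i)

/-- The reduction of the last column is nonzero: otherwise multiplication by the integral inverse
would give a diagonal entry 1 of norm less than 1. -/
theorem exists_mem_lastColumnCoset {x : GL (Idx m) K} (hx : x ∈ integralGL (Idx m) K) :
    ∃ w : Idx m → IsLocalRing.ResidueField (intRing K), w ≠ 0 ∧
      x ∈ lastColumnCoset (liftVec w) ∧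
      ∀ i, w i = 0 ↔ ‖(x : Matrix (Idx m) (Idx m) K) i (Sum.inr 0)‖ < 1 := by
  let w : Idx m → IsLocalRing.ResidueField (intRing K) := fun i =>
    IsLocalRing.residue _
      (⟨(x : Matrix (Idx m) (Idx m) K) i (Sum.inr 0), mem_intRing.2 (hx _ _).1⟩ : intRing K)
  have hw : ∀ i, w i = 0 ↔ ‖(x : Matrix (Idx m) (Idx m) K) i (Sum.inr 0)‖ < 1 :=
    fun i => residue_eq_zero_iff_norm
  refine ⟨w, fun h0 => ?_, ⟨hx, fun i => ?_⟩, hw⟩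
  · have h1 := mulVec_norm_lt_one (M := ((x⁻¹ : GL (Idx m) K) : Matrix (Idx m) (Idx m) K))
      (fun i j => (hx i j).2) (fun i => (hw i).1 (congrFun h0 i)) (Sum.inr 0)
    have h2 : (((x⁻¹ : GL (Idx m) K) : Matrix (Idx m) (Idx m) K) *ᵥ
        fun i => (x : Matrix (Idx m) (Idx m) K) i (Sum.inr 0)) (Sum.inr 0) =
        (((x⁻¹ * x : GL (Idx m) K)) : Matrix (Idx m) (Idx m) K) (Sum.inr 0) (Sum.inr 0) := by
      rw [Units.val_mul, Matrix.mul_apply]; rfl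
    rw [h2, inv_mul_cancel, Units.val_one, one_apply_eq, norm_one] at h1
    exact lt_irrefl _ h1
  · exact residue_eq_iff_norm.1 (residue_liftVec w i).symm

theorem measure_iUnion_lastColumnCoset [SecondCountableTopology K] (μ : Measure (GL (Idx m) K))
    [μ.IsMulLeftInvariant] [Finite (IsLocalRing.ResidueField (intRing K))]
    (s : Set (Idx m → IsLocalRing.ResidueField (intRing K))) (hs : ∀ w ∈ s, w ≠ 0) :
    μ (⋃ w : s, lastColumnCoset (liftVec (w : Idx m → IsLocalRing.ResidueField (intRing K)))) =
      Nat.card s * μ (lastColumnCoset (Pi.single (Sum.inr 0) 1)) := by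
  classical
  have := Fintype.ofFinite (IsLocalRing.ResidueField (intRing K))
  have := Fintype.ofFinite s
  rw [measure_iUnion]
  · have : ∀ w : s, μ (lastColumnCoset (liftVec
        (w : Idx m → IsLocalRing.ResidueField (intRing K)))) =
        μ (lastColumnCoset (Pi.single (Sum.inr 0) 1)) := by
      rintro ⟨w, hw⟩
      obtain ⟨l, hl⟩ := Function.ne_iff.1 (hs w hw)
      refine measure_lastColumnCoset μ _ l ?_
      refine isUnit_of_map_unit (IsLocalRing.residue (intRing K)) _ ?_
      rw [residue_liftVec]
      exact isUnit_iff_ne_zero.2 hl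
    simp_rw [this]
    rw [tsum_fintype, Finset.sum_const, nsmul_eq_mul, Finset.card_univ, Nat.card_eq_fintype_card]
  · intro v w hvw
    rw [Function.onFun, Set.disjoint_left]
    intro x hx hx'
    refine hvw (Subtype.ext (funext fun i => ?_))
    have h := residue_eq_of_mem_lastColumnCoset hx hx' i
    rwa [residue_liftVec, residue_liftVec] at h
  · exact fun w => (isOpen_lastColumnCoset _).measurableSet

/-- The volume of the parahoric subgroup relative to the maximal compact subgroup. -/
theorem measure_parahoric [SecondCountableTopology K] (μ : Measure (GL (Idx m) K))
    [μ.IsMulLeftInvariant] [Finite (IsLocalRing.ResidueField (intRing K))]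
    (hμ : μ (integralGL (Idx m) K) = 1) :
    (μ {x | x ∈ integralGL (Idx m) K ∧ ∀ i : Fin m,
      ‖(x : Matrix (Idx m) (Idx m) K) (Sum.inl i) (Sum.inr 0)‖ < 1}).toReal *
      (((residueCard K : ℝ) ^ (m + 1) - 1) / ((residueCard K : ℝ) - 1)) = 1 := by
  classical
  have := Fintype.ofFinite (IsLocalRing.ResidueField (intRing K))
  set k := IsLocalRing.ResidueField (intRing K) with hk
  have hq : residueCard K = Fintype.card k := Nat.card_eq_fintype_card
  have hq1 : 1 < residueCard K := by rw [hq]; exact Fintype.one_lt_card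
  set a := μ (lastColumnCoset (Pi.single (Sum.inr 0) 1 : Idx m → intRing K)) with ha
  have h1 : integralGL (Idx m) K = ⋃ w : ({w | w ≠ 0} : Set (Idx m → k)),
      lastColumnCoset (liftVec (w : Idx m → k)) := by
    ext x
    rw [Set.mem_iUnion]
    constructor
    · intro hx
      obtain ⟨w, hw, hxw, -⟩ := exists_mem_lastColumnCoset hx
      exact ⟨⟨w, hw⟩, hxw⟩
    · rintro ⟨w, hw⟩
      exact hw.1
  have h2 : {x | x ∈ integralGL (Idx m) K ∧ ∀ i : Fin m,
      ‖(x : Matrix (Idx m) (Idx m) K) (Sum.inl i) (Sum.inr 0)‖ < 1} =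
      ⋃ w : ({w | w ≠ 0 ∧ ∀ i, w (Sum.inl i) = 0} : Set (Idx m → k)),
        lastColumnCoset (liftVec (w : Idx m → k)) := by
    ext x
    rw [Set.mem_iUnion]
    constructor
    · rintro ⟨hx, hx'⟩
      obtain ⟨w, hw, hxw, hw0⟩ := exists_mem_lastColumnCoset hx
      exact ⟨⟨w, hw, fun i => (hw0 _).2 (hx' i)⟩, hxw⟩
    · rintro ⟨⟨w, hw, hw'⟩, hx⟩
      refine ⟨hx.1, fun i => ?_⟩
      obtain ⟨w₁, -, hxw, hw0⟩ := exists_mem_lastColumnCoset hx.1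
      rw [← hw0, ← residue_liftVec w₁, residue_eq_of_mem_lastColumnCoset hxw hx, residue_liftVec]
      exact hw' i
  -- GL_n(O) is the union of the cosets of all qⁿ - 1 nonzero vectors, and the parahoric subgroup
  -- that of the q - 1 nonzero multiples of e. All cosets have equal volume.
  have c1 : Nat.card ({w | w ≠ 0} : Set (Idx m → k)) = residueCard K ^ (m + 1) - 1 := by
    rw [Nat.card_eq_fintype_card, hq]
    change Fintype.card {w : Idx m → k // ¬ w = 0} = _
    rw [Fintype.card_subtype_compl, Fintype.card_subtype_eq]
    simp
  have c2 : Nat.card ({w | w ≠ 0 ∧ ∀ i, w (Sum.inl i) = 0} : Set (Idx m → k)) =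
      residueCard K - 1 := by
    let e : ({w | w ≠ 0 ∧ ∀ i, w (Sum.inl i) = 0} : Set (Idx m → k)) ≃ {c : k // ¬ c = 0} :=
      { toFun := fun w => ⟨w.1 (Sum.inr 0), fun h => w.2.1 (funext fun i => by
          rcases i with i | i
          · exact w.2.2 i
          · rw [Subsingleton.elim i 0]; exact h)⟩
        invFun := fun c => ⟨Sum.elim 0 fun _ => c.1, fun h => c.2 (congrFun h (Sum.inr 0)),
          fun _ => rfl⟩
        left_inv := by
          rintro ⟨w, hw⟩
          apply Subtype.ext
          funext i
          rcases i with i | i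
          · exact (hw.2 i).symm
          · rw [Subsingleton.elim i 0]; rfl
        right_inv := fun c => rfl }
    rw [Nat.card_congr e, Nat.card_eq_fintype_card, Fintype.card_subtype_compl,
      Fintype.card_subtype_eq, hq]
  rw [h1, measure_iUnion_lastColumnCoset μ {w : Idx m → k | w ≠ 0} fun w hw => hw, c1] at hμ
  rw [h2, measure_iUnion_lastColumnCoset μ
    {w : Idx m → k | w ≠ 0 ∧ ∀ i, w (Sum.inl i) = 0} fun w hw => hw.1, c2]
  have hμ' := congrArg ENNReal.toReal hμ
  rw [ENNReal.toReal_mul, ENNReal.toReal_natCast, ENNReal.toReal_one,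
    Nat.cast_sub (Nat.one_le_pow _ _ (by omega)), Nat.cast_pow, Nat.cast_one] at hμ'
  rw [ENNReal.toReal_mul, ENNReal.toReal_natCast, Nat.cast_sub hq1.le, Nat.cast_one]
  have hq0 : (residueCard K : ℝ) - 1 ≠ 0 := by
    rw [sub_ne_zero]; exact_mod_cast hq1.ne'
  refine Eq.trans ?_ hμ'
  field_simp

end Volume

/-! ### Rational points of the parahoric subgroup -/

section

variable {F₀ F : Type*} [NormedField F₀] [NormedField F] [NormedAlgebra F₀ F] {ϖ : F₀} {m : ℕ}

theorem baseGL_mem_parK_iff (hϖ : IsUniformizer ϖ) {x : GL (Idx m) F₀} :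
    (baseGL x : GL (Idx m) F) ∈ parK ϖ m ↔ x ∈ integralGL (Idx m) F₀ ∧ ∀ i : Fin m,
      ‖(x : Matrix (Idx m) (Idx m) F₀) (Sum.inl i) (Sum.inr 0)‖ < 1 := by
  have hn : ∀ (y : GL (Idx m) F₀) i j,
      ‖((baseGL y : GL (Idx m) F) : Matrix (Idx m) (Idx m) F) i j‖ =
        ‖(y : Matrix (Idx m) (Idx m) F₀) i j‖ := fun y i j => norm_algebraMap' F _
  refine and_congr ?_ (forall_congr' fun i => ?_)
  · refine forall₂_congr fun i j => ?_
    rw [hn, ← map_inv, hn]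
  · rw [hn]
    exact ⟨fun h => h.trans_lt hϖ.2.1, hϖ.2.2 _⟩

end


/-! ## Integration over one factor -/

section ProductIntegrals

theorem measurable_charFn {X : Type*} [MeasurableSpace X] {S : Set X} (hS : MeasurableSet S) :
    Measurable (charFn S) := measurable_const.indicator hS

/-- Integration of a characteristic function over the second factor of a product, without
integrability assumptions. -/
theorem integral_prod_charFn_mul {X Y : Type*} [MeasurableSpace X] [MeasurableSpace Y]
    (μ : Measure X) [SFinite μ] (ν : Measure Y) [SFinite ν] {S : Set (X × Y)}
    (hS : MeasurableSet S) {f : X → ℂ} (hf : Measurable f)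
    (hfin : ∀ x, ν (Prod.mk x ⁻¹' S) ≠ ⊤) :
    ∫ z, charFn S z * f z.1 ∂(μ.prod ν) = ∫ x, (ν (Prod.mk x ⁻¹' S)).toReal * f x ∂μ := by
  have hsec : ∀ x, MeasurableSet (Prod.mk x ⁻¹' S) := fun x => measurable_prodMk_left hS
  have hch : ∀ x y, charFn S (x, y) = charFn (Prod.mk x ⁻¹' S) y := fun x y => rfl
  have hint : ∀ x, Integrable (charFn (Prod.mk x ⁻¹' S)) ν := fun x =>
    (integrable_indicator_iff (hsec x)).2 (integrableOn_const (hfin x))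
  have hval : ∀ x, ∫ y, charFn S (x, y) * f x ∂ν = (ν (Prod.mk x ⁻¹' S)).toReal * f x := by
    intro x
    rw [integral_mul_const]
    congr 1
    change ∫ y, charFn (Prod.mk x ⁻¹' S) y ∂ν = _
    rw [charFn, integral_indicator (hsec x), setIntegral_const]
    simp [Measure.real]
  have hval' : ∀ x, ∫ y, ‖charFn S (x, y) * f x‖ ∂ν =
      ‖((ν (Prod.mk x ⁻¹' S)).toReal : ℂ) * f x‖ := by
    intro x
    simp_rw [norm_mul]
    rw [integral_mul_const]
    congr 1
    have : (fun y => ‖charFn S (x, y)‖) = (Prod.mk x ⁻¹' S).indicator fun _ => (1 : ℝ) := by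
      funext y
      rw [hch, charFn, norm_indicator_eq_indicator_norm]
      simp
    rw [this, integral_indicator (hsec x), setIntegral_const]
    simp [Measure.real]
  have hm : Measurable fun z : X × Y => charFn S z * f z.1 :=
    (measurable_charFn hS).mul (hf.comp measurable_fst)
  by_cases hg : Integrable (fun z : X × Y => charFn S z * f z.1) (μ.prod ν)
  · rw [integral_prod _ hg]
    exact integral_congr_ae (Filter.Eventually.of_forall hval)
  -- Without integrability both integrals take the default value 0. The norm of the integrand has
  -- inner integral equal to the norm of the right-hand integrand, so integrability on one side is
  -- equivalent to integrability on the other.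
  · rw [integral_undef hg, integral_undef]
    intro h
    refine hg ((integrable_prod_iff hm.aestronglyMeasurable).2 ⟨?_, ?_⟩)
    · exact Filter.Eventually.of_forall fun x => (hint x).mul_const (f x)
    · simp only [hval']
      exact h.norm

theorem integral_prod_charFn_mul_of_measure_eq_one {X Y : Type*} [MeasurableSpace X]
    [MeasurableSpace Y] (μ : Measure X) [SFinite μ] (ν : Measure Y) [SFinite ν] {S : Set (Y × X)}
    (hS : MeasurableSet S) {f : X → ℂ} (hf : Measurable f)
    (h1 : ∀ x, ν {y | (y, x) ∈ S} = 1) :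
    ∫ z, charFn S z * f z.2 ∂(ν.prod μ) = ∫ x, f x ∂μ := by
  rw [← integral_prod_swap]
  have hsec : ∀ x, Prod.mk x ⁻¹' (Prod.swap ⁻¹' S) = {y | (y, x) ∈ S} := fun x => rfl
  refine (integral_prod_charFn_mul μ ν (measurable_swap hS) hf fun x => ?_).trans ?_
  · rw [hsec, h1]; exact ENNReal.one_ne_top
  · simp_rw [hsec, h1]
    simp

/-- Symmetry of K turns h⁻¹a ∈ K into a⁻¹h ∈ K, so left invariance suffices and unimodularity is not
needed. -/
theorem measure_inv_mul_mem {G : Type*} [Group G] [MeasurableSpace G] [MeasurableMul G]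
    (ν : Measure G) [ν.IsMulLeftInvariant] {K : Set G} (hK : ∀ x, x⁻¹ ∈ K ↔ x ∈ K) (a : G) :
    ν {h | h⁻¹ * a ∈ K} = ν K := by
  rw [← measure_preimage_mul ν a⁻¹ K]
  congr 1
  ext h
  rw [Set.mem_ofPred_eq, Set.mem_preimage, ← hK, _root_.mul_inv_rev, inv_inv]

end ProductIntegrals

/-! ## Reduction of the homogeneous orbital integrals -/

section UnitarySide

variable {F₀ F : Type*} [NormedField F₀] [NormedField F] [NormedAlgebra F₀ F]
variable [IsUltrametricDist F] {σ : F ≃ₐ[F₀] F} {ϖ : F₀} {m : ℕ}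

theorem mul_mem_stabGp_iff {ι : Type*} [Fintype ι] [DecidableEq ι] {G : Subgroup (GL ι F)}
    {Λ : Submodule (intRing F) (ι → F)} {k x : GL ι F} (hk : k ∈ stabGp G Λ) :
    k * x ∈ stabGp G Λ ↔ x ∈ stabGp G Λ := by
  refine and_congr (G.mul_mem_cancel_left hk.1) (forall_congr' fun w => ?_)
  rw [Units.val_mul, ← mulVec_mulVec, hk.2]

theorem inv_mem_stabGp_iff {ι : Type*} [Fintype ι] [DecidableEq ι] {G : Subgroup (GL ι F)}
    {Λ : Submodule (intRing F) (ι → F)} {x : GL ι F} : x⁻¹ ∈ stabGp G Λ ↔ x ∈ stabGp G Λ := by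
  have h1 : (1 : GL ι F) ∈ stabGp G Λ := ⟨one_mem _, fun w => by simp⟩
  constructor
  · intro h
    exact (mul_mem_stabGp_iff h).1 (by rwa [inv_mul_cancel])
  · intro h
    exact (mul_mem_stabGp_iff h).1 (by rwa [mul_inv_cancel])

theorem glEmb_mem_stabGp {J : Matrix (Fin m) (Fin m) F} {ε : F₀}
    {Λ : Submodule (intRing F) (Fin m → F)} {k : GL (Fin m) F}
    (hk : k ∈ stabGp (unitaryGp σ J) Λ) :
    glEmb k ∈ stabGp (unitaryGp σ (extForm J ε)) (extLattice Λ) := by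
  refine ⟨?_, fun w => ?_⟩
  · have hh' : (k : Matrix (Fin m) (Fin m) F)ᵀ * J * (k : Matrix (Fin m) (Fin m) F).map σ = J :=
      hk.1
    change _ * _ * _ = _
    rw [extForm_conj, hh']
  · have e : ((glEmb k : GL (Idx m) F) : Matrix (Idx m) (Idx m) F) *ᵥ w =
        Sum.elim ((k : Matrix (Fin m) (Fin m) F) *ᵥ fun i => w (Sum.inl i))
          (fun i => w (Sum.inr i)) := by
      rw [coe_glEmb, fromBlocks_mulVec]
      simp [Function.comp_def]
    rw [e]
    exact and_congr_left fun _ => hk.2 _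

theorem isClosed_stabGp {ι : Type*} [Fintype ι] [DecidableEq ι] {G : Subgroup (GL ι F)}
    (hG : IsClosed (G : Set (GL ι F))) {Λ : Submodule (intRing F) (ι → F)}
    (hΛ : IsClopen (Λ : Set (ι → F))) : IsClosed (stabGp G Λ) := by
  have : stabGp G Λ = (G : Set (GL ι F)) ∩ ⋂ x : ι → F,
      {g : GL ι F | (g : Matrix ι ι F) *ᵥ x ∈ Λ ↔ x ∈ Λ} := by
    ext g; simp [stabGp]
  rw [this]
  refine hG.inter (isClosed_iInter fun x => ?_)
  have hc : Continuous fun g : GL ι F => (g : Matrix ι ι F) *ᵥ x :=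
    Units.continuous_val.matrix_mulVec continuous_const
  by_cases hx : x ∈ Λ
  · simp only [hx, iff_true]
    exact hΛ.1.preimage hc
  · simp only [hx, iff_false]
    exact hΛ.compl.1.preimage hc

theorem isClopen_extLattice {Λ : Submodule (intRing F) (Fin m → F)}
    (hΛ : IsClopen (Λ : Set (Fin m → F))) : IsClopen (extLattice Λ : Set (Idx m → F)) := by
  have hc : IsClopen {x : F | x ∈ intRing F} := by
    have : {x : F | x ∈ intRing F} = Metric.closedBall 0 1 := by
      ext
      rw [Set.mem_ofPred_eq, mem_intRing, mem_closedBall_zero_iff]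
    rw [this]
    exact IsUltrametricDist.isClopen_closedBall _ one_ne_zero
  exact (hΛ.preimage (f := fun w : Idx m → F => fun i => w (Sum.inl i)) (by fun_prop)).inter
    (hc.preimage (f := fun w : Idx m → F => w (Sum.inr 0)) (by fun_prop))

theorem isClopen_of_mulVec_mem_iff {Λ : Submodule (intRing F) (Fin m → F)} {T : GL (Fin m) F}
    (hT : ∀ x, (T : Matrix (Fin m) (Fin m) F) *ᵥ x ∈ Λ ↔ ∀ i, ‖x i‖ ≤ 1) :
    IsClopen (Λ : Set (Fin m → F)) := by
  have hc : IsClopen {x : F | ‖x‖ ≤ 1} := by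
    have : {x : F | ‖x‖ ≤ 1} = Metric.closedBall 0 1 := by ext; simp
    rw [this]
    exact IsUltrametricDist.isClopen_closedBall _ one_ne_zero
  have : (Λ : Set (Fin m → F)) = ⋂ i, (fun x : Fin m → F =>
      (((T⁻¹ : GL (Fin m) F) : Matrix (Fin m) (Fin m) F) *ᵥ x) i) ⁻¹' {x : F | ‖x‖ ≤ 1} := by
    ext x
    have := hT (((T⁻¹ : GL (Fin m) F) : Matrix (Fin m) (Fin m) F) *ᵥ x)
    rw [mulVec_mulVec, ← Units.val_mul, mul_inv_cancel, Units.val_one, one_mulVec] at this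
    simpa using this
  rw [this]
  refine isClopen_iInter_of_finite fun i => hc.preimage ?_
  exact (continuous_apply i).comp (continuous_const.matrix_mulVec continuous_id)

theorem UnramifiedQuadratic.sfinite_unitaryGp [LocallyCompactSpace F] [SecondCountableTopology F]
    (D : UnramifiedQuadratic σ ϖ) (J : Matrix (Fin m) (Fin m) F) (ν : Measure (unitaryGp σ J))
    [ν.IsHaarMeasure] : SFinite ν := by
  have : LocallyCompactSpace (unitaryGp σ J) :=
    (D.isClosed_unitaryGp J).isClosedEmbedding_subtypeVal.locallyCompactSpace
  have : SecondCountableTopology (unitaryGp σ J) :=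
    TopologicalSpace.Subtype.secondCountableTopology (unitaryGp σ J : Set (GL (Fin m) F))
  infer_instance

/-- For fixed h₂ the first condition confines h₁ to a coset of the stabilizer of Λ, of volume one.
There the second component equals h₂⁻¹g₁⁻¹g₂h₂ up to left multiplication by an element of the
stabilizer of the extended lattice, so the condition depends on h₂ alone. -/
theorem orbUHom_charFn [LocallyCompactSpace F] [SecondCountableTopology F]
    (D : UnramifiedQuadratic σ ϖ) {J : Matrix (Fin m) (Fin m) F} {ε : F₀}
    {Λ : Submodule (intRing F) (Fin m → F)} (hΛ : IsClopen (Λ : Set (Fin m → F)))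
    (ν : Measure (unitaryGp σ J)) [ν.IsHaarMeasure]
    (hν : ν {h | (h : GL (Fin m) F) ∈ stabGp (unitaryGp σ J) Λ} = 1)
    (g : GL (Fin m) F × GL (Idx m) F) (hg : g.1 ∈ unitaryGp σ J) :
    orbUHom ν g (charFn (stabGp (unitaryGp σ J) Λ ×ˢ
      stabGp (unitaryGp σ (extForm J ε)) (extLattice Λ))) =
    orbU ν (quot g : Matrix (Idx m) (Idx m) F)
      (charFn (toMat (stabGp (unitaryGp σ (extForm J ε)) (extLattice Λ)))) := by
  let H := unitaryGp σ J
  set K := stabGp (unitaryGp σ (extForm J ε)) (extLattice Λ) with hK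
  have := D.sfinite_unitaryGp J ν
  have : SecondCountableTopology H :=
    TopologicalSpace.Subtype.secondCountableTopology (H : Set (GL (Fin m) F))
  have hc1 : IsClosed (stabGp H Λ) := isClosed_stabGp (D.isClosed_unitaryGp J) hΛ
  have hc2 : IsClosed K := isClosed_stabGp (D.isClosed_unitaryGp _) (isClopen_extLattice hΛ)
  let c : H → GL (Idx m) F := fun h => (glEmb (h : GL (Fin m) F))⁻¹ * quot g * glEmb h
  have hcc : Continuous c := by
    have h1 : Continuous fun h : H => glEmb (h : GL (Fin m) F) :=
      continuous_glEmb.comp continuous_subtype_val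
    exact (h1.inv.mul continuous_const).mul h1
  let S : Set (H × H) :=
    {h | (h.1 : GL (Fin m) F)⁻¹ * g.1 * (h.2 : GL (Fin m) F) ∈ stabGp H Λ}
  have hS : MeasurableSet S := by
    refine (hc1.preimage ?_).measurableSet
    exact ((continuous_subtype_val.comp continuous_fst).inv.mul continuous_const).mul
      (continuous_subtype_val.comp continuous_snd)
  have hf : Measurable fun h : H => charFn K (c h) :=
    (measurable_charFn hc2.measurableSet).comp hcc.measurable
  have hcoe : ∀ h : H, charFn (toMat K) (conjAct (quot g : Matrix (Idx m) (Idx m) F) h) =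
      charFn K (c h) := by
    intro h
    refine charFn_congr ?_
    have e : conjAct (quot g : Matrix (Idx m) (Idx m) F) h =
        ((c h : GL (Idx m) F) : Matrix (Idx m) (Idx m) F) := by
      rw [conjAct, map_inv]; rfl
    rw [e, toMat]
    exact Function.Injective.mem_set_image Units.val_injective
  rw [orbUHom, orbU]
  simp_rw [hcoe]
  rw [← integral_prod_charFn_mul_of_measure_eq_one ν ν hS hf]
  · refine integral_congr_ae (Filter.Eventually.of_forall fun h => ?_)
    change charFn _ _ = charFn _ _ * charFn _ _
    by_cases hh : h ∈ S
    · have e1 : charFn S h = 1 := Set.indicator_of_mem hh _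
      rw [e1, one_mul]
      refine charFn_congr ?_
      rw [Set.mem_prod]
      have e2 : (glEmb (h.1 : GL (Fin m) F))⁻¹ * g.2 * glEmb (h.2 : GL (Fin m) F) =
          glEmb ((h.1 : GL (Fin m) F)⁻¹ * g.1 * (h.2 : GL (Fin m) F)) * c h.2 := by
        simp only [c, quot, map_mul, map_inv]
        group
      rw [e2]
      exact (and_iff_right hh).trans (mul_mem_stabGp_iff (glEmb_mem_stabGp hh))
    · have e1 : charFn S h = 0 := Set.indicator_of_notMem hh _
      rw [e1, zero_mul]
      exact Set.indicator_of_notMem (fun h' => hh h'.1) _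
  · intro x
    rw [← hν]
    have := measure_inv_mul_mem ν (K := {h : H | (h : GL (Fin m) F) ∈ stabGp H Λ})
      (fun x => inv_mem_stabGp_iff) (⟨g.1, hg⟩ * x)
    rw [← this]
    congr 1
    ext y
    change (y : GL (Fin m) F)⁻¹ * g.1 * (x : GL (Fin m) F) ∈ stabGp H Λ ↔
      (y : GL (Fin m) F)⁻¹ * (g.1 * (x : GL (Fin m) F)) ∈ stabGp H Λ
    rw [mul_assoc]

end UnitarySide

/-! ### Homogeneous orbital integrals on the linear side -/

section LinearSide

variable {F₀ F : Type*} [NormedField F₀] [NormedField F] [NormedAlgebra F₀ F]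
variable [IsUltrametricDist F] {σ : F ≃ₐ[F₀] F} {ϖ : F₀} {m : ℕ}

theorem rMap_glEmb_inv_mul (g : GL (Idx m) F) (h : GL (Fin m) F₀) :
    rMap σ ((glEmb (baseGL h))⁻¹ * g) = conjAct (rMap σ g) (baseGL h) := by
  have e : ((glEmb (baseGL h : GL (Fin m) F) : GL (Idx m) F) : Matrix (Idx m) (Idx m) F).map σ =
      ((glEmb (baseGL h : GL (Fin m) F) : GL (Idx m) F) : Matrix (Idx m) (Idx m) F) := by
    rw [coe_glEmb, fromBlocks_map, coe_baseGL_map]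
    simp
  rw [rMap, rMap, conjAct, _root_.mul_inv_rev, inv_inv, Units.val_mul, Units.val_mul,
    Matrix.map_mul, e, map_inv]
  simp only [Matrix.mul_assoc]

/-- If r(a) ∈ K', integral Hilbert 90 gives a = k y with k ∈ K₀(ϖ) and y rational, so the set is a
left translate of the rational points of K₀(ϖ). If r(a) ∉ K', it is empty, as r(ax) = r(a) for
rational x. -/
theorem measure_mul_baseGL_mem_parK (D : UnramifiedQuadratic σ ϖ) [SecondCountableTopology F₀]
    (μn : Measure (GL (Idx m) F₀)) [μn.IsMulLeftInvariant] (a : GL (Idx m) F) :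
    (μn {x | a * baseGL x ∈ parK ϖ m} = μn {x | (baseGL x : GL (Idx m) F) ∈ parK ϖ m} ∧
      rMap σ a ∈ symK σ ϖ m) ∨
    (μn {x | a * baseGL x ∈ parK ϖ m} = 0 ∧ rMap σ a ∉ symK σ ϖ m) := by
  by_cases h : rMap σ a ∈ symK σ ϖ m
  · left
    refine ⟨?_, h⟩
    obtain ⟨k, hk, hka⟩ := D.exists_mem_parK h
    obtain ⟨y, rfl⟩ := D.rMap_eq_rMap_iff.1 hka.symm
    rw [← measure_preimage_mul μn y {x | (baseGL x : GL (Idx m) F) ∈ parK ϖ m}]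
    congr 1
    ext x
    rw [Set.mem_ofPred_eq, Set.mem_preimage, Set.mem_ofPred_eq, mul_assoc, ← map_mul, mem_parK_iff,
      mem_parK_iff]
    exact Subgroup.mul_mem_cancel_left _ (mem_parK_iff.1 hk)
  · right
    refine ⟨?_, h⟩
    have : {x : GL (Idx m) F₀ | a * baseGL x ∈ parK ϖ m} = ∅ := by
      ext x
      simp only [Set.mem_ofPred_eq, Set.mem_empty_iff_false, iff_false]
      intro hx
      apply h
      rw [← D.rMap_eq_rMap_iff.2 ⟨x, rfl⟩]
      exact D.rMap_mem_symK hx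
    rw [this, measure_empty]

theorem det_ne_zero_of_GL {ι L : Type*} [Fintype ι] [DecidableEq ι] [Field L] (y : GL ι L) :
    (y : Matrix ι ι L).det ≠ 0 :=
  ((Matrix.isUnit_iff_isUnit_det _).1 y.isUnit).ne_zero

/-- Elements of K₀(ϖ) have unit determinant, so v(det h) = v(det g) + v(det x). The rest is
arithmetic with signs: the even power of η(det x) disappears. -/
theorem eta_pow_mul_eta_pow (D : UnramifiedQuadratic σ ϖ) {g : GL (Idx m) F} {h : GL (Fin m) F₀}
    {x : GL (Idx m) F₀} (hx : (glEmb (baseGL h))⁻¹ * g * baseGL x ∈ parK ϖ m) :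
    eta σ (h : Matrix (Fin m) (Fin m) F₀).det ^ (m + 1) *
      eta σ (x : Matrix (Idx m) (Idx m) F₀).det ^ m =
    etaTilde ϖ (g : Matrix (Idx m) (Idx m) F).det ^ m *
      eta σ (h : Matrix (Fin m) (Fin m) F₀).det := by
  have hb : ∀ {ι : Type} [Fintype ι] [DecidableEq ι] (y : GL ι F₀),
      ((baseGL y : GL ι F) : Matrix ι ι F).det = algebraMap F₀ F (y : Matrix ι ι F₀).det :=
    fun y => (RingHom.map_det (algebraMap F₀ F) _).symm
  have he : (((glEmb (baseGL h : GL (Fin m) F)) : GL (Idx m) F) : Matrix (Idx m) (Idx m) F).det =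
      algebraMap F₀ F (h : Matrix (Fin m) (Fin m) F₀).det := by
    rw [coe_glEmb, det_fromBlocks_zero₂₁, det_one, mul_one, hb]
  have h1 := norm_det_of_mem_parK hx
  have h2 : ‖(g : Matrix (Idx m) (Idx m) F).det * algebraMap F₀ F (x : Matrix (Idx m) (Idx m) F₀).det‖ =
      ‖algebraMap F₀ F (h : Matrix (Fin m) (Fin m) F₀).det‖ := by
    have e : g * baseGL x =
        glEmb (baseGL h : GL (Fin m) F) * ((glEmb (baseGL h))⁻¹ * g * baseGL x) := by group
    have e' := congrArg (fun y : GL (Idx m) F => ‖(y : Matrix (Idx m) (Idx m) F).det‖) e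
    simp only [Units.val_mul _ ((glEmb (baseGL h))⁻¹ * g * baseGL x), det_mul, norm_mul, h1,
      mul_one, he] at e'
    rw [← e', Units.val_mul, det_mul, hb, norm_mul]
  have h3 := etaTilde_congr (ϖ := ϖ) h2
  rw [D.etaTilde_mul (det_ne_zero_of_GL g) (by simpa using det_ne_zero_of_GL x), ← D.eta_eq_etaTilde (det_ne_zero_of_GL x),
    ← D.eta_eq_etaTilde (det_ne_zero_of_GL h)] at h3
  have s1 := UnramifiedQuadratic.etaTilde_mul_self (ϖ := ϖ) (g : Matrix (Idx m) (Idx m) F).det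
  have s2 := UnramifiedQuadratic.eta_mul_self (σ := σ) (x : Matrix (Idx m) (Idx m) F₀).det
  rw [← h3]
  set u := etaTilde ϖ (g : Matrix (Idx m) (Idx m) F).det
  set v := eta σ (x : Matrix (Idx m) (Idx m) F₀).det
  calc (u * v) ^ (m + 1) * v ^ m = u ^ m * (u * v) * (v * v) ^ m := by ring
    _ = _ := by rw [s2, one_pow, mul_one]

/-- The variable h₁ ranges over a coset of GL_{n-1}(O_F), of volume one. Then the variable in
GL_n(F₀) contributes the volume c of the rational points of K₀(ϖ) when the conjugate of r(γ₁⁻¹γ₂)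
lies in K', and 0 otherwise. Finally c (qⁿ - 1)/(q - 1) = 1. -/
theorem orbLinHom_charFn [IsUltrametricDist F₀] [ProperSpace F₀] [LocallyCompactSpace F]
    [SecondCountableTopology F] (D : UnramifiedQuadratic σ ϖ)
    (μ : Measure (GL (Fin m) F₀)) [μ.IsHaarMeasure]
    (μn : Measure (GL (Idx m) F₀)) [μn.IsHaarMeasure] (hμn : μn (integralGL (Idx m) F₀) = 1)
    (μF : Measure (GL (Fin m) F)) [μF.IsHaarMeasure] (hμF : μF (integralGL (Fin m) F) = 1)
    (γ : GL (Fin m) F × GL (Idx m) F) :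
    orbLinHom σ μF μ μn γ (fun γ =>
      (-1) ^ m * (((residueCard F₀ : ℂ) ^ (m + 1) - 1) / ((residueCard F₀ : ℂ) - 1)) *
      charFn (integralGL (Fin m) F ×ˢ parK ϖ m) γ) =
    etaTilde ϖ (quot γ : Matrix (Idx m) (Idx m) F).det ^ m *
      orbLin σ μ (rMap σ (quot γ)) (fun γ => (-1) ^ m * charFn (symK σ ϖ m) γ) := by
  have := D.unif.finite_residueField
  have hvol := measure_parahoric μn hμn
  set c := μn {x | (baseGL x : GL (Idx m) F) ∈ parK ϖ m} with hc
  have hc' : c = μn {x | x ∈ integralGL (Idx m) F₀ ∧ ∀ i : Fin m,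
      ‖(x : Matrix (Idx m) (Idx m) F₀) (Sum.inl i) (Sum.inr 0)‖ < 1} := by
    simp only [hc, baseGL_mem_parK_iff D.unif]
  rw [← hc'] at hvol
  have hctop : c ≠ ⊤ := by
    intro h
    rw [h] at hvol
    simp at hvol
  set q : ℂ := ((residueCard F₀ : ℂ) ^ (m + 1) - 1) / ((residueCard F₀ : ℂ) - 1) with hq
  have hvol' : (c.toReal : ℂ) * q = 1 := by
    rw [hq]; exact_mod_cast congrArg (fun r : ℝ => (r : ℂ)) hvol
  set g := quot γ with hg
  have hpar := isClopen_parK (L := F) D.unif.1 (m := m)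
  have hηh : Measurable fun h : GL (Fin m) F₀ => eta σ (h : Matrix (Fin m) (Fin m) F₀).det :=
    D.measurable_eta measurable_norm_det
  let S : Set (GL (Fin m) F × (GL (Fin m) F₀ × GL (Idx m) F₀)) :=
    {h | h.1⁻¹ * γ.1 * baseGL h.2.1 ∈ integralGL (Fin m) F}
  have hS : MeasurableSet S := by
    refine (isClopen_integralGL.1.preimage ?_).measurableSet
    exact (continuous_fst.inv.mul continuous_const).mul
      (continuous_baseGL.comp (continuous_fst.comp continuous_snd))
  let S' : Set (GL (Fin m) F₀ × GL (Idx m) F₀) :=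
    {h | (glEmb (baseGL h.1))⁻¹ * g * baseGL h.2 ∈ parK ϖ m}
  have hS' : MeasurableSet S' := by
    refine (hpar.1.preimage ?_).measurableSet
    exact (((continuous_glEmb.comp (continuous_baseGL.comp continuous_fst)).inv).mul
      continuous_const).mul (continuous_baseGL.comp continuous_snd)
  let f : GL (Fin m) F₀ → ℂ := fun h => (-1) ^ m * q *
    (etaTilde ϖ (g : Matrix (Idx m) (Idx m) F).det ^ m *
      eta σ (h : Matrix (Fin m) (Fin m) F₀).det)
  have hf : Measurable f := (hηh.const_mul _).const_mul _
  have hf' : Measurable fun z : GL (Fin m) F₀ × GL (Idx m) F₀ => charFn S' z * f z.1 :=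
    (measurable_charFn hS').mul (hf.comp measurable_fst)
  have hsec := fun h : GL (Fin m) F₀ =>
    measure_mul_baseGL_mem_parK D μn ((glEmb (baseGL h))⁻¹ * g)
  have hsec' : ∀ h : GL (Fin m) F₀, Prod.mk h ⁻¹' S' =
    {x | (glEmb (baseGL h))⁻¹ * g * baseGL x ∈ parK ϖ m} := fun h => rfl
  calc _ = ∫ z, charFn S z * (charFn S' z.2 * f z.2.1) ∂(μF.prod (μ.prod μn)) := by
        refine integral_congr_ae (Filter.Eventually.of_forall fun h => ?_)
        have e2 : (glEmb h.1)⁻¹ * γ.2 * baseGL h.2.2 =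
            glEmb (h.1⁻¹ * γ.1 * baseGL h.2.1) *
              ((glEmb (baseGL h.2.1))⁻¹ * g * baseGL h.2.2) := by
          simp only [hg, quot, map_mul, map_inv]
          group
        simp only
        by_cases h1 : h ∈ S
        · have hiff : (glEmb h.1)⁻¹ * γ.2 * baseGL h.2.2 ∈ parK ϖ m ↔ h.2 ∈ S' := by
            rw [e2]
            change _ ↔ _ ∈ parK ϖ m
            rw [mem_parK_iff, mem_parK_iff]
            exact Subgroup.mul_mem_cancel_left _ (mem_parK_iff.1 (glEmb_mem_parK h1))
          have e1 : charFn S h = 1 := Set.indicator_of_mem h1 _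
          by_cases h2 : h.2 ∈ S'
          · have e3 : charFn S' h.2 = 1 := Set.indicator_of_mem h2 _
            have e4 : charFn (integralGL (Fin m) F ×ˢ parK ϖ m)
                (h.1⁻¹ * γ.1 * baseGL h.2.1, (glEmb h.1)⁻¹ * γ.2 * baseGL h.2.2) = 1 :=
              Set.indicator_of_mem (Set.mem_prod.2 ⟨h1, hiff.2 h2⟩) _
            rw [e1, e3, e4, eta_pow_mul_eta_pow D h2]
            simp only [f]
            ring
          · have e3 : charFn S' h.2 = 0 := Set.indicator_of_notMem h2 _
            have e4 : charFn (integralGL (Fin m) F ×ˢ parK ϖ m)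
                (h.1⁻¹ * γ.1 * baseGL h.2.1, (glEmb h.1)⁻¹ * γ.2 * baseGL h.2.2) = 0 :=
              Set.indicator_of_notMem (fun h' => h2 (hiff.1 h'.2)) _
            rw [e3, e4]
            ring
        · have e1 : charFn S h = 0 := Set.indicator_of_notMem h1 _
          have e4 : charFn (integralGL (Fin m) F ×ˢ parK ϖ m)
              (h.1⁻¹ * γ.1 * baseGL h.2.1, (glEmb h.1)⁻¹ * γ.2 * baseGL h.2.2) = 0 :=
            Set.indicator_of_notMem (fun h' => h1 h'.1) _
          rw [e1, e4]
          ring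
    _ = ∫ z, charFn S' z * f z.1 ∂(μ.prod μn) := by
        refine integral_prod_charFn_mul_of_measure_eq_one (μ.prod μn) μF hS hf' fun x => ?_
        have hinv : ∀ x : GL (Fin m) F,
            x⁻¹ ∈ integralGL (Fin m) F ↔ x ∈ integralGL (Fin m) F := fun x => by
          rw [mem_integralGL_iff, mem_integralGL_iff]
          exact Subgroup.inv_mem_iff _
        rw [← hμF, ← measure_inv_mul_mem μF hinv (γ.1 * baseGL x.1)]
        congr 1
        ext y
        change y⁻¹ * γ.1 * baseGL x.1 ∈ integralGL (Fin m) F ↔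
          y⁻¹ * (γ.1 * baseGL x.1) ∈ integralGL (Fin m) F
        rw [mul_assoc]
    _ = ∫ h, (μn (Prod.mk h ⁻¹' S')).toReal * f h ∂μ := by
        refine integral_prod_charFn_mul μ μn hS' hf fun h => ?_
        rw [hsec']
        rcases hsec h with ⟨h1, -⟩ | ⟨h1, -⟩
        · rw [h1]; exact hctop
        · rw [h1]; exact ENNReal.zero_ne_top
    _ = _ := by
        rw [orbLin, ← integral_const_mul]
        refine integral_congr_ae (Filter.Eventually.of_forall fun h => ?_)
        simp only [hsec']
        rcases hsec h with ⟨h1, h2⟩ | ⟨h1, h2⟩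
        · rw [rMap_glEmb_inv_mul] at h2
          have e : charFn (symK σ ϖ m) (conjAct (rMap σ g) (baseGL h)) = 1 :=
            Set.indicator_of_mem h2 _
          rw [h1, e]
          simp only [f]
          linear_combination ((-1) ^ m * (etaTilde ϖ (g : Matrix (Idx m) (Idx m) F).det ^ m *
            eta σ (h : Matrix (Fin m) (Fin m) F₀).det)) * hvol'
        · rw [rMap_glEmb_inv_mul] at h2
          have e : charFn (symK σ ϖ m) (conjAct (rMap σ g) (baseGL h)) = 0 :=
            Set.indicator_of_notMem h2 _
          rw [h1, e]
          simp

/-- Here n = m + 1. For n odd the m-th power of the sign is 1. For n even it is the sign itself,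
which cancels the extra factor in ω_{G'}. -/
theorem omegaG_mul_etaTilde_pow (ϖ : F₀) (γ : GL (Fin m) F × GL (Idx m) F) :
    omegaG σ ϖ γ * etaTilde ϖ (quot γ : Matrix (Idx m) (Idx m) F).det ^ m =
      omegaS ϖ (rMap σ (quot γ)) := by
  have s : etaTilde ϖ (quot γ : Matrix (Idx m) (Idx m) F).det ^ 2 = 1 := by
    rw [pow_two, UnramifiedQuadratic.etaTilde_mul_self]
  rcases Nat.even_or_odd m with h | h
  · have e : ∀ u : ℂ, u ^ 2 = 1 → u ^ m = 1 := by
      obtain ⟨k, rfl⟩ := h.two_dvd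
      intro u hu
      rw [pow_mul, hu, one_pow]
    rw [omegaG, if_pos h.add_one, e _ s, mul_one]
  · have e : ∀ u : ℂ, u ^ 2 = 1 → u ^ m = u := by
      obtain ⟨k, rfl⟩ := h
      intro u hu
      rw [pow_succ, pow_mul, hu, one_pow, one_mul]
    rw [omegaG, if_neg (Nat.not_odd_iff_even.2 h.add_one), e _ s, mul_right_comm, ← pow_two,
      s, one_mul]

/-- The homogeneous and the inhomogeneous statements are equivalent. -/
theorem homAFL_iff_inhomAFL [IsUltrametricDist F₀] [ProperSpace F₀] [LocallyCompactSpace F]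
    [SecondCountableTopology F] (D : UnramifiedQuadratic σ ϖ)
    (μ : Measure (GL (Fin m) F₀)) [μ.IsHaarMeasure]
    (μn : Measure (GL (Idx m) F₀)) [μn.IsHaarMeasure] (hμn : μn (integralGL (Idx m) F₀) = 1)
    (μF : Measure (GL (Fin m) F)) [μF.IsHaarMeasure] (hμF : μF (integralGL (Fin m) F) = 1)
    (W : HermPair σ m ϖ) (Λ : Submodule (intRing F) (Fin m → F)) (hΛ : IsSelfDual σ (W.J 1) Λ)
    (ν : ∀ i, Measure (W.H i)) [∀ i, (ν i).IsHaarMeasure]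
    (hν : ν 1 {h | (h : GL (Fin m) F) ∈ stabGp (W.H 1) Λ} = 1) :
    HomAFL ϖ μF μ μn W Λ ν ↔ InhomAFL ϖ μ W Λ ν := by
  obtain ⟨T, hT, -⟩ := D.exists_orthonormal_basis (W.herm 1) hΛ
  have hU : ∀ i : Fin 2, ∀ g : GL (Fin m) F × GL (Idx m) F, g.1 ∈ W.H i →
      orbUHom (ν i) g (![0, charFn (stabGp (W.H 1) Λ ×ˢ stabGp (W.G 1) (extLattice Λ))] i) =
      orbU (ν i) (quot g : Matrix (Idx m) (Idx m) F)
        (![0, charFn (toMat (stabGp (W.G 1) (extLattice Λ)))] i) := by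
    intro i g hg
    fin_cases i
    · simp [orbUHom, orbU]
    · exact orbUHom_charFn D (isClopen_of_mulVec_mem_iff hT) (ν 1) hν g hg
  have hL := fun γ : GL (Fin m) F × GL (Idx m) F => orbLinHom_charFn D μ μn hμn μF hμF γ
  constructor
  · intro H i g hg hgrs γ hγ hγrs hm
    -- By Hilbert 90 every γ ∈ S is r(γ'), so the pairs (1, γ') and (1, g) recover the inhomogeneous
    -- statement.
    obtain ⟨γ', rfl⟩ := D.exists_rMap_eq hγ
    have hq : ∀ y : GL (Idx m) F, quot ((1 : GL (Fin m) F), y) = y := fun y => by simp [quot]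
    have h := H i (1, g) (one_mem _) hg (by rwa [hq]) (1, γ') (by rwa [hq]) (by rwa [hq, hq])
    rw [hU i _ (one_mem _), hL, ← mul_assoc, omegaG_mul_etaTilde_pow, hq, hq] at h
    exact h
  · intro H i g hg1 hg2 hgrs γ hγrs hm
    have hqg : quot g ∈ W.G i := by
      refine mul_mem (inv_mem ?_) hg2
      have hh' : (g.1 : Matrix (Fin m) (Fin m) F)ᵀ * W.J i *
        (g.1 : Matrix (Fin m) (Fin m) F).map σ = W.J i := hg1
      change _ * _ * _ = _
      rw [extForm_conj, hh']
    rw [hU i _ hg1, hL, ← mul_assoc, omegaG_mul_etaTilde_pow]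
    exact H i _ hqg hgrs _ (D.rMap_mem_symSpace _) hγrs hm

end LinearSide

/-! ## The main theorem -/

theorem properSpace_of_finrank_eq_two {F₀ F : Type*} [NormedField F₀] [NormedField F]
    [NormedAlgebra F₀ F] [ProperSpace F₀] {ϖ : F₀} (hϖ : IsUniformizer ϖ)
    (hdeg : Module.finrank F₀ F = 2) : ProperSpace F := by
  have : FiniteDimensional F₀ F := Module.finite_of_finrank_eq_succ hdeg
  let _ : NontriviallyNormedField F₀ := { ‹NormedField F₀› with
    non_trivial := ⟨ϖ⁻¹, by rw [norm_inv]; exact (one_lt_inv₀ hϖ.norm_pos).2 hϖ.2.1⟩ }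
  exact FiniteDimensional.proper F₀ F

end UnramFL

end

theorem mainTheorem7 (p : ℕ) [Fact p.Prime] (hp : p ≠ 2)
    {F₀ F : Type*} [NormedField F₀] [NormedAlgebra ℚ_[p] F₀] [FiniteDimensional ℚ_[p] F₀]
    [NormedField F] [NormedAlgebra F₀ F] [IsUltrametricDist F₀] [IsUltrametricDist F]
    (hdeg : Module.finrank F₀ F = 2) (hunr : IsUnramifiedExt F₀ F)
    (σ : F ≃ₐ[F₀] F) (hσ : σ ≠ AlgEquiv.refl)
    (ϖ : F₀) (hϖ : IsUniformizer ϖ)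
    (m : ℕ) (hm : 1 ≤ m)
    -- normalized Haar measures on the general linear groups
    (μ : Measure (GL (Fin m) F₀)) [μ.IsHaarMeasure] (hμ : μ (integralGL (Fin m) F₀) = 1)
    (μn : Measure (GL (Idx m) F₀)) [μn.IsHaarMeasure] (hμn : μn (integralGL (Idx m) F₀) = 1)
    (μF : Measure (GL (Fin m) F)) [μF.IsHaarMeasure] (hμF : μF (integralGL (Fin m) F) = 1)
    -- the almost self-dual case: special vectors of norm `ϖ`
    (W : HermPair σ m ϖ) (Λ : Submodule (intRing F) (Fin m → F)) (hΛ : IsSelfDual σ (W.J 1) Λ)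
    (ν : ∀ i, Measure (W.H i)) [∀ i, (ν i).IsHaarMeasure]
    (hν : ν 1 {h | (h : GL (Fin m) F) ∈ stabGp (W.H 1) Λ} = 1)
    -- the self-dual case: special vectors of unit norm `ε`
    (ε : F₀) (hε : ‖ε‖ = 1)
    (W' : HermPair σ m ε) (Λ' : Submodule (intRing F) (Fin m → F))
    (hΛ' : IsSelfDual σ (W'.J 0) Λ')
    (ν' : ∀ i, Measure (W'.H i)) [∀ i, (ν' i).IsHaarMeasure]
    (hν' : ν' 0 {h | (h : GL (Fin m) F) ∈ stabGp (W'.H 0) Λ'} = 1) :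
    (LieFL ϖ μ W' Λ' ν' ↔ LieAFL ϖ μ W Λ ν) ∧
    (HomAFL ϖ μF μ μn W Λ ν ↔ InhomAFL ϖ μ W Λ ν) ∧
    (m + 1 ≤ residueCard F₀ → LieAFL ϖ μ W Λ ν →
      HomAFL ϖ μF μ μn W Λ ν ∧ InhomAFL ϖ μ W Λ ν) := by
  have : ProperSpace F₀ := FiniteDimensional.proper ℚ_[p] F₀
  have : ProperSpace F := properSpace_of_finrank_eq_two hϖ hdeg
  have D := UnramifiedQuadratic.of_padic p hp hdeg hunr σ hσ ϖ hϖ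
  have hom_iff := homAFL_iff_inhomAFL D μ μn hμn μF hμF W Λ hΛ ν hν
  refine ⟨lieFL_iff_lieAFL D μ W Λ hΛ ν hν ε hε W' Λ' hΛ' ν' hν', hom_iff, fun hq H => ?_⟩
  have hinhom := inhomAFL_of_lieAFL D μ W Λ hΛ ν hq H
  exact ⟨hom_iff.2 hinhom, hinhom⟩
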